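/- **Notation.** Let $f\in\mathbb R[x_1,\dots,x_n]$ be homogeneous of degree $d$ and put $\|f\|_2:=\sup_{\|x\|=1}|f(x)|$ (Euclidean norm on $\mathbb R^n$). For a homogeneous polynomial $h$ of even degree $q$, a *matrix representation* of $h$ is a real symmetric matrix $M$ with rows and columns indexed by $[n]^{q/2}$ such that $(x^{\otimes q/2})^T M\,x^{\otimes q/2}=h(x)$ for all $x\in\mathbb R^n$, and $$\Lambda(h):=\inf\Big\{\sup_{\|z\|_2=1}z^TMz\;:\;M\text{ is a matrix representation of }h\Big\}.$$ A *degree-$q$ pseudoexpectation* is a linear functional $\widetilde{\mathbf E}$ on the real polynomials of degree at most $q$ with $\widetilde{\mathbf E}[1]=1$ and $\widetilde{\mathbf E}[p^2]\ge 0$ whenever $\deg p^2\le q$. It *respects* a system $C$ of constraints $f_i=0$, $g_j\ge 0$ if $\widetilde{\mathbf E}[p f_i]=0$ whenever $\deg(pf_i)\le q$, and $\widetilde{\mathbf E}[p^2\prod_{j\in S}g_j]\ge 0$ for every finite set $S$ of indices and every $p$ with $\deg(p^2\prod_{j\in S}g_j)\le q$. For $h$ homogeneous of degree $q$, $\Lambda_C(h)$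 is the supremum of $\widetilde{\mathbf E}[h]$ over all degree-$q$ pseudoexpectations respecting $C$. **Theorem.** There is an absolute constant $K>0$ such that the following holds for all integers $n,d,q\ge 1$ with $q\le n$ and $2d\mid q$, and every homogeneous $f\in\mathbb R[x_1,\dots,x_n]$ of degree $d$. Let $m$ be the number of non-zero coefficients of $f$, and let $C=\{\|x\|_2^2=1\}\cup\{x^\beta\ge 0:\beta\in\mathbb N^n,\ |\beta|=2q/d\}$. 1. If $d\ge 2$, then $\Lambda(f^{q/d})^{d/q}\le K^d\,(n/q)^{d/2-1}\,\|f\|_2$. 2. If $d\ge 2$ and $f$ has non-negative coefficients, then $\Lambda_C(f^{q/d})^{d/q}\le K^d\,(n/q)^{d/4-1/2}\,\|f\|_2$. 3. $\Lambda(f^{q/d})^{d/q}\le K^d\sqrt{\max(1,m/q)}\;\|f\|_2$; in particular the factor is $K^d\sqrt{m/q}$ when $m\ge q$. Furthermore, there is a deterministic algorithm (one program for a real random access machine with unit-cost exact operations $+,-,\times,/,\sqrt{\cdot}$ and comparisons on reals), which on input $n$, $d$, $q$ and the list of monomials and non-zero coefficients of $f$ halts after at most $n^{O(q)}$ steps (with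 an absolute constant in the exponent) and returns a vector $x\in\mathbb R^n$ with $\|x\|=1$ such that $$|f(x)|\ \ge\ \frac{\Lambda(f^{q/d})^{d/q}}{K^d (n/q)^{d/2-1}}\ \ (d\ge 2),\qquad |f(x)|\ \ge\ \frac{\Lambda(f^{q/d})^{d/q}}{K^d\sqrt{\max(1,m/q)}},$$ and, if $d\ge 2$ and $f$ has non-negative coefficients, also $$|f(x)|\ \ge\ \frac{\Lambda_C(f^{q/d})^{d/q}}{K^d (n/q)^{d/4-1/2}}.$$ -/

import Mathlib

/-! ## Polynomials on the sphere and their sum-of-squares relaxations -/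

noncomputable section

namespace SphereOpt

open MvPolynomial

/-- `‖f‖₂ = sup_{‖x‖ = 1} |f x|`. -/
def supNorm {n : ℕ} (f : MvPolynomial (Fin n) ℝ) : ℝ :=
  ⨆ x : Metric.sphere (0 : EuclideanSpace ℝ (Fin n)) 1, |eval (fun i => x.1 i) f|

/-- The vector `x^{⊗k}`, indexed by the tuples in `[n]^k`. -/
def tensorPow {n : ℕ} (k : ℕ) (x : Fin n → ℝ) : (Fin k → Fin n) → ℝ :=
  fun I => ∏ j, x (I j)

/-- `M` is a (symmetric) matrix representation of the polynomial `h` of degree `2k`: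
`(x^{⊗k})ᵀ M x^{⊗k} = h x` for all `x`. -/
def IsMatrixRep {n : ℕ} (k : ℕ) (h : MvPolynomial (Fin n) ℝ)
    (M : Matrix (Fin k → Fin n) (Fin k → Fin n) ℝ) : Prop :=
  M.IsSymm ∧ ∀ x : Fin n → ℝ, tensorPow k x ⬝ᵥ M.mulVec (tensorPow k x) = eval x h

/-- `sup_{‖z‖ = 1} zᵀ M z` (Euclidean norm). -/
def maxQuadForm {ι : Type*} [Fintype ι] (M : Matrix ι ι ℝ) : ℝ :=
  ⨆ z : Metric.sphere (0 : EuclideanSpace ℝ ι) 1, (fun i => z.1 i) ⬝ᵥ M.mulVec (fun i => z.1 i)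

/-- `Λ(h)` for `h` homogeneous of degree `2k`: the infimum, over all matrix representations `M`
of `h`, of `sup_{‖z‖ = 1} zᵀ M z`. -/
def sosValue {n : ℕ} (k : ℕ) (h : MvPolynomial (Fin n) ℝ) : ℝ :=
  ⨅ M : {M : Matrix (Fin k → Fin n) (Fin k → Fin n) ℝ // IsMatrixRep k h M}, maxQuadForm M.1

/-- A degree-`D` pseudoexpectation: a linear functional on the polynomials of degree at most `D`
which is normalized and non-negative on squares. -/
structure IsPseudoexpectation {n D : ℕ} (E : restrictTotalDegree (Fin n) ℝ D →ₗ[ℝ] ℝ) :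
    Prop where
  map_one : ∀ h : (1 : MvPolynomial (Fin n) ℝ) ∈ restrictTotalDegree (Fin n) ℝ D, E ⟨1, h⟩ = 1
  sq_nonneg : ∀ (p : MvPolynomial (Fin n) ℝ) (h : p ^ 2 ∈ restrictTotalDegree (Fin n) ℝ D),
    0 ≤ E ⟨p ^ 2, h⟩

/-- The constant `1` has degree at most `D`, so `IsPseudoexpectation.map_one` is not vacuous. -/
theorem one_mem_restrictTotalDegree (n D : ℕ) :
    (1 : MvPolynomial (Fin n) ℝ) ∈ restrictTotalDegree (Fin n) ℝ D := by
  rw [mem_restrictTotalDegree, totalDegree_one]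
  exact Nat.zero_le D

/-- The functional `E` respects the constraints `p = 0` for `p ∈ eqs` and `g ≥ 0` for `g ∈ ineqs`
(up to degree `D`). -/
structure Respects {n D : ℕ} (E : restrictTotalDegree (Fin n) ℝ D →ₗ[ℝ] ℝ)
    (eqs ineqs : Set (MvPolynomial (Fin n) ℝ)) : Prop where
  eq_zero : ∀ g ∈ eqs, ∀ (p : MvPolynomial (Fin n) ℝ)
    (h : p * g ∈ restrictTotalDegree (Fin n) ℝ D), E ⟨p * g, h⟩ = 0
  nonneg : ∀ S : Finset (MvPolynomial (Fin n) ℝ), (∀ g ∈ S, g ∈ ineqs) →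
    ∀ (p : MvPolynomial (Fin n) ℝ)
      (h : p ^ 2 * ∏ g ∈ S, g ∈ restrictTotalDegree (Fin n) ℝ D),
      0 ≤ E ⟨p ^ 2 * ∏ g ∈ S, g, h⟩

/-- The equality constraint `‖x‖₂² = 1`. -/
def sphereConstraint (n : ℕ) : Set (MvPolynomial (Fin n) ℝ) :=
  {∑ i, X i ^ 2 - 1}

/-- The moment non-negativity constraints `x^β ≥ 0` for all multi-indices `β` with `|β| = e`. -/
def momentConstraints (n e : ℕ) : Set (MvPolynomial (Fin n) ℝ) :=
  {g | ∃ β : Fin n →₀ ℕ, β.degree = e ∧ g = monomial β 1}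

/-- `Λ_C(h)` for `C = {‖x‖₂² = 1} ∪ {x^β ≥ 0 : |β| = e}`: the supremum of `E h` over all
degree-`D` pseudoexpectations `E` respecting `C`. -/
def constrainedSosValue {n : ℕ} (D e : ℕ) (h : MvPolynomial (Fin n) ℝ) : ℝ :=
  sSup {v | ∃ E : restrictTotalDegree (Fin n) ℝ D →ₗ[ℝ] ℝ,
    IsPseudoexpectation E ∧ Respects E (sphereConstraint n) (momentConstraints n e) ∧
      ∃ hh : h ∈ restrictTotalDegree (Fin n) ℝ D, E ⟨h, hh⟩ = v}

end SphereOpt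

/-! ## A real random access machine

Programs handle natural numbers (for indices and counters, with addition and truncated
subtraction only) and real numbers (with exact `+`, `-`, `*`, `/`, `√` and comparison), stored in
finitely many variables and arrays; the only numerical constants are natural numbers and there is
no rounding of reals to integers. Every elementary operation has unit cost. -/

namespace RealRAM

/-- Contents of the variables and of the arrays; variables and arrays are named by numbers that
are fixed in the program, and array cells are addressed by computed natural numbers. -/
structure State where
  nat : ℕ → ℕ
  real : ℕ → ℝ
  natArr : ℕ → ℕ → ℕ
  realArr : ℕ → ℕ → ℝ

/-- Expressions with values in `ℕ`. -/
inductive NExp : Type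
  | lit (k : ℕ)
  | var (i : ℕ)
  | get (a : ℕ) (e : NExp)
  | add (e₁ e₂ : NExp)
  | sub (e₁ e₂ : NExp)

/-- Value of an expression. -/
def NExp.eval (s : State) : NExp → ℕ
  | lit k => k
  | var i => s.nat i
  | get a e => s.natArr a (e.eval s)
  | add e₁ e₂ => e₁.eval s + e₂.eval s
  | sub e₁ e₂ => e₁.eval s - e₂.eval s

/-- Cost of evaluating an expression: the number of its nodes. -/
def NExp.cost : NExp → ℕ
  | lit _ => 1
  | var _ => 1
  | get _ e => e.cost + 1
  | add e₁ e₂ => e₁.cost + e₂.cost + 1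
  | sub e₁ e₂ => e₁.cost + e₂.cost + 1

/-- Expressions with values in `ℝ`. -/
inductive RExp : Type
  | ofNat (e : NExp)
  | var (i : ℕ)
  | get (a : ℕ) (e : NExp)
  | add (r₁ r₂ : RExp)
  | sub (r₁ r₂ : RExp)
  | mul (r₁ r₂ : RExp)
  | div (r₁ r₂ : RExp)
  | sqrt (r : RExp)

/-- Value of an expression (`x / 0 = 0`, and `√x = 0` for `x < 0`). -/
def RExp.eval (s : State) : RExp → ℝ
  | ofNat e => (e.eval s : ℝ)
  | var i => s.real i
  | get a e => s.realArr a (e.eval s)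
  | add r₁ r₂ => r₁.eval s + r₂.eval s
  | sub r₁ r₂ => r₁.eval s - r₂.eval s
  | mul r₁ r₂ => r₁.eval s * r₂.eval s
  | div r₁ r₂ => r₁.eval s / r₂.eval s
  | sqrt r => Real.sqrt (r.eval s)

/-- Cost of evaluating an expression: the number of its nodes. -/
def RExp.cost : RExp → ℕ
  | ofNat e => e.cost + 1
  | var _ => 1
  | get _ e => e.cost + 1
  | add r₁ r₂ => r₁.cost + r₂.cost + 1
  | sub r₁ r₂ => r₁.cost + r₂.cost + 1
  | mul r₁ r₂ => r₁.cost + r₂.cost + 1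
  | div r₁ r₂ => r₁.cost + r₂.cost + 1
  | sqrt r => r.cost + 1

/-- Programs. -/
inductive Prog : Type
  | skip
  | setNat (i : ℕ) (e : NExp)
  | setReal (i : ℕ) (r : RExp)
  | putNat (a : ℕ) (e v : NExp)
  | putReal (a : ℕ) (e : NExp) (v : RExp)
  | seq (P Q : Prog)
  /-- `if e₁ ≤ e₂ then P else Q`, for natural numbers -/
  | ifNat (e₁ e₂ : NExp) (P Q : Prog)
  /-- `if r₁ ≤ r₂ then P else Q`, for real numbers -/
  | ifReal (r₁ r₂ : RExp) (P Q : Prog)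
  /-- `while e₁ < e₂ do P`, for natural numbers -/
  | whileLt (e₁ e₂ : NExp) (P : Prog)

/-- `Exec P s t s'`: started in the state `s`, the program `P` halts after exactly `t` steps, in
the state `s'`. -/
inductive Exec : Prog → State → ℕ → State → Prop
  | skip (s : State) : Exec .skip s 1 s
  | setNat (i : ℕ) (e : NExp) (s : State) :
      Exec (.setNat i e) s (e.cost + 1) { s with nat := Function.update s.nat i (e.eval s) }
  | setReal (i : ℕ) (r : RExp) (s : State) :
      Exec (.setReal i r) s (r.cost + 1) { s with real := Function.update s.real i (r.eval s) }
  | putNat (a : ℕ) (e v : NExp) (s : State) :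
      Exec (.putNat a e v) s (e.cost + v.cost + 1)
        { s with natArr := Function.update s.natArr a
                  (Function.update (s.natArr a) (e.eval s) (v.eval s)) }
  | putReal (a : ℕ) (e : NExp) (v : RExp) (s : State) :
      Exec (.putReal a e v) s (e.cost + v.cost + 1)
        { s with realArr := Function.update s.realArr a
                  (Function.update (s.realArr a) (e.eval s) (v.eval s)) }
  | seq {P Q : Prog} {s s' s'' : State} {t t' : ℕ} :
      Exec P s t s' → Exec Q s' t' s'' → Exec (.seq P Q) s (t + t') s''
  | ifNatTrue {e₁ e₂ : NExp} {P Q : Prog} {s s' : State} {t : ℕ} :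
      e₁.eval s ≤ e₂.eval s → Exec P s t s' →
      Exec (.ifNat e₁ e₂ P Q) s (e₁.cost + e₂.cost + 1 + t) s'
  | ifNatFalse {e₁ e₂ : NExp} {P Q : Prog} {s s' : State} {t : ℕ} :
      ¬ e₁.eval s ≤ e₂.eval s → Exec Q s t s' →
      Exec (.ifNat e₁ e₂ P Q) s (e₁.cost + e₂.cost + 1 + t) s'
  | ifRealTrue {r₁ r₂ : RExp} {P Q : Prog} {s s' : State} {t : ℕ} :
      r₁.eval s ≤ r₂.eval s → Exec P s t s' →
      Exec (.ifReal r₁ r₂ P Q) s (r₁.cost + r₂.cost + 1 + t) s'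
  | ifRealFalse {r₁ r₂ : RExp} {P Q : Prog} {s s' : State} {t : ℕ} :
      ¬ r₁.eval s ≤ r₂.eval s → Exec Q s t s' →
      Exec (.ifReal r₁ r₂ P Q) s (r₁.cost + r₂.cost + 1 + t) s'
  | whileDone {e₁ e₂ : NExp} {P : Prog} {s : State} :
      ¬ e₁.eval s < e₂.eval s → Exec (.whileLt e₁ e₂ P) s (e₁.cost + e₂.cost + 1) s
  | whileStep {e₁ e₂ : NExp} {P : Prog} {s s' s'' : State} {t t' : ℕ} :
      e₁.eval s < e₂.eval s → Exec P s t s' → Exec (.whileLt e₁ e₂ P) s' t' s'' →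
      Exec (.whileLt e₁ e₂ P) s (e₁.cost + e₂.cost + 1 + t + t') s''

/-- Programs are deterministic. -/
theorem Exec.deterministic {P : Prog} {s s₁ s₂ : State} {t₁ t₂ : ℕ}
    (h₁ : Exec P s t₁ s₁) (h₂ : Exec P s t₂ s₂) : t₁ = t₂ ∧ s₁ = s₂ := by
  induction h₁ generalizing t₂ s₂ with
  | skip | setNat | setReal | putNat | putReal => cases h₂; exact ⟨rfl, rfl⟩
  | seq _ _ ih ih' =>
    cases h₂ with
    | seq a b =>
      obtain ⟨rfl, rfl⟩ := ih a
      obtain ⟨rfl, rfl⟩ := ih' b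
      exact ⟨rfl, rfl⟩
  | ifNatTrue h _ ih =>
    cases h₂ with
    | ifNatTrue _ a => obtain ⟨rfl, rfl⟩ := ih a; exact ⟨rfl, rfl⟩
    | ifNatFalse h' _ => exact absurd h h'
  | ifNatFalse h _ ih =>
    cases h₂ with
    | ifNatTrue h' _ => exact absurd h' h
    | ifNatFalse _ a => obtain ⟨rfl, rfl⟩ := ih a; exact ⟨rfl, rfl⟩
  | ifRealTrue h _ ih =>
    cases h₂ with
    | ifRealTrue _ a => obtain ⟨rfl, rfl⟩ := ih a; exact ⟨rfl, rfl⟩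
    | ifRealFalse h' _ => exact absurd h h'
  | ifRealFalse h _ ih =>
    cases h₂ with
    | ifRealTrue h' _ => exact absurd h' h
    | ifRealFalse _ a => obtain ⟨rfl, rfl⟩ := ih a; exact ⟨rfl, rfl⟩
  | whileDone h =>
    cases h₂ with
    | whileDone _ => exact ⟨rfl, rfl⟩
    | whileStep h' _ _ => exact absurd h' h
  | whileStep h _ _ ih ih' =>
    cases h₂ with
    | whileDone h' => exact absurd h h'
    | whileStep _ a b =>
      obtain ⟨rfl, rfl⟩ := ih a
      obtain ⟨rfl, rfl⟩ := ih' b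
      exact ⟨rfl, rfl⟩

/-- The state `s` holds the input `(n, d, q, f)`: the variables `0, 1, 2, 3` hold `n`, `d`, `q`
and the number `m` of monomials of `f`; for some enumeration `μ₀, …, μ_{m-1}` of the monomials
with non-zero coefficient, the real array `0` lists the coefficients, and the array `0` of natural
numbers lists the exponent vectors, one after the other. Nothing is assumed about the rest of the
memory. -/
def HoldsInput (s : State) (n d q : ℕ) (f : MvPolynomial (Fin n) ℝ) : Prop :=
  s.nat 0 = n ∧ s.nat 1 = d ∧ s.nat 2 = q ∧ s.nat 3 = f.support.card ∧
    ∃ μ : Fin f.support.card ≃ f.support, ∀ j : Fin f.support.card,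
      s.realArr 0 j = f.coeff (μ j : Fin n →₀ ℕ) ∧
        ∀ i : Fin n, s.natArr 0 (j * n + i) = (μ j : Fin n →₀ ℕ) i

/-- The vector in `ℝⁿ` that is returned: the first `n` cells of the real array `1`. -/
def output (n : ℕ) (s : State) : EuclideanSpace ℝ (Fin n) :=
  WithLp.toLp 2 fun i => s.realArr 1 i

end RealRAM

end

/-! Everything is proved with `‖f‖₂` replaced by any `N ≥ 0` such that `|f u| ≤ N ‖u‖^d` on an
explicit family of `n^{O(q)}` vectors (`CandidateBound`). A program runs through the family and
returns the best direction `x`, so the bounds hold with `N = |f x|`. As `|f x| ≤ ‖f‖₂`, the three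
inequalities follow from the correctness of the algorithm.

Write `q = 2ρd`, let `F` be the symmetric `d`-linear form of `f`, and put `Q_t(x) = F(t,…,t,x,x)`.
For quadratic forms a bound on the sphere is a sum-of-squares bound, so `Q_t^{2ρ}` is bounded by
`Θ^{2ρ} ‖x‖^{4ρ}` modulo squares, with `Θ = O(1)^d N`, for every base point `t` of the family with
`‖t‖ ≤ 1`. As a function of `t`, `Q_t(x)^{2ρ}` has a symmetric coefficient tensor `T_K(x)`, with `K`
of length `2s`, `s = ρ(d-2)`, and putting `t = x` gives `f^{2ρ} = ∑_{I,J} x^I x^J T_{IJ}(x)`.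
Polarization at basis vectors `e_{K_j}`, scaled down by the square roots of `9q` and of the
multiplicity of `K_j`, bounds every `T_K` modulo squares (`sosBdd_mform_powTensor`). All subset sums
stay in the unit ball, and the loss is essentially `√(I! J!)`, where `I!` is the product of the
factorials of the multiplicities.

General `f`: weighted AM-GM with weights `√I!` bounds `f^{2ρ}` by a constant times `∑ I! =
n(n+1)⋯(n+s-1) ≤ (2n)^s` (`mem_sosCone_of_sosBdd`), which leaves `(n/q)^s` and hence `(n/q)^{d/2-1}`
after the root. Non-negative coefficients: the `T_K` have non-negative coefficients, so the moment
constraints allow weighted row sums instead (`ExtPseudo.map_mform_le`). The weights are dominated by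
a positive combination of tensor powers of peaked vectors (`prod_multiplicity_le_peak`), which
polarization can handle again, and only `(n/q)^{s/2}` is lost. Sparse `f`: all `q` positions of
`f^{2ρ}` are polarized, and the Frobenius norm of the flattened tensor is bounded by counting orbits
and the monomials of `f^{2ρ}`.

The base points depend only on vectors of multiplicities with sum `O(q)`, which makes the family
small. The spectral norm of `Q_t` is controlled by `n` steps of power iteration from every basis
vector (`nrm_mulVec_le_of_powerIteration`), and each step is computed from values of `f` by finite
differences. The multiplicities are enumerated as digit counts of the numbers below `(n+5)^{6q}`;
this number bounds every loop, and the nesting depth is fixed. -/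

noncomputable section

namespace SphereOpt

open MvPolynomial Finset Matrix
open scoped Nat

/-! ### Symmetric tensors and polarization -/

section Tensor

variable {ι : Type*} [Fintype ι] [DecidableEq ι] {n : ℕ} {A : Type*} [CommRing A]

/-- The multilinear form with coefficient tensor `T`. -/
def mform (T : (ι → Fin n) → A) (v : ι → Fin n → A) : A := ∑ L, T L * ∏ j, v j (L j)

/-- Invariance of a tensor under permutations of its positions. -/
def IsSymmTensor (T : (ι → Fin n) → A) : Prop := ∀ (σ : Equiv.Perm ι) L, T (L ∘ σ) = T L

theorem mform_comp_perm {T : (ι → Fin n) → A} (hT : IsSymmTensor T) (σ : Equiv.Perm ι)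
    (v : ι → Fin n → A) : mform T (v ∘ σ) = mform T v := by
  unfold mform
  refine (Fintype.sum_equiv (Equiv.arrowCongr σ.symm (Equiv.refl _)) _ _ fun L => ?_).symm
  have h : (Equiv.arrowCongr σ.symm (Equiv.refl (Fin n))) L = L ∘ σ := by ext; simp
  rw [h, hT σ L]
  congr 1
  exact (Equiv.prod_comp σ (fun j => v j (L j))).symm

/-- By complements this is the alternating sum over the subsets of `Rᶜ`, which vanishes unless `Rᶜ`
is empty. It is the inclusion-exclusion behind polarization. -/
theorem sum_superset_sign (R : Finset ι) :
    ∑ S : Finset ι, (if R ⊆ S then (-1 : A) ^ #Sᶜ else 0) = if R = univ then 1 else 0 := by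
  have h := Finset.sum_powerset_neg_one_pow_card (x := Rᶜ)
  have h2 : ∑ S : Finset ι, (if R ⊆ S then (-1 : ℤ) ^ #Sᶜ else 0) = if R = univ then 1 else 0 := by
    rw [← sum_filter]
    have : (if R = univ then (1 : ℤ) else 0) = if Rᶜ = ∅ then 1 else 0 := by simp
    rw [this, ← h]
    refine sum_nbij' (fun S => Sᶜ) (fun S => Sᶜ) ?_ ?_ ?_ ?_ ?_
    · intro S hS; simpa using hS
    · intro S hS
      simp only [mem_powerset] at hS
      simp only [mem_filter, mem_univ, true_and]
      simpa using compl_subset_compl.mpr hS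
    · simp
    · simp
    · simp
  have h3 := congrArg (Int.cast : ℤ → A) h2
  push_cast at h3
  simpa using h3

theorem sum_bijective_eq_sum_perm (G : (ι → ι) → A) :
    (∑ w : ι → ι, if univ.image w = univ then G w else 0) = ∑ σ : Equiv.Perm ι, G σ := by
  rw [← sum_filter]
  symm
  refine sum_bij (fun σ _ => (σ : ι → ι)) ?_ ?_ ?_ ?_
  · intro σ _
    simp only [mem_filter, mem_univ, true_and]
    exact Finset.image_univ_of_surjective σ.surjective
  · intro σ _ τ _ h
    exact Equiv.coe_fn_injective h
  · intro w hw
    simp only [mem_filter, mem_univ, true_and] at hw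
    have hs : Function.Surjective w := by
      intro y
      have : y ∈ univ.image w := by rw [hw]; exact mem_univ _
      simpa using this
    exact ⟨Equiv.ofBijective w (Finite.surjective_iff_bijective.1 hs), mem_univ _, rfl⟩
  · intros; rfl

/-- Expanding at a subset sum gives one term for each map `w` with image in `S`. The signed sum over
`S` keeps the surjective `w` only, that is, the permutations, and by symmetry their terms agree. The
ring is general because the formula serves both real tensors and tensors of polynomials. -/
theorem polarization {T : (ι → Fin n) → A} (hT : IsSymmTensor T)
    (v : ι → Fin n → A) :
    ((Fintype.card ι)! : A) * mform T v =
      ∑ S : Finset ι, (-1) ^ #Sᶜ * mform T (fun _ => ∑ j ∈ S, v j) := by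
  have key : ∀ S : Finset ι, mform T (fun _ => ∑ j ∈ S, v j) =
      ∑ w : ι → ι, if univ.image w ⊆ S then mform T (v ∘ w) else 0 := by
    intro S
    simp only [mform, Finset.sum_apply]
    simp_rw [Finset.prod_univ_sum, mul_sum]
    rw [sum_comm, ← sum_filter]
    refine sum_congr ?_ fun w _ => rfl
    ext w
    simp [Finset.image_subset_iff]
  simp_rw [key, mul_sum]
  rw [sum_comm]
  have : ∀ w : ι → ι, (∑ S : Finset ι, (-1 : A) ^ #Sᶜ *
      (if univ.image w ⊆ S then mform T (v ∘ w) else 0)) =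
      if univ.image w = univ then mform T (v ∘ w) else 0 := by
    intro w
    have h := sum_superset_sign (A := A) (univ.image w)
    calc _ = (∑ S : Finset ι, (if univ.image w ⊆ S then (-1 : A) ^ #Sᶜ else 0)) *
          mform T (v ∘ w) := by
          rw [sum_mul]; refine sum_congr rfl fun S _ => ?_
          split_ifs <;> simp
      _ = _ := by rw [h]; split_ifs <;> simp
  simp_rw [this]
  rw [sum_bijective_eq_sum_perm (fun w => mform T (v ∘ w))]
  simp_rw [mform_comp_perm hT]
  simp [Fintype.card_perm]

/-- Symmetrization of a tensor. -/
def symmetrize [Algebra ℝ A] (T : (ι → Fin n) → A) : (ι → Fin n) → A :=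
  fun L => ((Fintype.card ι)! : ℝ)⁻¹ • ∑ σ : Equiv.Perm ι, T (L ∘ σ)

theorem isSymmTensor_symmetrize [Algebra ℝ A] (T : (ι → Fin n) → A) :
    IsSymmTensor (symmetrize T) := by
  intro τ L
  unfold symmetrize
  congr 1
  exact Fintype.sum_equiv (Equiv.mulLeft τ) _ _ fun σ => rfl

theorem mform_symmetrize_const [Algebra ℝ A] (T : (ι → Fin n) → A)
    (x : Fin n → A) : mform (symmetrize T) (fun _ => x) = mform T (fun _ => x) := by
  have h : ∀ σ : Equiv.Perm ι, ∑ L : ι → Fin n, T (L ∘ σ) * ∏ j, x (L j) =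
      ∑ L : ι → Fin n, T L * ∏ j, x (L j) := by
    intro σ
    refine Fintype.sum_equiv (Equiv.arrowCongr σ.symm (Equiv.refl _)) _ _ fun L => ?_
    have h : (Equiv.arrowCongr σ.symm (Equiv.refl (Fin n))) L = L ∘ σ := by ext; simp
    rw [h]
    congr 1
    exact (Equiv.prod_comp σ (fun j => x (L j))).symm
  unfold mform symmetrize
  simp_rw [smul_mul_assoc, sum_mul]
  rw [← smul_sum, sum_comm]
  simp_rw [h]
  simp only [sum_const, card_univ, Fintype.card_perm]
  rw [← Nat.cast_smul_eq_nsmul ℝ, smul_smul, inv_mul_cancel₀ (by positivity), one_smul]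

end Tensor

/-! ### The symmetric tensor of a homogeneous polynomial -/

section PolyTensor

variable {ι : Type*} [Fintype ι] {n : ℕ}

/-- The exponent vector of the monomial `∏ j, X (L j)`. -/
def tupleType (L : ι → Fin n) : Fin n →₀ ℕ := ∑ j, Finsupp.single (L j) 1

theorem tupleType_comp_equiv {κ : Type*} [Fintype κ] (L : ι → Fin n) (e : κ ≃ ι) :
    tupleType (L ∘ e) = tupleType L :=
  Equiv.sum_comp e (fun j => Finsupp.single (L j) 1)

theorem tupleType_apply [DecidableEq (Fin n)] (L : ι → Fin n) (i : Fin n) :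
    tupleType L i = #{j | L j = i} := by
  rw [tupleType, Finsupp.finsetSum_apply, Finset.card_filter]
  exact sum_congr rfl fun j _ => Finsupp.single_apply

theorem degree_tupleType (L : ι → Fin n) : (tupleType L).degree = Fintype.card ι := by
  simp [tupleType, Finsupp.degree_single]

theorem prod_X_eq_monomial (L : ι → Fin n) :
    ∏ j, (X (L j) : MvPolynomial (Fin n) ℝ) = monomial (tupleType L) 1 := by
  rw [tupleType, MvPolynomial.monomial_sum_one]
  rfl

theorem exists_tupleType_eq (μ : Fin n →₀ ℕ) (h : μ.degree = Fintype.card ι) :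
    ∃ L : ι → Fin n, tupleType L = μ := by
  have key : ∀ (d : ℕ) (μ : Fin n →₀ ℕ), μ.degree = d →
      ∃ L : Fin d → Fin n, tupleType L = μ := by
    intro d
    induction d with
    | zero =>
      intro μ h
      refine ⟨Fin.elim0, ?_⟩
      rw [Finsupp.degree_eq_zero_iff] at h
      simp [tupleType, h]
    | succ d ih =>
      intro μ h
      have hne : μ ≠ 0 := by rintro rfl; simp at h
      obtain ⟨i, hi⟩ := Finsupp.ne_iff.1 hne
      have hle : Finsupp.single i 1 ≤ μ := by
        rw [Finsupp.single_le_iff]; exact Nat.one_le_iff_ne_zero.2 (by simpa using hi)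
      have hadd := tsub_add_cancel_of_le hle
      have hdeg : (μ - Finsupp.single i 1).degree = d := by
        have := congrArg Finsupp.degree hadd
        rw [map_add, Finsupp.degree_single, h] at this
        omega
      obtain ⟨L, hL⟩ := ih _ hdeg
      refine ⟨Fin.cons i L, ?_⟩
      rw [← hadd, ← hL]
      simp [tupleType, Fin.sum_univ_succ, add_comm]
  obtain ⟨L, hL⟩ := key _ μ h
  exact ⟨L ∘ Fintype.equivFin ι, by rw [tupleType_comp_equiv, hL]⟩

variable [DecidableEq ι]

/-- The symmetric tensor with `f = ∑ L, T L * ∏ j, X (L j)`. -/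
def polyTensor (ι : Type*) [Fintype ι] [DecidableEq ι] (f : MvPolynomial (Fin n) ℝ)
    (L : ι → Fin n) : ℝ :=
  f.coeff (tupleType L) / #{L' : ι → Fin n | tupleType L' = tupleType L}

theorem isSymmTensor_polyTensor (f : MvPolynomial (Fin n) ℝ) :
    IsSymmTensor (polyTensor ι f) := by
  intro σ L
  unfold polyTensor
  rw [tupleType_comp_equiv L σ]

theorem polyTensor_nonneg {f : MvPolynomial (Fin n) ℝ} (hf : ∀ μ, 0 ≤ f.coeff μ)
    (L : ι → Fin n) : 0 ≤ polyTensor ι f L :=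
  div_nonneg (hf _) (Nat.cast_nonneg _)

theorem tupleType_mem_support {f : MvPolynomial (Fin n) ℝ} {L : ι → Fin n}
    (h : polyTensor ι f L ≠ 0) : tupleType L ∈ f.support := by
  rw [mem_support_iff]
  intro h0
  exact h (by simp [polyTensor, h0])

/-- The coefficient at `μ` is shared equally among the tuples of type `μ`; homogeneity ensures that
such tuples exist wherever the coefficient is non-zero. -/
theorem eq_mform_polyTensor {f : MvPolynomial (Fin n) ℝ}
    (hf : f.IsHomogeneous (Fintype.card ι)) :
    f = mform (fun L => C (polyTensor ι f L)) (fun _ => X) := by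
  unfold mform
  simp_rw [prod_X_eq_monomial, C_mul_monomial, mul_one]
  ext μ
  simp only [coeff_sum, coeff_monomial]
  rw [← sum_filter]
  have h1 : ∀ L ∈ ({L | tupleType L = μ} : Finset (ι → Fin n)), polyTensor ι f L =
      f.coeff μ / #{L' : ι → Fin n | tupleType L' = μ} := by
    intro L hL
    simp only [mem_filter, mem_univ, true_and] at hL
    simp [polyTensor, hL]
  rw [sum_congr rfl h1, sum_const, nsmul_eq_mul]
  by_cases hμ : μ.degree = Fintype.card ι
  · obtain ⟨L, hL⟩ := exists_tupleType_eq (ι := ι) μ hμ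
    have : (#{L' : ι → Fin n | tupleType L' = μ} : ℝ) ≠ 0 := by
      rw [Nat.cast_ne_zero, ← Nat.pos_iff_ne_zero, card_pos]
      exact ⟨L, by simp [hL]⟩
    field_simp
  · rw [hf.coeff_eq_zero hμ]; simp

theorem aeval_eq_mform {A : Type*} [CommRing A] [Algebra ℝ A] {f : MvPolynomial (Fin n) ℝ}
    (hf : f.IsHomogeneous (Fintype.card ι)) (x : Fin n → A) :
    aeval x f = mform (fun L => algebraMap ℝ A (polyTensor ι f L)) (fun _ => x) := by
  conv_lhs => rw [eq_mform_polyTensor hf]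
  simp [mform, map_sum, map_mul, map_prod]

theorem eval_eq_mform {f : MvPolynomial (Fin n) ℝ}
    (hf : f.IsHomogeneous (Fintype.card ι)) (x : Fin n → ℝ) :
    eval x f = mform (polyTensor ι f) (fun _ => x) := by
  have := aeval_eq_mform hf x
  rwa [aeval_eq_eval] at this

theorem eval_smul_of_isHomogeneous {d : ℕ} {f : MvPolynomial (Fin n) ℝ} (hf : f.IsHomogeneous d)
    (a : ℝ) (x : Fin n → ℝ) : eval (fun i => a * x i) f = a ^ d * eval x f := by
  have hf' : f.IsHomogeneous (Fintype.card (Fin d)) := by simpa using hf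
  rw [eval_eq_mform hf', eval_eq_mform hf']
  simp only [mform, prod_mul_distrib, prod_const, card_univ, Fintype.card_fin, mul_sum]
  exact sum_congr rfl fun L _ => by ring

end PolyTensor

/-! ### Sums of squares of forms -/

section Sos

variable {n : ℕ}

/-- The cone of sums of squares of forms of degree `k`. -/
def sosCone (n k : ℕ) : AddSubmonoid (MvPolynomial (Fin n) ℝ) :=
  AddSubmonoid.closure {p | ∃ g : MvPolynomial (Fin n) ℝ, g.IsHomogeneous k ∧ p = g ^ 2}

/-- The polynomial `‖x‖²`. -/
def normSqPoly (n : ℕ) : MvPolynomial (Fin n) ℝ := ∑ i, X i ^ 2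

theorem sq_mem_sosCone {k : ℕ} {g : MvPolynomial (Fin n) ℝ} (hg : g.IsHomogeneous k) :
    g ^ 2 ∈ sosCone n k := AddSubmonoid.subset_closure ⟨g, hg, rfl⟩

theorem C_mul_mem_sosCone {k : ℕ} {p : MvPolynomial (Fin n) ℝ} (hp : p ∈ sosCone n k) {c : ℝ}
    (hc : 0 ≤ c) : C c * p ∈ sosCone n k := by
  induction hp using AddSubmonoid.closure_induction with
  | mem p hp =>
    obtain ⟨g, hg, rfl⟩ := hp
    have : C c * g ^ 2 = (C (√c) * g) ^ 2 := by
      rw [mul_pow, ← C_pow, Real.sq_sqrt hc]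
    rw [this]
    exact sq_mem_sosCone (hg.C_mul _)
  | zero => simp
  | add p q _ _ hp hq => rw [mul_add]; exact add_mem hp hq

theorem mul_mem_sosCone {k l : ℕ} {p p' : MvPolynomial (Fin n) ℝ} (hp : p ∈ sosCone n k)
    (hp' : p' ∈ sosCone n l) : p * p' ∈ sosCone n (k + l) := by
  induction hp using AddSubmonoid.closure_induction with
  | mem p hp =>
    obtain ⟨g, hg, rfl⟩ := hp
    induction hp' using AddSubmonoid.closure_induction with
    | mem p' hp' =>
      obtain ⟨g', hg', rfl⟩ := hp'
      rw [← mul_pow]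
      exact sq_mem_sosCone (hg.mul hg')
    | zero => simp
    | add p q _ _ hp hq => rw [mul_add]; exact add_mem hp hq
  | zero => simp
  | add p q _ _ hp hq => rw [add_mul]; exact add_mem hp hq

theorem one_mem_sosCone : (1 : MvPolynomial (Fin n) ℝ) ∈ sosCone n 0 := by
  simpa using sq_mem_sosCone (isHomogeneous_one (Fin n) ℝ)

theorem normSqPoly_pow_mem (k : ℕ) : normSqPoly n ^ k ∈ sosCone n k := by
  induction k with
  | zero => simpa using one_mem_sosCone
  | succ k ih =>
    rw [pow_succ]
    exact mul_mem_sosCone ih (sum_mem fun i _ => sq_mem_sosCone (isHomogeneous_X ℝ i))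

/-- `p` is bounded by `c ‖x‖^{2k}`, in both directions, modulo sums of squares. -/
def SosBdd (k : ℕ) (c : ℝ) (p : MvPolynomial (Fin n) ℝ) : Prop :=
  C c * normSqPoly n ^ k + p ∈ sosCone n k ∧ C c * normSqPoly n ^ k - p ∈ sosCone n k

theorem SosBdd.add {k : ℕ} {c c' : ℝ} {p p' : MvPolynomial (Fin n) ℝ} (h : SosBdd k c p)
    (h' : SosBdd k c' p') : SosBdd k (c + c') (p + p') := by
  refine ⟨?_, ?_⟩
  · convert add_mem h.1 h'.1 using 1
    rw [C_add]; ring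
  · convert add_mem h.2 h'.2 using 1
    rw [C_add]; ring

theorem sosBdd_zero (k : ℕ) : SosBdd k 0 (0 : MvPolynomial (Fin n) ℝ) := by
  simp [SosBdd]

theorem SosBdd.sum {κ : Type*} (s : Finset κ) {k : ℕ} {c : κ → ℝ}
    {p : κ → MvPolynomial (Fin n) ℝ} (h : ∀ i ∈ s, SosBdd k (c i) (p i)) :
    SosBdd k (∑ i ∈ s, c i) (∑ i ∈ s, p i) := by
  classical
  induction s using Finset.induction_on with
  | empty => simpa using sosBdd_zero k
  | insert a s ha ih =>
    rw [sum_insert ha, sum_insert ha]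
    exact (h a (mem_insert_self a s)).add (ih fun i hi => h i (mem_insert_of_mem hi))

theorem SosBdd.C_mul {k : ℕ} {c : ℝ} {p : MvPolynomial (Fin n) ℝ} (h : SosBdd k c p) (a : ℝ) :
    SosBdd k (|a| * c) (C a * p) := by
  rcases le_total 0 a with ha | ha
  · rw [abs_of_nonneg ha]
    refine ⟨?_, ?_⟩
    · convert C_mul_mem_sosCone h.1 ha using 1
      rw [MvPolynomial.C_mul]; ring
    · convert C_mul_mem_sosCone h.2 ha using 1
      rw [MvPolynomial.C_mul]; ring
  · rw [abs_of_nonpos ha]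
    have ha' : 0 ≤ -a := by linarith
    refine ⟨?_, ?_⟩
    · convert C_mul_mem_sosCone h.2 ha' using 1
      rw [MvPolynomial.C_mul, C_neg]; ring
    · convert C_mul_mem_sosCone h.1 ha' using 1
      rw [MvPolynomial.C_mul, C_neg]; ring

theorem SosBdd.mono {k : ℕ} {c c' : ℝ} {p : MvPolynomial (Fin n) ℝ} (h : SosBdd k c p)
    (hc : c ≤ c') : SosBdd k c' p := by
  have h0 := C_mul_mem_sosCone (normSqPoly_pow_mem (n := n) k) (sub_nonneg.2 hc)
  refine ⟨?_, ?_⟩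
  · convert add_mem h0 h.1 using 1
    rw [C_sub]; ring
  · convert add_mem h0 h.2 using 1
    rw [C_sub]; ring

/-- With `R = c‖x‖^{2k}` and `R' = c'‖x‖^{2k'}`: `RR' + pp'` is half of `(R+p)(R'+p') +
(R-p)(R'-p')`, and `RR' - pp'` is half of `(R+p)(R'-p') + (R-p)(R'+p')`. This is why the bound is
two-sided. -/
theorem SosBdd.mul {k k' : ℕ} {c c' : ℝ} {p p' : MvPolynomial (Fin n) ℝ} (h : SosBdd k c p)
    (h' : SosBdd k' c' p') : SosBdd (k + k') (c * c') (p * p') := by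
  have h12 : (C (1 / 2 : ℝ) : MvPolynomial (Fin n) ℝ) * 2 = 1 := by
    rw [show (2 : MvPolynomial (Fin n) ℝ) = C 2 from (map_ofNat C 2).symm, ← MvPolynomial.C_mul]
    norm_num
  refine ⟨?_, ?_⟩
  · convert C_mul_mem_sosCone (add_mem (mul_mem_sosCone h.1 h'.1) (mul_mem_sosCone h.2 h'.2))
      (by norm_num : (0 : ℝ) ≤ 1 / 2) using 1
    rw [MvPolynomial.C_mul, pow_add]
    linear_combination (-(C c * normSqPoly n ^ k * (C c' * normSqPoly n ^ k') + p * p')) * h12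
  · convert C_mul_mem_sosCone (add_mem (mul_mem_sosCone h.1 h'.2) (mul_mem_sosCone h.2 h'.1))
      (by norm_num : (0 : ℝ) ≤ 1 / 2) using 1
    rw [MvPolynomial.C_mul, pow_add]
    linear_combination (-(C c * normSqPoly n ^ k * (C c' * normSqPoly n ^ k') - p * p')) * h12

theorem sosBdd_one : SosBdd 0 1 (1 : MvPolynomial (Fin n) ℝ) := by
  refine ⟨?_, ?_⟩
  · simpa using add_mem (one_mem_sosCone (n := n)) one_mem_sosCone
  · simp

theorem SosBdd.pow {c : ℝ} {p : MvPolynomial (Fin n) ℝ} (h : SosBdd 1 c p) (r : ℕ) :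
    SosBdd r (c ^ r) (p ^ r) := by
  induction r with
  | zero => simpa using sosBdd_one
  | succ r ih => rw [pow_succ, pow_succ]; exact ih.mul h

/-- Weighted AM-GM for a product of two forms with a bounded form. -/
theorem cross_term_mem_sosCone {s r : ℕ} {c : ℝ} {x y W : MvPolynomial (Fin n) ℝ}
    (hx : x.IsHomogeneous s) (hy : y.IsHomogeneous s) (hW : SosBdd r c W) (a b : ℝ) :
    C c * normSqPoly n ^ r * (C (b ^ 2) * x ^ 2 + C (a ^ 2) * y ^ 2) -
      C (2 * a * b) * (x * y * W) ∈ sosCone n (s + r) := by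
  have h12 : (C (1 / 2 : ℝ) : MvPolynomial (Fin n) ℝ) * 2 = 1 := by
    rw [show (2 : MvPolynomial (Fin n) ℝ) = C 2 from (map_ofNat C 2).symm, ← MvPolynomial.C_mul]
    norm_num
  -- With `R = c‖·‖^{2r}`, in half the sum of `(bx+ay)²(R-W)` and `(bx-ay)²(R+W)` the products of
  -- `W` with squares cancel, and so do those of `R` with `xy`.
  have h1 := mul_mem_sosCone (sq_mem_sosCone ((hx.C_mul b).add (hy.C_mul a))) hW.2
  have h2 := mul_mem_sosCone (sq_mem_sosCone ((hx.C_mul b).sub (hy.C_mul a))) hW.1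
  convert C_mul_mem_sosCone (add_mem h1 h2) (by norm_num : (0 : ℝ) ≤ 1 / 2) using 1
  have e : (C (2 * a * b) : MvPolynomial (Fin n) ℝ) = 2 * C a * C b := by
    rw [MvPolynomial.C_mul, MvPolynomial.C_mul, map_ofNat C 2]
  rw [e, C_pow, C_pow]
  linear_combination (-(C c * normSqPoly n ^ r * (C b ^ 2 * x ^ 2 + C a ^ 2 * y ^ 2) -
      2 * C a * C b * (x * y * W))) * h12

/-- The quadratic form of a matrix as a polynomial. -/
def quadPoly (Q : Matrix (Fin n) (Fin n) ℝ) : MvPolynomial (Fin n) ℝ :=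
  ∑ i, ∑ j, C (Q i j) * (X i * X j)

open scoped MatrixOrder ComplexOrder Matrix.Norms.L2Operator in
theorem exists_eq_conjTranspose_mul_self {P : Matrix (Fin n) (Fin n) ℝ} (hP : P.PosSemidef) :
    ∃ B : Matrix (Fin n) (Fin n) ℝ, P = Bᴴ * B :=
  CStarAlgebra.nonneg_iff_eq_star_mul_self.mp hP.nonneg

theorem quadPoly_mem_sosCone {P : Matrix (Fin n) (Fin n) ℝ} (hP : P.PosSemidef) :
    quadPoly P ∈ sosCone n 1 := by
  obtain ⟨B, rfl⟩ := exists_eq_conjTranspose_mul_self hP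
  have : quadPoly (Bᴴ * B) = ∑ k, (∑ i, C (B k i) * X i) ^ 2 := by
    unfold quadPoly
    simp_rw [sq, sum_mul_sum, Matrix.mul_apply, map_sum, sum_mul]
    rw [sum_comm' (t' := univ) (s' := fun _ => univ) (by simp)]
    rw [sum_comm]
    conv_rhs => rw [sum_comm]
    refine sum_congr rfl fun i _ => ?_
    rw [sum_comm]
    refine sum_congr rfl fun j _ => ?_
    refine sum_congr rfl fun k _ => ?_
    simp
    ring
  rw [this]
  exact sum_mem fun k _ => sq_mem_sosCone
    (IsHomogeneous.sum _ _ _ fun i _ => isHomogeneous_C_mul_X _ _)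

theorem quadPoly_smul_one (c : ℝ) :
    quadPoly (c • (1 : Matrix (Fin n) (Fin n) ℝ)) = C c * normSqPoly n := by
  unfold quadPoly normSqPoly
  rw [mul_sum]
  refine sum_congr rfl fun i _ => ?_
  rw [sum_eq_single i]
  · simp [sq]
  · intro j _ hj; simp [Matrix.one_apply_ne hj.symm]
  · simp

theorem quadPoly_add (P Q : Matrix (Fin n) (Fin n) ℝ) :
    quadPoly (P + Q) = quadPoly P + quadPoly Q := by
  simp [quadPoly, add_mul, sum_add_distrib]

theorem quadPoly_sub (P Q : Matrix (Fin n) (Fin n) ℝ) :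
    quadPoly (P - Q) = quadPoly P - quadPoly Q := by
  simp [quadPoly, sub_mul, sum_sub_distrib]

/-- In degree two a bound on the sphere gives a sum-of-squares bound without loss, because `c ± Q`
is positive semidefinite. For this reason two of the `d` slots of the form of `f` are never
polarized in the dense bounds. -/
theorem sosBdd_quadPoly {Q : Matrix (Fin n) (Fin n) ℝ} (hQ : Q.IsSymm) {c : ℝ}
    (h : ∀ x : Fin n → ℝ, |x ⬝ᵥ Q *ᵥ x| ≤ c * (x ⬝ᵥ x)) : SosBdd 1 c (quadPoly Q) := by
  have hc : (c • (1 : Matrix (Fin n) (Fin n) ℝ)).IsHermitian := by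
    simp [Matrix.IsHermitian]
  have hQ' : Q.IsHermitian := by
    simpa [Matrix.IsHermitian, Matrix.IsSymm] using hQ
  unfold SosBdd
  rw [pow_one, ← quadPoly_smul_one, ← quadPoly_add, ← quadPoly_sub]
  refine ⟨quadPoly_mem_sosCone (Matrix.PosSemidef.of_dotProduct_mulVec_nonneg (hc.add hQ') ?_),
    quadPoly_mem_sosCone (Matrix.PosSemidef.of_dotProduct_mulVec_nonneg (hc.sub hQ') ?_)⟩
  · intro x
    have := (abs_le.1 (h x)).1
    simp [Matrix.add_mulVec, dotProduct_add, Matrix.smul_mulVec, dotProduct_smul]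
    linarith
  · intro x
    have := (abs_le.1 (h x)).2
    simp [Matrix.sub_mulVec, dotProduct_sub, Matrix.smul_mulVec, dotProduct_smul]
    linarith

/-! ### From sums of squares to matrix representations -/

theorem eval_eq_dotProduct_tensorPow {k : ℕ} {g : MvPolynomial (Fin n) ℝ} (hg : g.IsHomogeneous k)
    (x : Fin n → ℝ) : eval x g = polyTensor (Fin k) g ⬝ᵥ tensorPow k x := by
  rw [eval_eq_mform (ι := Fin k) (by simpa using hg)]
  rfl

/-- A square `g²` is represented by the rank-one matrix `v vᵀ`, where `v` is the coefficient tensor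
of `g`. -/
theorem exists_matrix_of_mem_sosCone {k : ℕ} {p : MvPolynomial (Fin n) ℝ}
    (hp : p ∈ sosCone n k) : ∃ P : Matrix (Fin k → Fin n) (Fin k → Fin n) ℝ,
      IsMatrixRep k p P ∧ ∀ z, 0 ≤ z ⬝ᵥ P *ᵥ z := by
  induction hp using AddSubmonoid.closure_induction with
  | mem p hp =>
    obtain ⟨g, hg, rfl⟩ := hp
    set v := polyTensor (Fin k) g
    have key : ∀ z, z ⬝ᵥ (vecMulVec v v) *ᵥ z = (v ⬝ᵥ z) ^ 2 := by
      intro z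
      rw [vecMulVec_mulVec, dotProduct_comm z]
      simp [sq]
    refine ⟨vecMulVec v v, ⟨?_, fun x => ?_⟩, fun z => ?_⟩
    · ext i j; simp [vecMulVec_apply, mul_comm]
    · rw [key, map_pow, eval_eq_dotProduct_tensorPow hg]
    · rw [key]; positivity
  | zero => exact ⟨0, ⟨by simp [Matrix.IsSymm], by simp⟩, by simp⟩
  | add p q _ _ hp hq =>
    obtain ⟨P, ⟨hP, hP1⟩, hP2⟩ := hp
    obtain ⟨Q, ⟨hQ, hQ1⟩, hQ2⟩ := hq
    refine ⟨P + Q, ⟨hP.add hQ, fun x => ?_⟩, fun z => ?_⟩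
    · rw [Matrix.add_mulVec, dotProduct_add, hP1, hQ1, map_add]
    · rw [Matrix.add_mulVec, dotProduct_add]; exact add_nonneg (hP2 z) (hQ2 z)

theorem tensorPow_dotProduct_self (k : ℕ) (x : Fin n → ℝ) :
    tensorPow k x ⬝ᵥ tensorPow k x = (x ⬝ᵥ x) ^ k := by
  unfold tensorPow dotProduct
  simp_rw [← prod_mul_distrib]
  have h := Finset.prod_univ_sum (fun _ : Fin k => (univ : Finset (Fin n)))
    (fun _ i => x i * x i)
  simpa using h.symm

theorem eval_normSqPoly (x : Fin n → ℝ) : eval x (normSqPoly n) = x ⬝ᵥ x := by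
  simp [normSqPoly, dotProduct, sq]

theorem dotProduct_self_eq_norm_sq {ι : Type*} [Fintype ι] (z : EuclideanSpace ℝ ι) :
    (fun i => z i) ⬝ᵥ (fun i => z i) = ‖z‖ ^ 2 := by
  rw [EuclideanSpace.norm_sq_eq]
  simp [dotProduct, sq]

theorem le_maxQuadForm {ι : Type*} [Fintype ι] (M : Matrix ι ι ℝ) (z : ι → ℝ)
    (hz : z ⬝ᵥ z = 1) : z ⬝ᵥ M *ᵥ z ≤ maxQuadForm M := by
  unfold maxQuadForm
  have hz' : ‖(WithLp.toLp 2 z : EuclideanSpace ℝ ι)‖ = 1 := by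
    have := dotProduct_self_eq_norm_sq (WithLp.toLp 2 z : EuclideanSpace ℝ ι)
    simp only [] at this
    rw [hz] at this
    nlinarith [norm_nonneg (WithLp.toLp 2 z : EuclideanSpace ℝ ι)]
  have hb : BddAbove (Set.range fun z : Metric.sphere (0 : EuclideanSpace ℝ ι) 1 =>
      (fun i => z.1 i) ⬝ᵥ M.mulVec (fun i => z.1 i)) := by
    have : CompactSpace (Metric.sphere (0 : EuclideanSpace ℝ ι) 1) :=
      isCompact_iff_compactSpace.1 (isCompact_sphere _ _)
    refine (isCompact_range ?_).bddAbove
    simp only [dotProduct, mulVec]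
    fun_prop
  exact le_ciSup hb ⟨WithLp.toLp 2 z, by simpa using hz'⟩

theorem maxQuadForm_le {ι : Type*} [Fintype ι] (M : Matrix ι ι ℝ) {B : ℝ} (hB : 0 ≤ B)
    (h : ∀ z : ι → ℝ, z ⬝ᵥ z = 1 → z ⬝ᵥ M *ᵥ z ≤ B) : maxQuadForm M ≤ B := by
  refine Real.iSup_le (fun z => h _ ?_) hB
  rw [dotProduct_self_eq_norm_sq]
  have : ‖z.1‖ = 1 := by simp
  rw [this, one_pow]

/-- The tensor power of a basis vector is a unit vector, on which every representation takes the
value of `h`. This bounds the set below, without which the real infimum would carry no information.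
-/
theorem maxQuadForm_nonneg_of_isMatrixRep (hn : 0 < n) {k : ℕ} {h : MvPolynomial (Fin n) ℝ}
    (hh : ∀ x, 0 ≤ eval x h) {M : Matrix (Fin k → Fin n) (Fin k → Fin n) ℝ}
    (hM : IsMatrixRep k h M) : 0 ≤ maxQuadForm M := by
  let x : Fin n → ℝ := Pi.single ⟨0, hn⟩ 1
  have hx : x ⬝ᵥ x = 1 := by simp [x]
  refine le_trans ?_ (le_maxQuadForm M (tensorPow k x) (by
    rw [tensorPow_dotProduct_self, hx, one_pow]))
  rw [hM.2]
  exact hh x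

theorem sosValue_nonneg (hn : 0 < n) {k : ℕ} {h : MvPolynomial (Fin n) ℝ}
    (hh : ∀ x, 0 ≤ eval x h) : 0 ≤ sosValue k h :=
  Real.iInf_nonneg fun M => maxQuadForm_nonneg_of_isMatrixRep hn hh M.2

theorem sosValue_le_of_isMatrixRep (hn : 0 < n) {k : ℕ} {h : MvPolynomial (Fin n) ℝ}
    (hh : ∀ x, 0 ≤ eval x h) {M : Matrix (Fin k → Fin n) (Fin k → Fin n) ℝ}
    (hM : IsMatrixRep k h M) {B : ℝ} (hB : 0 ≤ B)
    (hMB : ∀ z : (Fin k → Fin n) → ℝ, z ⬝ᵥ z = 1 → z ⬝ᵥ M *ᵥ z ≤ B) : sosValue k h ≤ B := by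
  unfold sosValue
  refine (ciInf_le ⟨0, ?_⟩ (⟨M, hM⟩ : {M // IsMatrixRep k h M})).trans (maxQuadForm_le M hB hMB)
  rintro _ ⟨M', rfl⟩
  exact maxQuadForm_nonneg_of_isMatrixRep hn hh M'.2

/-- The matrix `B • 1` represents `B‖x‖^{2k}`; subtracting a positive semidefinite representation of
the difference leaves a representation of `h` whose quadratic form is at most `B`. -/
theorem sosValue_le_of_mem_sosCone (hn : 0 < n) {k : ℕ} {h : MvPolynomial (Fin n) ℝ}
    (hh : ∀ x, 0 ≤ eval x h) {B : ℝ} (hB : 0 ≤ B)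
    (hs : C B * normSqPoly n ^ k - h ∈ sosCone n k) : sosValue k h ≤ B := by
  obtain ⟨P, ⟨hP, hP1⟩, hP2⟩ := exists_matrix_of_mem_sosCone hs
  refine sosValue_le_of_isMatrixRep hn hh (M := B • 1 - P) ⟨?_, fun x => ?_⟩ hB fun z hz => ?_
  · exact (Matrix.isSymm_one.smul B).sub hP
  · rw [Matrix.sub_mulVec, dotProduct_sub, hP1, Matrix.smul_mulVec, dotProduct_smul,
      Matrix.one_mulVec, tensorPow_dotProduct_self]
    simp [eval_normSqPoly]
  · rw [Matrix.sub_mulVec, dotProduct_sub, Matrix.smul_mulVec, dotProduct_smul,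
      Matrix.one_mulVec, hz]
    have := hP2 z
    simp only [smul_eq_mul, mul_one]
    linarith

end Sos

/-! ### Power iteration -/

section PowerIteration

variable {n : ℕ}

/-- The Euclidean norm of a coordinate vector. -/
def nrm (x : Fin n → ℝ) : ℝ := √(x ⬝ᵥ x)

theorem nrm_eq_norm (x : Fin n → ℝ) : nrm x = ‖(WithLp.toLp 2 x : EuclideanSpace ℝ (Fin n))‖ := by
  rw [EuclideanSpace.norm_eq, nrm]
  simp [dotProduct, sq]

theorem nrm_nonneg (x : Fin n → ℝ) : 0 ≤ nrm x := Real.sqrt_nonneg _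

theorem dotProduct_self_nonneg' (x : Fin n → ℝ) : 0 ≤ x ⬝ᵥ x :=
  sum_nonneg fun i _ => mul_self_nonneg (x i)

theorem nrm_sq (x : Fin n → ℝ) : nrm x ^ 2 = x ⬝ᵥ x := Real.sq_sqrt (dotProduct_self_nonneg' x)

theorem nrm_add_le (x y : Fin n → ℝ) : nrm (x + y) ≤ nrm x + nrm y := by
  simp only [nrm_eq_norm, WithLp.toLp_add]; exact norm_add_le _ _

theorem nrm_smul (c : ℝ) (x : Fin n → ℝ) : nrm (c • x) = |c| * nrm x := by
  simp only [nrm_eq_norm, WithLp.toLp_smul, norm_smul, Real.norm_eq_abs]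

theorem nrm_sum_le {κ : Type*} (s : Finset κ) (x : κ → Fin n → ℝ) :
    nrm (∑ k ∈ s, x k) ≤ ∑ k ∈ s, nrm (x k) := by
  simp only [nrm_eq_norm, WithLp.toLp_sum]; exact norm_sum_le _ _

theorem dotProduct_le_nrm_mul_nrm (x y : Fin n → ℝ) : x ⬝ᵥ y ≤ nrm x * nrm y := by
  have := real_inner_le_norm (WithLp.toLp 2 y : EuclideanSpace ℝ (Fin n)) (WithLp.toLp 2 x)
  rw [EuclideanSpace.inner_toLp_toLp, ← nrm_eq_norm, ← nrm_eq_norm] at this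
  simpa [mul_comm] using this

theorem abs_dotProduct_le (x y : Fin n → ℝ) : |x ⬝ᵥ y| ≤ nrm x * nrm y := by
  rw [abs_le]
  refine ⟨?_, dotProduct_le_nrm_mul_nrm x y⟩
  have := dotProduct_le_nrm_mul_nrm ((-1 : ℝ) • x) y
  rw [nrm_smul, smul_dotProduct] at this
  simp at this
  linarith

theorem eq_zero_of_nrm_eq_zero {x : Fin n → ℝ} (h : nrm x = 0) : x = 0 := by
  rw [nrm_eq_norm, norm_eq_zero] at h
  simpa using h

theorem nrm_single (i : Fin n) : nrm (Pi.single i 1 : Fin n → ℝ) = 1 := by simp [nrm]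

variable {A : Matrix (Fin n) (Fin n) ℝ}

theorem dotProduct_mulVec_of_isSymm (hA : A.IsSymm) (x y : Fin n → ℝ) :
    (A *ᵥ x) ⬝ᵥ y = x ⬝ᵥ A *ᵥ y := by
  rw [dotProduct_mulVec, ← mulVec_transpose, hA.eq]

/-- Symmetry moves one factor `A` across the inner product: `‖A^{p+1}x‖² = ⟨A^p x, A^{p+2} x⟩`; then
Cauchy-Schwarz. -/
theorem nrm_pow_mulVec_logConvex (hA : A.IsSymm) (x : Fin n → ℝ) (p : ℕ) :
    nrm (A ^ (p + 1) *ᵥ x) ^ 2 ≤ nrm (A ^ p *ᵥ x) * nrm (A ^ (p + 2) *ᵥ x) := by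
  rw [nrm_sq]
  have h1 : A ^ (p + 1) *ᵥ x = A *ᵥ (A ^ p *ᵥ x) := by rw [mulVec_mulVec, ← pow_succ']
  have h2 : A ^ (p + 2) *ᵥ x = A *ᵥ (A ^ (p + 1) *ᵥ x) := by rw [mulVec_mulVec, ← pow_succ']
  conv_lhs => arg 1; rw [h1]
  rw [dotProduct_mulVec_of_isSymm hA, ← h2]
  exact dotProduct_le_nrm_mul_nrm _ _

/-- By log-convexity the growth ratios of a power iteration never fall below the first one. -/
theorem nrm_pow_mulVec_ratio (hA : A.IsSymm) (x : Fin n → ℝ) (p : ℕ) :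
    nrm (A ^ p *ᵥ x) * nrm (A *ᵥ x) ≤ nrm (A ^ (p + 1) *ᵥ x) * nrm x := by
  induction p with
  | zero => simp [mul_comm]
  | succ p ih =>
    have h := nrm_pow_mulVec_logConvex hA x p
    set a := nrm (A ^ p *ᵥ x)
    set b := nrm (A ^ (p + 1) *ᵥ x)
    set c := nrm (A ^ (p + 1 + 1) *ᵥ x)
    have ha : 0 ≤ a := nrm_nonneg _
    have hb : 0 ≤ b := nrm_nonneg _
    have hc : 0 ≤ c := nrm_nonneg _
    have hx : 0 ≤ nrm x := nrm_nonneg _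
    rcases ha.eq_or_lt with h0 | h0
    · have : b = 0 := by
        rw [← h0, zero_mul] at h
        exact pow_eq_zero_iff (two_ne_zero) |>.1 (le_antisymm h (sq_nonneg b))
      rw [this, zero_mul]; positivity
    · refine le_of_mul_le_mul_left ?_ h0
      calc a * (b * nrm (A *ᵥ x)) = b * (a * nrm (A *ᵥ x)) := by ring
        _ ≤ b * (b * nrm x) := mul_le_mul_of_nonneg_left ih hb
        _ = b ^ 2 * nrm x := by ring
        _ ≤ (a * c) * nrm x := mul_le_mul_of_nonneg_right h hx
        _ = a * (c * nrm x) := by ring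

theorem nrm_mulVec_pow_le (hA : A.IsSymm) (x : Fin n → ℝ) (p : ℕ) :
    nrm (A *ᵥ x) ^ p * nrm x ≤ nrm (A ^ p *ᵥ x) * nrm x ^ p := by
  induction p with
  | zero => simp
  | succ p ih =>
    have h := nrm_pow_mulVec_ratio hA x p
    calc nrm (A *ᵥ x) ^ (p + 1) * nrm x = nrm (A *ᵥ x) * (nrm (A *ᵥ x) ^ p * nrm x) := by ring
      _ ≤ nrm (A *ᵥ x) * (nrm (A ^ p *ᵥ x) * nrm x ^ p) :=
        mul_le_mul_of_nonneg_left ih (nrm_nonneg _)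
      _ = (nrm (A ^ p *ᵥ x) * nrm (A *ᵥ x)) * nrm x ^ p := by ring
      _ ≤ (nrm (A ^ (p + 1) *ᵥ x) * nrm x) * nrm x ^ p :=
        mul_le_mul_of_nonneg_right h (pow_nonneg (nrm_nonneg _) _)
      _ = _ := by ring

/-- If no step of the power iteration started from a basis vector expands by more than `β`, then
the spectral norm is at most `2 β`. -/
theorem nrm_mulVec_le_of_powerIteration (hA : A.IsSymm) {β : ℝ} (hβ : 0 ≤ β)
    (h : ∀ i : Fin n, ∀ p < n, nrm (A *ᵥ (A ^ p *ᵥ Pi.single i 1)) ≤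
      β * nrm (A ^ p *ᵥ Pi.single i 1)) (x : Fin n → ℝ) : nrm (A *ᵥ x) ≤ 2 * β * nrm x := by
  have h1 : ∀ i : Fin n, ∀ p ≤ n, nrm (A ^ p *ᵥ Pi.single i 1) ≤ β ^ p := by
    intro i p
    induction p with
    | zero => intro _; rw [pow_zero, one_mulVec, nrm_single, pow_zero]
    | succ p ih =>
      intro hp
      have e : A ^ (p + 1) *ᵥ (Pi.single i 1 : Fin n → ℝ) = A *ᵥ (A ^ p *ᵥ Pi.single i 1) := by
        rw [mulVec_mulVec, ← pow_succ']
      rw [e, pow_succ']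
      exact (h i p (by omega)).trans (mul_le_mul_of_nonneg_left (ih (by omega)) hβ)
  have hx : nrm (A ^ n *ᵥ x) ≤ n * β ^ n * nrm x := by
    have e : A ^ n *ᵥ x = ∑ i, x i • (A ^ n *ᵥ Pi.single i 1) := by
      conv_lhs => rw [pi_eq_sum_univ' x]
      rw [mulVec_sum]
      exact sum_congr rfl fun i _ => by rw [mulVec_smul]
    rw [e]
    refine (nrm_sum_le _ _).trans ?_
    have : ∀ i ∈ (univ : Finset (Fin n)), nrm (x i • (A ^ n *ᵥ (Pi.single i 1 : Fin n → ℝ))) ≤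
        nrm x * β ^ n := by
      intro i _
      rw [nrm_smul]
      refine mul_le_mul ?_ (h1 i n le_rfl) (nrm_nonneg _) (nrm_nonneg _)
      have := abs_dotProduct_le x (Pi.single i 1)
      simpa [nrm_single] using this
    refine (sum_le_sum this).trans (le_of_eq ?_)
    simp; ring
  rcases (nrm_nonneg x).eq_or_lt with h0 | h0
  · rw [eq_zero_of_nrm_eq_zero h0.symm]; simp [nrm]
  · have hn : n ≠ 0 := by
      rintro rfl
      have : x = 0 := Subsingleton.elim _ _
      rw [this] at h0; simp [nrm] at h0
    have h2 := nrm_mulVec_pow_le hA x n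
    have h3 : nrm (A *ᵥ x) ^ n ≤ (2 * β * nrm x) ^ n := by
      refine le_of_mul_le_mul_right (h2.trans ?_) h0
      -- Expanding `x` in the basis cost a factor `n`, which becomes at most `2` after the `n`-th
      -- root.
      have hn2 : (n : ℝ) ≤ 2 ^ n := by exact_mod_cast Nat.lt_two_pow_self.le
      calc nrm (A ^ n *ᵥ x) * nrm x ^ n ≤ (n * β ^ n * nrm x) * nrm x ^ n :=
            mul_le_mul_of_nonneg_right hx (by positivity)
        _ ≤ (2 ^ n * β ^ n * nrm x) * nrm x ^ n := by gcongr
        _ = _ := by rw [mul_pow, mul_pow]; ring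
    exact le_of_pow_le_pow_left₀ hn (by positivity) h3

end PowerIteration

/-! ### The candidate vectors -/

section Candidates

variable {n : ℕ}

/-- One step of the (unnormalized) power iteration for the Hessian of `f` at `t`, expressed by
finite differences of `f`. -/
def polStep (f : MvPolynomial (Fin n) ℝ) (d : ℕ) (t v : Fin n → ℝ) : Fin n → ℝ := fun i =>
  ∑ l ∈ range (d - 2 + 1), (-1) ^ l * ((d - 2).choose l : ℝ) *
    (eval ((l : ℝ) • t + v + Pi.single i 1) f - eval ((l : ℝ) • t + v) f -
      eval ((l : ℝ) • t + Pi.single i 1) f + eval ((l : ℝ) • t) f)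

/-- The combination of `t`, `v / ‖v‖` and `z / ‖z‖`, where `z` is the next power iterate. -/
def candU (f : MvPolynomial (Fin n) ℝ) (d : ℕ) (t v : Fin n → ℝ) (g e₁ e₂ : ℕ) : Fin n → ℝ :=
  (g : ℝ) • t + (e₁ : ℝ) • ((nrm v)⁻¹ • v) +
    (e₂ : ℝ) • ((nrm (polStep f d t v))⁻¹ • polStep f d t v)

/-- The base points at which Hessians are taken. -/
def candT (n q : ℕ) (a b c : ℕ → ℕ) : Fin n → ℝ := fun i =>
  a i / (3 * √(q * (a i + b i))) + a n / (3 * q) * (1 / √n + √(c i / q))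

/-- `|f u| ≤ N ‖u‖^d` for all candidate vectors `u`. -/
def CandidateBound (f : MvPolynomial (Fin n) ℝ) (d q : ℕ) (N : ℝ) : Prop :=
  ∀ a b c : ℕ → ℕ, ∑ i ∈ range (n + 4), a i ≤ 2 * q → ∑ i ∈ range (n + 4), b i ≤ 2 * q →
    ∑ i ∈ range (n + 4), c i ≤ 2 * q → ∀ i : Fin n, ∀ p < n,
      |eval (candU f d (candT n q a b c) ((polStep f d (candT n q a b c))^[p] (Pi.single i 1))
        (a (n + 1)) (a (n + 2)) (a (n + 3))) f| ≤
      N * nrm (candU f d (candT n q a b c) ((polStep f d (candT n q a b c))^[p] (Pi.single i 1))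
        (a (n + 1)) (a (n + 2)) (a (n + 3))) ^ d

/-- The symmetric matrix of the quadratic form `x ↦ F(t, …, t, x, x)`. -/
def hess {D : ℕ} (T : (Fin D ⊕ Fin 2 → Fin n) → ℝ) (t : Fin n → ℝ) : Matrix (Fin n) (Fin n) ℝ :=
  fun i k => ∑ L : Fin D → Fin n, T (Sum.elim L ![i, k]) * ∏ j, t (L j)

theorem hess_isSymm {D : ℕ} {T : (Fin D ⊕ Fin 2 → Fin n) → ℝ} (hT : IsSymmTensor T)
    (t : Fin n → ℝ) : (hess T t).IsSymm := by
  ext i k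
  simp only [hess, transpose_apply]
  refine sum_congr rfl fun L _ => ?_
  congr 1
  rw [← hT (Equiv.sumCongr (Equiv.refl _) (Equiv.swap 0 1))]
  congr 1
  ext j
  rcases j with j | j
  · rfl
  · fin_cases j <;> rfl

theorem mform_sum_two {D : ℕ} (T : (Fin D ⊕ Fin 2 → Fin n) → ℝ) (t v w : Fin n → ℝ) :
    mform T (Sum.elim (fun _ => t) ![v, w]) = v ⬝ᵥ hess T t *ᵥ w := by
  unfold mform hess
  rw [← (Equiv.sumArrowEquivProdArrow (Fin D) (Fin 2) (Fin n)).symm.sum_comp,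
    Fintype.sum_prod_type, sum_comm,
    ← (finTwoArrowEquiv (Fin n)).symm.sum_comp, Fintype.sum_prod_type]
  simp only [dotProduct, mulVec, mul_sum, sum_mul]
  refine sum_congr rfl fun i _ => sum_congr rfl fun k _ => sum_congr rfl fun L _ => ?_
  simp [Equiv.sumArrowEquivProdArrow, finTwoArrowEquiv]
  ring

theorem sum_finset_sum_two {D : ℕ} (G : Finset (Fin D ⊕ Fin 2) → ℝ) :
    ∑ S, G S = ∑ S : Finset (Fin D), (G (S.disjSum {0, 1}) + G (S.disjSum {0}) +
      G (S.disjSum {1}) + G (S.disjSum ∅)) := by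
  rw [← (Finset.sumEquiv (α := Fin D) (β := Fin 2)).symm.toEquiv.sum_comp, Fintype.sum_prod_type]
  refine sum_congr rfl fun S _ => ?_
  have : (univ : Finset (Finset (Fin 2))) = {{0, 1}, {0}, {1}, ∅} := by decide
  rw [this, sum_insert (by decide), sum_insert (by decide), sum_insert (by decide), sum_singleton]
  simp only [← add_assoc]
  rfl

theorem neg_one_pow_card_compl {ι : Type*} [Fintype ι] [DecidableEq ι] (S : Finset ι) :
    (-1 : ℝ) ^ #Sᶜ = (-1) ^ Fintype.card ι * (-1) ^ #S := by
  rw [← card_add_card_compl S, pow_add]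
  have : ((-1 : ℝ) ^ #S) * (-1) ^ #S = 1 := by rw [← mul_pow]; simp
  linear_combination (-(-1 : ℝ) ^ #Sᶜ) * this

variable {D : ℕ} {f : MvPolynomial (Fin n) ℝ}

/-- In the polarization with `D` equal arguments `t`, subsets containing the same number `l` of
copies of `t` give the same term, whence the binomial coefficients; the four ways of including `v`
and `w` form the mixed second difference. -/
theorem hess_polarization (hf : f.IsHomogeneous (D + 2)) (t v w : Fin n → ℝ) :
    ((D + 2)! : ℝ) * (v ⬝ᵥ hess (polyTensor (Fin D ⊕ Fin 2) f) t *ᵥ w) =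
      (-1) ^ D * ∑ l ∈ range (D + 1), (-1) ^ l * (D.choose l : ℝ) *
        (eval ((l : ℝ) • t + v + w) f - eval ((l : ℝ) • t + v) f -
          eval ((l : ℝ) • t + w) f + eval ((l : ℝ) • t) f) := by
  have hf' : f.IsHomogeneous (Fintype.card (Fin D ⊕ Fin 2)) := by simpa using hf
  have h := polarization (isSymmTensor_polyTensor (ι := Fin D ⊕ Fin 2) f)
    (Sum.elim (fun _ => t) ![v, w])
  simp_rw [← eval_eq_mform hf', mform_sum_two, neg_one_pow_card_compl] at h
  rw [sum_finset_sum_two] at h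
  simp only [sum_disjSum, Sum.elim_inl, Sum.elim_inr, sum_const, card_disjSum, Fintype.card_sum,
    Fintype.card_fin] at h
  rw [h]
  have e := Finset.sum_powerset_apply_card (x := (univ : Finset (Fin D))) (fun m =>
    ((-1 : ℝ) ^ D * ((-1) ^ m * (eval ((m : ℝ) • t + v + w) f - eval ((m : ℝ) • t + v) f -
          eval ((m : ℝ) • t + w) f + eval ((m : ℝ) • t) f))))
  rw [powerset_univ, card_univ, Fintype.card_fin] at e
  rw [mul_sum]
  simp only [nsmul_eq_mul] at e
  refine Eq.trans ?_ (e.trans ?_)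
  · refine sum_congr rfl fun S _ => ?_
    simp [pow_add, ← add_assoc, Nat.cast_smul_eq_nsmul]
    ring
  · refine sum_congr rfl fun l _ => ?_
    ring

/-- A step is thus linear in `v`: it multiplies by a fixed non-zero multiple of the matrix of `x ↦
F(t,…,t,x,x)`, although only values of `f` are used to compute it. -/
theorem polStep_eq (hf : f.IsHomogeneous (D + 2)) (t v : Fin n → ℝ) :
    polStep f (D + 2) t v =
      ((-1) ^ D * ((D + 2)! : ℝ)) • hess (polyTensor (Fin D ⊕ Fin 2) f) t *ᵥ v := by
  ext i
  have h := hess_polarization hf t v (Pi.single i 1)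
  rw [← dotProduct_mulVec_of_isSymm (hess_isSymm (isSymmTensor_polyTensor f) t)] at h
  simp only [dotProduct_single, mul_one] at h
  rw [Pi.smul_apply, smul_eq_mul, mul_assoc, h, ← mul_assoc, ← mul_pow]
  simp [polStep]

/-- There are `2^{D+2}` signed values of `f` at points of norm at most `D + 2`, and `(D+2)^{D+2} ≤
e^{D+2} (D+2)!`. -/
theorem abs_dotProduct_hess_le (hf : f.IsHomogeneous (D + 2)) {t v w : Fin n → ℝ} {N : ℝ}
    (hN : 0 ≤ N) (ht : nrm t ≤ 1) (hv : nrm v ≤ 1) (hw : nrm w ≤ 1)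
    (h : ∀ g ≤ D, ∀ e₁ ≤ 1, ∀ e₂ ≤ 1,
      |eval ((g : ℝ) • t + ((e₁ : ℕ) : ℝ) • v + ((e₂ : ℕ) : ℝ) • w) f| ≤
        N * nrm ((g : ℝ) • t + ((e₁ : ℕ) : ℝ) • v + ((e₂ : ℕ) : ℝ) • w) ^ (D + 2)) :
    |v ⬝ᵥ hess (polyTensor (Fin D ⊕ Fin 2) f) t *ᵥ w| ≤ (2 * Real.exp 1) ^ (D + 2) * N := by
  have hb : ∀ g ≤ D, ∀ e₁ ≤ 1, ∀ e₂ ≤ 1,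
      |eval ((g : ℝ) • t + ((e₁ : ℕ) : ℝ) • v + ((e₂ : ℕ) : ℝ) • w) f| ≤
        N * ((D + 2 : ℕ) : ℝ) ^ (D + 2) := by
    intro g hg e₁ he₁ e₂ he₂
    refine (h g hg e₁ he₁ e₂ he₂).trans ?_
    gcongr
    · exact nrm_nonneg _
    · refine (nrm_add_le _ _).trans ((add_le_add_left (nrm_add_le _ _) _).trans ?_)
      rw [nrm_smul, nrm_smul, nrm_smul, Nat.abs_cast, Nat.abs_cast, Nat.abs_cast]
      have h1 : (g : ℝ) * nrm t ≤ D * 1 :=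
        mul_le_mul (by exact_mod_cast hg) ht (nrm_nonneg _) (by positivity)
      have h2 : (e₁ : ℝ) * nrm v ≤ 1 * 1 :=
        mul_le_mul (by exact_mod_cast he₁) hv (nrm_nonneg _) (by positivity)
      have h3 : (e₂ : ℝ) * nrm w ≤ 1 * 1 :=
        mul_le_mul (by exact_mod_cast he₂) hw (nrm_nonneg _) (by positivity)
      push_cast
      linarith
  have hp := congrArg abs (hess_polarization hf t v w)
  rw [abs_mul, abs_mul, abs_pow, abs_neg, abs_one, one_pow, one_mul, Nat.abs_cast] at hp
  have hle : ((D + 2)! : ℝ) * |v ⬝ᵥ hess (polyTensor (Fin D ⊕ Fin 2) f) t *ᵥ w| ≤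
      2 ^ (D + 2) * (N * ((D + 2 : ℕ) : ℝ) ^ (D + 2)) := by
    rw [hp]
    refine (abs_sum_le_sum_abs _ _).trans ?_
    have : ∀ l ∈ range (D + 1), |(-1) ^ l * (D.choose l : ℝ) *
        (eval ((l : ℝ) • t + v + w) f - eval ((l : ℝ) • t + v) f -
          eval ((l : ℝ) • t + w) f + eval ((l : ℝ) • t) f)| ≤
        (D.choose l : ℝ) * (4 * (N * ((D + 2 : ℕ) : ℝ) ^ (D + 2))) := by
      intro l hl
      have hl' : l ≤ D := by simpa [Nat.lt_succ_iff] using hl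
      rw [abs_mul, abs_mul, abs_pow, abs_neg, abs_one, one_pow, one_mul, Nat.abs_cast]
      refine mul_le_mul_of_nonneg_left ?_ (by positivity)
      have a1 := hb l hl' 1 le_rfl 1 le_rfl
      have a2 := hb l hl' 1 le_rfl 0 zero_le_one
      have a3 := hb l hl' 0 zero_le_one 1 le_rfl
      have a4 := hb l hl' 0 zero_le_one 0 zero_le_one
      simp only [Nat.cast_one, Nat.cast_zero, one_smul, zero_smul, add_zero] at a1 a2 a3 a4
      rw [abs_le] at *
      constructor <;> linarith [a1.1, a1.2, a2.1, a2.2, a3.1, a3.2, a4.1, a4.2]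
    refine (sum_le_sum this).trans (le_of_eq ?_)
    rw [← sum_mul]
    have := Nat.sum_range_choose D
    have h2 : ∑ l ∈ range (D + 1), (D.choose l : ℝ) = 2 ^ D := by exact_mod_cast this
    rw [h2]; ring
  have hfac : (((D + 2 : ℕ) : ℝ) ^ (D + 2)) ≤ Real.exp 1 ^ (D + 2) * ((D + 2)! : ℝ) := by
    have := Real.pow_div_factorial_le_exp ((D + 2 : ℕ) : ℝ) (by positivity) (D + 2)
    rw [div_le_iff₀ (by positivity)] at this
    rwa [← Real.exp_nat_mul, mul_one]
  have hpos : (0 : ℝ) < ((D + 2)! : ℝ) := by positivity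
  refine le_of_mul_le_mul_left (hle.trans ?_) hpos
  calc 2 ^ (D + 2) * (N * ((D + 2 : ℕ) : ℝ) ^ (D + 2)) ≤
      2 ^ (D + 2) * (N * (Real.exp 1 ^ (D + 2) * ((D + 2)! : ℝ))) := by gcongr
    _ = _ := by rw [mul_pow]; ring

theorem iterate_smul_mulVec (A : Matrix (Fin n) (Fin n) ℝ) (p : ℕ) (x : Fin n → ℝ) :
    (fun v => A *ᵥ v)^[p] x = A ^ p *ᵥ x := by
  induction p with
  | zero => simp
  | succ p ih => rw [Function.iterate_succ_apply', ih, mulVec_mulVec, ← pow_succ']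

theorem candT_congr {q : ℕ} {a b c a' : ℕ → ℕ} (h : ∀ i ≤ n, a i = a' i) :
    candT n q a b c = candT n q a' b c := by
  ext i
  simp [candT, h i i.2.le, h n le_rfl]

/-- If `z` is the iterate after `v`, then `‖z‖/‖v‖` is, up to the factor `|κ|`, the bilinear form at
`v/‖v‖` and `z/‖z‖`, and polarization expresses this through values of `f` at `candU`. So the
candidate bound limits the expansion of every step. The slack `D + 2` in the budget for `a` pays for
the coefficients `g ≤ D` and `e₁, e₂ ≤ 1` stored behind position `n`. -/
theorem hess_bound_of_candidateBound (hf : f.IsHomogeneous (D + 2)) {q : ℕ} {N : ℝ} (hN : 0 ≤ N)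
    (hG : CandidateBound f (D + 2) q N) {a b c : ℕ → ℕ}
    (ha : ∑ i ∈ range (n + 1), a i + (D + 2) ≤ 2 * q)
    (hb : ∑ i ∈ range (n + 4), b i ≤ 2 * q) (hc : ∑ i ∈ range (n + 4), c i ≤ 2 * q)
    (ht : nrm (candT n q a b c) ≤ 1) (x : Fin n → ℝ) :
    |x ⬝ᵥ hess (polyTensor (Fin D ⊕ Fin 2) f) (candT n q a b c) *ᵥ x| ≤
      2 * ((2 * Real.exp 1) ^ (D + 2) * N) * (x ⬝ᵥ x) := by
  set t := candT n q a b c with htdef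
  set Q := hess (polyTensor (Fin D ⊕ Fin 2) f) t with hQ
  have hQs : Q.IsSymm := hess_isSymm (isSymmTensor_polyTensor f) t
  set κ : ℝ := (-1) ^ D * ((D + 2)! : ℝ) with hκ
  have hκa : |κ| = ((D + 2)! : ℝ) := by
    rw [hκ, abs_mul, abs_pow, abs_neg, abs_one, one_pow, one_mul, Nat.abs_cast]
  have hκ0 : 0 < |κ| := by rw [hκa]; positivity
  have hκ1 : κ ≠ 0 := abs_pos.1 hκ0
  have hstep : polStep f (D + 2) t = fun v => (κ • Q) *ᵥ v := by
    funext v; rw [polStep_eq hf, smul_mulVec]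
  have hAs : (κ • Q).IsSymm := hQs.smul κ
  set β := (2 * Real.exp 1) ^ (D + 2) * N with hβ
  have hβ0 : 0 ≤ β := by positivity
  have hiter : ∀ i : Fin n, ∀ p < n, nrm ((κ • Q) *ᵥ ((κ • Q) ^ p *ᵥ Pi.single i 1)) ≤
      (|κ| * β) * nrm ((κ • Q) ^ p *ᵥ Pi.single i 1) := by
    intro i p hp
    set v := (κ • Q) ^ p *ᵥ (Pi.single i 1 : Fin n → ℝ) with hv
    set z := (κ • Q) *ᵥ v with hz
    have hunit : ∀ y : Fin n → ℝ, nrm ((nrm y)⁻¹ • y) ≤ 1 := by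
      intro y
      rw [nrm_smul, abs_of_nonneg (inv_nonneg.2 (nrm_nonneg y))]
      exact inv_mul_le_one
    have hbd := abs_dotProduct_hess_le hf hN ht (hunit v) (hunit z) (by
      intro g hg e₁ he₁ e₂ he₂
      let a' : ℕ → ℕ := fun j => if j ≤ n then a j else if j = n + 1 then g else
        if j = n + 2 then e₁ else e₂
      have hat : candT n q a' b c = t := candT_congr (fun j hj => by simp [a', hj])
      have hs : ∑ j ∈ range (n + 4), a' j = ∑ j ∈ range (n + 1), a j + g + e₁ + e₂ := by
        rw [show n + 4 = n + 1 + 1 + 1 + 1 from rfl, sum_range_succ, sum_range_succ,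
          sum_range_succ]
        have : ∑ j ∈ range (n + 1), a' j = ∑ j ∈ range (n + 1), a j :=
          sum_congr rfl fun j hj => by
            have : j ≤ n := by simpa [Nat.lt_succ_iff] using hj
            simp [a', this]
        rw [this]
        simp [a']
      have h := hG a' b c (by rw [hs]; omega) hb hc i p hp
      rw [hat, hstep, iterate_smul_mulVec] at h
      have e1 : a' (n + 1) = g := by simp [a']
      have e2 : a' (n + 2) = e₁ := by simp [a']
      have e3 : a' (n + 3) = e₂ := by simp [a']
      rw [e1, e2, e3, ← hv] at h
      simp only [candU, hstep] at h
      exact h)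
    rw [← hQ, smul_dotProduct, mulVec_smul, dotProduct_smul, smul_eq_mul, smul_eq_mul] at hbd
    have e : κ * (v ⬝ᵥ Q *ᵥ z) = nrm z ^ 2 := by
      rw [nrm_sq, ← dotProduct_mulVec_of_isSymm hQs, hz, smul_mulVec, smul_dotProduct,
        smul_eq_mul]
    have hmul : |κ| * |(nrm v)⁻¹ * ((nrm z)⁻¹ * (v ⬝ᵥ Q *ᵥ z))| ≤ |κ| * β :=
      mul_le_mul_of_nonneg_left hbd hκ0.le
    rw [← abs_mul, show κ * ((nrm v)⁻¹ * ((nrm z)⁻¹ * (v ⬝ᵥ Q *ᵥ z))) =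
      (nrm v)⁻¹ * ((nrm z)⁻¹ * (κ * (v ⬝ᵥ Q *ᵥ z))) by ring, e] at hmul
    rcases (nrm_nonneg z).eq_or_lt with hz0 | hz0
    · rw [← hz0]; exact mul_nonneg (by positivity) (nrm_nonneg _)
    · have hv0 : 0 < nrm v := by
        refine (nrm_nonneg v).lt_of_ne fun h0 => ?_
        rw [hz, eq_zero_of_nrm_eq_zero h0.symm] at hz0
        simp [nrm] at hz0
      have e2 : (nrm v)⁻¹ * ((nrm z)⁻¹ * nrm z ^ 2) = nrm z / nrm v := by
        field_simp
      rw [e2, abs_of_nonneg (by positivity), div_le_iff₀ hv0] at hmul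
      exact hmul
  have hfin := nrm_mulVec_le_of_powerIteration hAs (by positivity) hiter x
  have h1 := abs_dotProduct_le x ((κ • Q) *ᵥ x)
  rw [smul_mulVec, dotProduct_smul, smul_eq_mul, abs_mul] at h1
  rw [smul_mulVec] at hfin
  refine le_of_mul_le_mul_left (h1.trans ?_) hκ0
  rw [← nrm_sq]
  calc nrm x * nrm (κ • Q *ᵥ x) ≤ nrm x * (2 * (|κ| * β) * nrm x) :=
        mul_le_mul_of_nonneg_left hfin (nrm_nonneg _)
    _ = _ := by ring

end Candidates

/-! ### Scaled basis vectors and base points -/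

section BasePoints

variable {n : ℕ} {ι : Type*} [Fintype ι]

/-- The basis vector `e_{I j}`, scaled by the square root of the multiplicity of `I j`. -/
def scaledVec (q : ℕ) (I : ι → Fin n) (j : ι) : Fin n → ℝ :=
  Pi.single (I j) (1 / (3 * √q * √(tupleType I (I j))))

/-- A nearly flat vector with peaks prescribed by `c`. -/
def peakVec (n q : ℕ) (c : ℕ → ℕ) : Fin n → ℝ := fun i => 1 / √n + √(c i / q)

theorem sum_scaledVec_apply (q : ℕ) (I : ι → Fin n) (S : Finset ι) (i : Fin n) :
    (∑ j ∈ S, scaledVec q I j) i =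
      #{j ∈ S | I j = i} * (1 / (3 * √q * √(tupleType I i))) := by
  rw [Finset.sum_apply, ← nsmul_eq_mul, ← sum_const, sum_filter]
  refine sum_congr rfl fun j _ => ?_
  by_cases h : I j = i
  · subst h; simp [scaledVec]
  · simp [scaledVec, h, Ne.symm h]

theorem sum_tupleType (I : ι → Fin n) : ∑ i, tupleType I i = Fintype.card ι := by
  rw [← degree_tupleType I, Finsupp.degree_eq_sum]

/-- Here `a i` counts the occurrences of `i` at positions in `S` and `b i` those outside, so `a i +
b i` is the multiplicity that enters the scaling; `a n` is the multiple of the peaked vector. A base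
point is determined by such counts, not by the tuple and the subset, and this keeps the family of
size `n^{O(q)}`. -/
theorem exists_candT_eq [DecidableEq ι] (q : ℕ) (I : ι → Fin n) (S : Finset ι) (u : ℕ) (c : ℕ → ℕ) :
    ∃ a b : ℕ → ℕ, candT n q a b c =
        ∑ j ∈ S, scaledVec q I j + ((u : ℝ) / (3 * q)) • peakVec n q c ∧
      ∑ i ∈ range (n + 1), a i ≤ Fintype.card ι + u ∧
      ∑ i ∈ range (n + 4), b i ≤ Fintype.card ι := by
  let a : ℕ → ℕ := fun i => if h : i < n then #{j ∈ S | I j = ⟨i, h⟩} else u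
  let b : ℕ → ℕ := fun i => if h : i < n then #{j ∈ Sᶜ | I j = ⟨i, h⟩} else 0
  have ha : ∑ i ∈ range n, a i = #S := by
    rw [sum_range, card_eq_sum_card_fiberwise (f := I) (t := univ) (by simp)]
    exact sum_congr rfl fun i _ => by simp [a]
  have hb : ∑ i ∈ range n, b i = #Sᶜ := by
    rw [sum_range, card_eq_sum_card_fiberwise (f := I) (t := univ) (by simp)]
    exact sum_congr rfl fun i _ => by simp [b]
  refine ⟨a, b, ?_, ?_, ?_⟩
  · ext i
    have hab : ((a i : ℝ) + b i) = tupleType I i := by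
      rw [tupleType_apply]
      simp only [a, b, i.2, dite_true]
      norm_cast
      rw [← card_union_of_disjoint, ← filter_union, union_compl]
      exact (disjoint_compl_right (a := S)).mono (filter_subset _ _) (filter_subset _ _)
    rw [Pi.add_apply, sum_scaledVec_apply]
    simp only [candT, hab, Pi.smul_apply, smul_eq_mul, peakVec]
    have h1 : a i = #{j ∈ S | I j = i} := by simp [a]
    have h2 : a n = u := by simp [a]
    rw [h1, h2, Real.sqrt_mul (Nat.cast_nonneg q)]
    ring
  · rw [sum_range_succ, ha]
    have : a n = u := by simp [a]
    rw [this]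
    exact Nat.add_le_add_right (card_le_univ S) _
  · rw [sum_range_add, hb]
    have : ∑ x ∈ range 4, b (n + x) = 0 := sum_eq_zero fun x _ => by simp [b]
    rw [this, add_zero]
    exact card_le_univ _

theorem nrm_le_of_sq_le {x : Fin n → ℝ} {B : ℝ} (hB : 0 ≤ B) (h : ∑ i, x i ^ 2 ≤ B ^ 2) :
    nrm x ≤ B := by
  unfold nrm
  rw [Real.sqrt_le_left hB]
  refine le_trans (le_of_eq ?_) h
  simp [dotProduct, sq]

/-- With multiplicity `α_i`, the coordinate `i` of a subset sum is at most `√α_i / (3√q)`, and `∑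
α_i ≤ q`. Scaling by the square root of the multiplicity keeps all subset sums bounded while losing
as little as possible. -/
theorem nrm_sum_scaledVec_le {q : ℕ} (hq : 0 < q) (I : ι → Fin n) (hI : Fintype.card ι ≤ q)
    (S : Finset ι) : nrm (∑ j ∈ S, scaledVec q I j) ≤ 1 / 3 := by
  refine nrm_le_of_sq_le (by norm_num) ?_
  have hq' : (0 : ℝ) < q := by exact_mod_cast hq
  have : ∀ i ∈ (univ : Finset (Fin n)), ((∑ j ∈ S, scaledVec q I j) i) ^ 2 ≤
      (tupleType I i : ℝ) * (1 / (9 * q)) := by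
    intro i _
    rw [sum_scaledVec_apply]
    have hle : (#{j ∈ S | I j = i} : ℝ) ≤ tupleType I i := by
      rw [tupleType_apply]
      exact_mod_cast card_le_card (filter_subset_filter _ (subset_univ S))
    rcases Nat.eq_zero_or_pos (tupleType I i) with h0 | h0
    · simp [h0]
    · have h0' : (0 : ℝ) < tupleType I i := by exact_mod_cast h0
      rw [mul_pow, div_pow, mul_pow, mul_pow, Real.sq_sqrt hq'.le, Real.sq_sqrt h0'.le]
      calc (#{j ∈ S | I j = i} : ℝ) ^ 2 * (1 ^ 2 / (3 ^ 2 * q * tupleType I i))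
          ≤ (tupleType I i : ℝ) ^ 2 * (1 ^ 2 / (3 ^ 2 * q * tupleType I i)) := by gcongr
        _ = _ := by field_simp; norm_num
  refine (sum_le_sum this).trans ?_
  rw [← sum_mul]
  have h2 : ∑ i, (tupleType I i : ℝ) = Fintype.card ι := by exact_mod_cast sum_tupleType I
  rw [h2]
  have h3 : (Fintype.card ι : ℝ) ≤ q := by exact_mod_cast hI
  rw [mul_one_div, div_le_iff₀ (by positivity)]
  linarith

theorem nrm_peakVec_le {q : ℕ} (hn : 0 < n) (hq : 0 < q) {c : ℕ → ℕ}
    (hc : ∑ i : Fin n, c i ≤ q) : nrm (peakVec n q c) ≤ 2 := by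
  have hq' : (0 : ℝ) < q := by exact_mod_cast hq
  have hn' : (0 : ℝ) < n := by exact_mod_cast hn
  have e : peakVec n q c = (fun _ => 1 / √n) + fun i : Fin n => √(c i / q) := by
    ext i; simp [peakVec]
  rw [e]
  refine (nrm_add_le _ _).trans ?_
  have h1 : nrm (fun _ : Fin n => 1 / √(n : ℝ)) ≤ 1 := by
    refine nrm_le_of_sq_le zero_le_one ?_
    simp only [div_pow, Real.sq_sqrt hn'.le, sum_const, card_univ, Fintype.card_fin, nsmul_eq_mul]
    field_simp; norm_num
  have h2 : nrm (fun i : Fin n => √((c i : ℝ) / q)) ≤ 1 := by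
    refine nrm_le_of_sq_le zero_le_one ?_
    have : ∀ i : Fin n, √((c i : ℝ) / q) ^ 2 = (c i : ℝ) / q := fun i =>
      Real.sq_sqrt (by positivity)
    simp_rw [this]
    rw [← sum_div, one_pow, div_le_one hq']
    exact_mod_cast hc
  linarith

/-- The factors `3` in the definitions are chosen for `1/3 + (1/3)·2 = 1`. -/
theorem nrm_basePoint_le {q : ℕ} (hn : 0 < n) (hq : 0 < q) (I : ι → Fin n)
    (hI : Fintype.card ι ≤ q) (S : Finset ι) {u : ℕ} (hu : u ≤ q) {c : ℕ → ℕ}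
    (hc : ∑ i : Fin n, c i ≤ q) :
    nrm (∑ j ∈ S, scaledVec q I j + ((u : ℝ) / (3 * q)) • peakVec n q c) ≤ 1 := by
  have hq' : (0 : ℝ) < q := by exact_mod_cast hq
  refine (nrm_add_le _ _).trans ?_
  rw [nrm_smul, abs_of_nonneg (by positivity)]
  have h1 := nrm_sum_scaledVec_le hq I hI S
  have h2 := nrm_peakVec_le hn hq hc
  have h3 : (u : ℝ) / (3 * q) ≤ 1 / 3 := by
    rw [div_le_iff₀ (by positivity)]
    have : (u : ℝ) ≤ q := by exact_mod_cast hu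
    linarith
  have h4 : (u : ℝ) / (3 * q) * nrm (peakVec n q c) ≤ 1 / 3 * 2 :=
    mul_le_mul h3 h2 (nrm_nonneg _) (by norm_num)
  linarith

theorem hess_bound_basePoint [DecidableEq ι] {D : ℕ} {f : MvPolynomial (Fin n) ℝ}
    (hf : f.IsHomogeneous (D + 2))
    {q : ℕ} (hn : 0 < n) (hq : 0 < q) {N : ℝ} (hN : 0 ≤ N) (hG : CandidateBound f (D + 2) q N)
    (I : ι → Fin n) (S : Finset ι) {u : ℕ} (hI : Fintype.card ι + u + (D + 2) ≤ 2 * q)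
    (hI' : Fintype.card ι ≤ q) (hu : u ≤ q)
    {c : ℕ → ℕ} (hc : ∑ i : Fin n, c i ≤ q) (hc' : ∀ i, n ≤ i → c i = 0) (x : Fin n → ℝ) :
    |x ⬝ᵥ hess (polyTensor (Fin D ⊕ Fin 2) f)
        (∑ j ∈ S, scaledVec q I j + ((u : ℝ) / (3 * q)) • peakVec n q c) *ᵥ x| ≤
      2 * ((2 * Real.exp 1) ^ (D + 2) * N) * (x ⬝ᵥ x) := by
  obtain ⟨a, b, ht, ha, hb⟩ := exists_candT_eq q I S u c
  have hnorm := nrm_basePoint_le hn hq I hI' S hu hc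
  rw [← ht] at hnorm ⊢
  refine hess_bound_of_candidateBound hf hN hG (by omega) (by omega) ?_ hnorm x
  rw [sum_range_add, sum_range]
  have : ∑ x ∈ range 4, c (n + x) = 0 := sum_eq_zero fun x _ => hc' _ (by omega)
  omega

/-- The base point is itself a candidate, with `g = 1` and `e₁ = e₂ = 0`; as no power step is
involved, `d` is arbitrary. -/
theorem abs_eval_basePoint_le [DecidableEq ι] {d : ℕ} {f : MvPolynomial (Fin n) ℝ}
    {q : ℕ} (hn : 0 < n) (hq : 0 < q) {N : ℝ} (hN : 0 ≤ N) (hG : CandidateBound f d q N)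
    (I : ι → Fin n) (S : Finset ι) (hI' : Fintype.card ι ≤ q) :
    |eval (∑ j ∈ S, scaledVec q I j) f| ≤ N := by
  obtain ⟨a, b, ht, ha, hb⟩ := exists_candT_eq q I S 0 0
  have hnorm := nrm_basePoint_le hn hq I hI' S (Nat.zero_le q) (c := 0) (by simp)
  rw [← ht] at hnorm
  have ht' : candT n q a b 0 = ∑ j ∈ S, scaledVec q I j := by simpa using ht
  let a' : ℕ → ℕ := fun j => if j ≤ n then a j else if j = n + 1 then 1 else 0
  have hat : candT n q a' b 0 = candT n q a b 0 := candT_congr (fun j hj => by simp [a', hj])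
  have hs : ∑ j ∈ range (n + 4), a' j = ∑ j ∈ range (n + 1), a j + 1 := by
    rw [show n + 4 = n + 1 + 1 + 1 + 1 from rfl, sum_range_succ, sum_range_succ,
      sum_range_succ]
    have : ∑ j ∈ range (n + 1), a' j = ∑ j ∈ range (n + 1), a j :=
      sum_congr rfl fun j hj => by
        have : j ≤ n := by simpa [Nat.lt_succ_iff] using hj
        simp [a', this]
    rw [this]
    simp [a']
  have h := hG a' b 0 (by rw [hs]; omega) (by omega) (by simp) ⟨0, hn⟩ 0 hn
  have e1 : a' (n + 1) = 1 := by simp [a']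
  have e2 : a' (n + 2) = 0 := by simp [a']
  have e3 : a' (n + 3) = 0 := by simp [a']
  rw [hat, e1, e2, e3] at h
  simp only [candU, Nat.cast_one, one_smul, Nat.cast_zero, zero_smul, add_zero] at h
  rw [ht'] at h hnorm
  refine h.trans ?_
  exact mul_le_of_le_one_right hN (pow_le_one₀ (nrm_nonneg _) hnorm)

end BasePoints

/-! ### The symmetric tensor of a power -/

section PowTensor

variable {n D r : ℕ} {ι : Type*} [Fintype ι] [DecidableEq ι]

/-- The coefficients, in the variable `t`, of the `r`-th power of `x ↦ F(t, …, t, x, x)`. -/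
def prodTensor (r : ℕ) (T : (Fin D ⊕ Fin 2 → Fin n) → ℝ) (L : Fin r × Fin D → Fin n) :
    MvPolynomial (Fin n) ℝ :=
  ∏ l, quadPoly fun i k => T (Sum.elim (fun j => L (l, j)) ![i, k])

theorem mform_prodTensor (T : (Fin D ⊕ Fin 2 → Fin n) → ℝ)
    (x : Fin n → MvPolynomial (Fin n) ℝ) :
    mform (prodTensor r T) (fun _ => x) =
      (∑ L : Fin D → Fin n, quadPoly (fun i k => T (Sum.elim L ![i, k])) * ∏ j, x (L j)) ^ r := by
  unfold mform prodTensor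
  have h := Finset.prod_univ_sum (fun _ : Fin r => (univ : Finset (Fin D → Fin n)))
    (fun _ L => quadPoly (fun i k => T (Sum.elim L ![i, k])) * ∏ j, x (L j))
  simp only [prod_const, card_univ, Fintype.card_fin, Fintype.piFinset_univ] at h
  rw [h, ← (Equiv.curry (Fin r) (Fin D) (Fin n)).sum_comp]
  refine sum_congr rfl fun L _ => ?_
  rw [prod_mul_distrib, Fintype.prod_prod_type]
  rfl

/-- The symmetric tensor of `t ↦ (x ↦ F(t, …, t, x, x)) ^ r`. -/
def powTensor (e : Fin r × Fin D ≃ ι) (T : (Fin D ⊕ Fin 2 → Fin n) → ℝ) :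
    (ι → Fin n) → MvPolynomial (Fin n) ℝ :=
  symmetrize fun L => prodTensor r T (L ∘ e)

theorem isSymmTensor_powTensor (e : Fin r × Fin D ≃ ι) (T : (Fin D ⊕ Fin 2 → Fin n) → ℝ) :
    IsSymmTensor (powTensor e T) := isSymmTensor_symmetrize _

theorem mform_powTensor (e : Fin r × Fin D ≃ ι) (T : (Fin D ⊕ Fin 2 → Fin n) → ℝ)
    (x : Fin n → MvPolynomial (Fin n) ℝ) :
    mform (powTensor e T) (fun _ => x) =
      (∑ L : Fin D → Fin n, quadPoly (fun i k => T (Sum.elim L ![i, k])) * ∏ j, x (L j)) ^ r := by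
  rw [powTensor, mform_symmetrize_const, ← mform_prodTensor]
  unfold mform
  refine Fintype.sum_equiv (Equiv.arrowCongr e.symm (Equiv.refl _)) _ _ fun L => ?_
  have h : (Equiv.arrowCongr e.symm (Equiv.refl (Fin n))) L = L ∘ e := by ext; simp
  rw [h]
  congr 1
  exact (Equiv.prod_comp e (fun j => x (L j))).symm

/-- Two evaluations of `powTensor` matter: at constants it is a power of a quadratic form, to which
spectral bounds apply, and at the variables it is `f ^ r`. -/
theorem mform_powTensor_C (e : Fin r × Fin D ≃ ι) (T : (Fin D ⊕ Fin 2 → Fin n) → ℝ)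
    (t : Fin n → ℝ) :
    mform (powTensor e T) (fun _ i => C (t i)) = quadPoly (hess T t) ^ r := by
  rw [mform_powTensor]
  congr 1
  unfold quadPoly hess
  simp_rw [map_sum, sum_mul]
  rw [sum_comm]
  refine sum_congr rfl fun i _ => ?_
  rw [sum_comm]
  refine sum_congr rfl fun k _ => sum_congr rfl fun L _ => ?_
  rw [MvPolynomial.C_mul, map_prod]
  ring

theorem mform_powTensor_X {f : MvPolynomial (Fin n) ℝ} (hf : f.IsHomogeneous (D + 2))
    (e : Fin r × Fin D ≃ ι) :
    mform (powTensor e (polyTensor (Fin D ⊕ Fin 2) f)) (fun _ => X) = f ^ r := by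
  rw [mform_powTensor]
  congr 1
  conv_rhs => rw [eq_mform_polyTensor (ι := Fin D ⊕ Fin 2) (f := f) (by simpa using hf)]
  unfold mform
  rw [← (Equiv.sumArrowEquivProdArrow (Fin D) (Fin 2) (Fin n)).symm.sum_comp,
    Fintype.sum_prod_type]
  refine sum_congr rfl fun L _ => ?_
  rw [← (finTwoArrowEquiv (Fin n)).symm.sum_comp, Fintype.sum_prod_type]
  simp only [quadPoly, sum_mul]
  refine sum_congr rfl fun i _ => sum_congr rfl fun k _ => ?_
  simp [Equiv.sumArrowEquivProdArrow, finTwoArrowEquiv]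
  ring

/-- Only the `t`-positions are polarized. Each of the `2^m` terms is, up to sign, the `r`-th power
of a quadratic form bounded by `Θ`, and polarization divides by `m!`. -/
theorem sosBdd_mform_powTensor {f : MvPolynomial (Fin n) ℝ}
    (e : Fin r × Fin D ≃ ι) (v : ι → Fin n → ℝ) {Θ : ℝ}
    (h : ∀ S : Finset ι, ∀ x : Fin n → ℝ,
      |x ⬝ᵥ hess (polyTensor (Fin D ⊕ Fin 2) f) (∑ j ∈ S, v j) *ᵥ x| ≤ Θ * (x ⬝ᵥ x)) :
    SosBdd r (2 ^ Fintype.card ι * Θ ^ r / (Fintype.card ι)!)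
      (mform (powTensor e (polyTensor (Fin D ⊕ Fin 2) f)) (fun j i => C (v j i))) := by
  have hp := polarization (isSymmTensor_powTensor e (polyTensor (Fin D ⊕ Fin 2) f))
    (fun j i => C (v j i))
  have hS : ∀ S : Finset ι, (∑ j ∈ S, fun i => (C (v j i) : MvPolynomial (Fin n) ℝ)) =
      fun i => C ((∑ j ∈ S, v j) i) := by
    intro S; ext i; simp
  simp_rw [hS, mform_powTensor_C] at hp
  have hb : SosBdd r (∑ _S : Finset ι, Θ ^ r) (∑ S : Finset ι, (-1) ^ #Sᶜ *
      quadPoly (hess (polyTensor (Fin D ⊕ Fin 2) f) (∑ j ∈ S, v j)) ^ r) := by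
    refine SosBdd.sum _ fun S _ => ?_
    have h1 := (sosBdd_quadPoly (hess_isSymm (isSymmTensor_polyTensor f) _) (h S)).pow r
    have h2 := h1.C_mul ((-1) ^ #Sᶜ)
    simpa using h2
  rw [← hp] at hb
  have hfin := hb.C_mul ((Fintype.card ι)! : ℝ)⁻¹
  have hne : ((Fintype.card ι)! : ℝ) ≠ 0 := by positivity
  have e1 : ((Fintype.card ι)! : MvPolynomial (Fin n) ℝ) = C ((Fintype.card ι)! : ℝ) := by simp
  rw [e1, ← mul_assoc, ← MvPolynomial.C_mul, inv_mul_cancel₀ hne, C_1, one_mul] at hfin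
  convert hfin using 1
  rw [abs_of_nonneg (by positivity)]
  simp
  ring

end PowTensor

/-! ### Multiplicities -/

section Multiplicity

variable {n : ℕ}

/-- The product of the factorials of the multiplicities. -/
def facWeight {ι : Type*} [Fintype ι] (J : ι → Fin n) : ℕ := ∏ i, (tupleType J i)!

theorem facWeight_pos {ι : Type*} [Fintype ι] (J : ι → Fin n) : 0 < facWeight J :=
  prod_pos fun _ _ => Nat.factorial_pos _

theorem facWeight_cons {s : ℕ} (i : Fin n) (J : Fin s → Fin n) :
    facWeight (Fin.cons i J : Fin (s + 1) → Fin n) = (tupleType J i + 1) * facWeight J := by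
  have h : tupleType (Fin.cons i J : Fin (s + 1) → Fin n) = Finsupp.single i 1 + tupleType J := by
    simp [tupleType, Fin.sum_univ_succ]
  unfold facWeight
  rw [h, ← mul_prod_erase univ _ (mem_univ i), ← mul_prod_erase univ _ (mem_univ i), ← mul_assoc]
  congr 1
  · simp [add_comm 1, Nat.factorial_succ]
  · refine prod_congr rfl fun k hk => ?_
    rw [Finsupp.add_apply, Finsupp.single_apply, if_neg (ne_of_mem_erase hk).symm, zero_add]

/-- Prepending `i` multiplies the weight by its multiplicity plus one, and these factors sum to `n +
s`. The total is therefore the rising factorial `n(n+1)⋯(n+s-1)`. -/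
theorem sum_facWeight_succ (s : ℕ) : ∑ J : Fin (s + 1) → Fin n, facWeight J =
    (n + s) * ∑ J : Fin s → Fin n, facWeight J := by
  rw [← (Fin.consEquiv (fun _ : Fin (s + 1) => Fin n)).sum_comp, Fintype.sum_prod_type, sum_comm,
    mul_sum]
  refine sum_congr rfl fun J _ => ?_
  have : ∀ i : Fin n, facWeight ((Fin.consEquiv (fun _ : Fin (s + 1) => Fin n)) (i, J)) =
      (tupleType J i + 1) * facWeight J := fun i => facWeight_cons i J
  simp_rw [this, ← sum_mul, sum_add_distrib, sum_tupleType]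
  simp [add_comm]

theorem sum_facWeight_le {s : ℕ} (hs : s ≤ n) :
    ∑ J : Fin s → Fin n, facWeight J ≤ (2 * n) ^ s := by
  induction s with
  | zero => simp [facWeight, tupleType]
  | succ s ih =>
    rw [sum_facWeight_succ, pow_succ']
    exact Nat.mul_le_mul (by omega) (ih (by omega))

theorem prod_comp_eq_prod_pow {ι : Type*} [Fintype ι] [DecidableEq ι] (I : ι → Fin n)
    (F : Fin n → ℝ) : ∏ j, F (I j) = ∏ i, F i ^ tupleType I i := by
  rw [← Finset.prod_fiberwise univ I (fun j => F (I j))]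
  refine prod_congr rfl fun i _ => ?_
  rw [tupleType_apply, ← prod_const]
  refine prod_congr rfl fun j hj => ?_
  simp only [mem_filter, mem_univ, true_and] at hj
  rw [hj]

theorem pow_self_le_exp_mul_factorial (k : ℕ) : (k : ℝ) ^ k ≤ Real.exp 1 ^ k * k ! := by
  have := Real.pow_div_factorial_le_exp (k : ℝ) (by positivity) k
  rw [div_le_iff₀ (by positivity)] at this
  rwa [← Real.exp_nat_mul, mul_one]

/-- Grouping equal entries turns the left side into `∏ α_i^{α_i}`, and `α^α ≤ e^α α!`. -/
theorem prod_multiplicity_sq_le {ι : Type*} [Fintype ι] [DecidableEq ι] (I : ι → Fin n) :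
    (∏ j, √(tupleType I (I j) : ℝ)) ^ 2 ≤ Real.exp 1 ^ Fintype.card ι * facWeight I := by
  rw [← prod_pow]
  simp_rw [Real.sq_sqrt (Nat.cast_nonneg _)]
  rw [prod_comp_eq_prod_pow I (fun i => (tupleType I i : ℝ)), ← sum_tupleType I,
    ← prod_pow_eq_pow_sum, facWeight]
  push_cast
  rw [← prod_mul_distrib]
  exact prod_le_prod (fun i _ => by positivity) fun i _ => pow_self_le_exp_mul_factorial _

theorem tupleType_sum_elim {ι κ : Type*} [Fintype ι] [Fintype κ] (I : ι → Fin n) (J : κ → Fin n) :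
    tupleType (Sum.elim I J) = tupleType I + tupleType J := by
  simp [tupleType]

theorem facWeight_sum_elim_le {ι κ : Type*} [Fintype ι] [DecidableEq ι] [Fintype κ]
    [DecidableEq κ] (I : ι → Fin n) (J : κ → Fin n) :
    facWeight (Sum.elim I J) ≤
      2 ^ (Fintype.card ι + Fintype.card κ) * (facWeight I * facWeight J) := by
  unfold facWeight
  rw [tupleType_sum_elim, ← sum_tupleType I, ← sum_tupleType J, ← sum_add_distrib,
    ← prod_pow_eq_pow_sum, ← prod_mul_distrib, ← prod_mul_distrib]
  refine prod_le_prod (fun _ _ => Nat.zero_le _) fun i _ => ?_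
  rw [Finsupp.add_apply, ← Nat.add_choose_mul_factorial_mul_factorial, mul_assoc]
  exact Nat.mul_le_mul_right _ (Nat.choose_le_two_pow _ _)

/-- Multiplicities of the joint tuple add up, but `(α+β)! ≤ 2^{α+β} α! β!` makes the loss split into
a factor for `I` and one for `J`, as the weighted AM-GM needs. -/
theorem prod_multiplicity_sum_elim_le {s : ℕ} (I J : Fin s → Fin n) :
    ∏ j, √(tupleType (Sum.elim I J) (Sum.elim I J j) : ℝ) ≤
      (2 * Real.exp 1) ^ s * (√(facWeight I) * √(facWeight J)) := by
  refine le_of_sq_le_sq ?_ (by positivity)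
  refine (prod_multiplicity_sq_le _).trans ?_
  have h : (facWeight (Sum.elim I J) : ℝ) ≤ 2 ^ (s + s) * (facWeight I * facWeight J) := by
    have := facWeight_sum_elim_le I J
    simp only [Fintype.card_fin] at this
    exact_mod_cast this
  rw [mul_pow, mul_pow (√_), Real.sq_sqrt (Nat.cast_nonneg _), Real.sq_sqrt (Nat.cast_nonneg _)]
  calc _ ≤ Real.exp 1 ^ Fintype.card (Fin s ⊕ Fin s) *
        (2 ^ (s + s) * (facWeight I * facWeight J)) := by gcongr
    _ = _ := by simp only [Fintype.card_sum, Fintype.card_fin]; rw [mul_pow, mul_pow]; ring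

end Multiplicity

/-! ### The bound for general polynomials -/

section General

variable {n : ℕ}

theorem SosBdd.of_C_mul {k : ℕ} {c a : ℝ} {p : MvPolynomial (Fin n) ℝ}
    (h : SosBdd k c (C a * p)) (ha : 0 < a) : SosBdd k (a⁻¹ * c) p := by
  have h2 := h.C_mul a⁻¹
  rwa [← mul_assoc (C _), ← MvPolynomial.C_mul, inv_mul_cancel₀ ha.ne', C_1, one_mul,
    abs_of_pos (inv_pos.2 ha)] at h2

theorem mform_single {ι A : Type*} [Fintype ι] [DecidableEq ι] [CommRing A]
    (T : (ι → Fin n) → A) (I : ι → Fin n) (w : ι → A) :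
    mform T (fun j => Pi.single (I j) (w j)) = T I * ∏ j, w j := by
  unfold mform
  rw [sum_eq_single I]
  · simp
  · intro L _ hL
    obtain ⟨j, hj⟩ := Function.ne_iff.1 hL
    rw [prod_eq_zero (mem_univ j), mul_zero]
    simp [hj]
  · simp

/-- The monomial `∏ j, X (I j)`. -/
def tupleMonomial {ι : Type*} [Fintype ι] (I : ι → Fin n) : MvPolynomial (Fin n) ℝ := ∏ j, X (I j)

theorem isHomogeneous_tupleMonomial {s : ℕ} (I : Fin s → Fin n) :
    (tupleMonomial I).IsHomogeneous s := by
  have := IsHomogeneous.prod univ (fun j => (X (I j) : MvPolynomial (Fin n) ℝ)) (fun _ => 1)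
    fun j _ => isHomogeneous_X ℝ (I j)
  simpa [tupleMonomial] using this

theorem sum_tupleMonomial_sq (s : ℕ) :
    ∑ I : Fin s → Fin n, tupleMonomial I ^ 2 = normSqPoly n ^ s := by
  have h := Finset.prod_univ_sum (fun _ : Fin s => (univ : Finset (Fin n)))
    (fun _ i => (X i ^ 2 : MvPolynomial (Fin n) ℝ))
  simp only [prod_const, card_univ, Fintype.card_fin, Fintype.piFinset_univ] at h
  rw [normSqPoly, h]
  exact sum_congr rfl fun I _ => by rw [tupleMonomial, prod_pow]

theorem mform_X_sum {s : ℕ} (T : (Fin s ⊕ Fin s → Fin n) → MvPolynomial (Fin n) ℝ) :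
    mform T (fun _ => X) = ∑ I : Fin s → Fin n, ∑ J : Fin s → Fin n,
      tupleMonomial I * tupleMonomial J * T (Sum.elim I J) := by
  unfold mform
  rw [← (Equiv.sumArrowEquivProdArrow (Fin s) (Fin s) (Fin n)).symm.sum_comp,
    Fintype.sum_prod_type]
  refine sum_congr rfl fun I _ => sum_congr rfl fun J _ => ?_
  simp [Equiv.sumArrowEquivProdArrow, tupleMonomial]
  ring

/-- A form of degree `2 (s + r)` whose coefficients in `2 s` of the variables are bounded forms. -/
theorem mem_sosCone_of_sosBdd {s r : ℕ} {T : (Fin s ⊕ Fin s → Fin n) → MvPolynomial (Fin n) ℝ}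
    {c : ℝ} {g : (Fin s → Fin n) → ℝ} (hg : ∀ I, 0 < g I)
    (hT : ∀ I J, SosBdd r (c * (g I * g J)) (T (Sum.elim I J))) :
    C (c * ∑ I, g I ^ 2) * normSqPoly n ^ (s + r) - mform T (fun _ => X) ∈ sosCone n (s + r) := by
  have hcross : ∀ I J : Fin s → Fin n, C (c / 2) * normSqPoly n ^ r *
      (C (g J ^ 2) * tupleMonomial I ^ 2 + C (g I ^ 2) * tupleMonomial J ^ 2) -
        tupleMonomial I * tupleMonomial J * T (Sum.elim I J) ∈ sosCone n (s + r) := by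
    intro I J
    have hI := hg I
    have hJ := hg J
    -- Dividing by `2 g_I g_J` normalizes the cross term and cancels the factor `g_I g_J` of the
    -- bound, so that `x^{2I}` receives `(c/2) g_J²`. Summing over `J` leaves the same total `∑ g²`
    -- for every `I`.
    have h := C_mul_mem_sosCone (cross_term_mem_sosCone (isHomogeneous_tupleMonomial I)
      (isHomogeneous_tupleMonomial J) (hT I J) (g I) (g J))
      (c := 1 / (2 * g I * g J)) (by positivity)
    convert h using 1
    rw [mul_sub]
    congr 1
    · rw [← mul_assoc, ← mul_assoc, ← MvPolynomial.C_mul]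
      congr 3
      field_simp
    · rw [← mul_assoc, ← MvPolynomial.C_mul, one_div_mul_cancel (by positivity), C_1, one_mul]
  have hsum := sum_mem (S := sosCone n (s + r)) (t := univ) fun I _ =>
    sum_mem (t := univ) fun J _ => hcross I J
  convert hsum using 1
  simp_rw [sum_sub_distrib]
  rw [← mform_X_sum]
  congr 1
  simp_rw [mul_add, sum_add_distrib]
  have e1 : ∑ I : Fin s → Fin n, ∑ J : Fin s → Fin n, C (c / 2) * normSqPoly n ^ r *
      (C (g J ^ 2) * tupleMonomial I ^ 2) =
      C (c / 2) * normSqPoly n ^ r * (C (∑ J, g J ^ 2) * normSqPoly n ^ s) := by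
    simp_rw [← mul_sum, ← sum_mul]
    rw [← mul_sum, sum_tupleMonomial_sq, ← map_sum]
  have e2 : ∑ I : Fin s → Fin n, ∑ J : Fin s → Fin n, C (c / 2) * normSqPoly n ^ r *
      (C (g I ^ 2) * tupleMonomial J ^ 2) =
      C (c / 2) * normSqPoly n ^ r * (C (∑ J, g J ^ 2) * normSqPoly n ^ s) := by
    rw [sum_comm, e1]
  rw [e1, e2, pow_add, MvPolynomial.C_mul]
  have hc2 : (C c : MvPolynomial (Fin n) ℝ) = C (c / 2) + C (c / 2) := by
    rw [← C_add]; congr 1; ring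
  rw [hc2]
  ring

variable {D ρ q : ℕ} {f : MvPolynomial (Fin n) ℝ}

theorem card_powTensor_index (ρ D : ℕ) :
    Fintype.card (Fin (2 * ρ) × Fin D) = Fintype.card (Fin (ρ * D) ⊕ Fin (ρ * D)) := by
  simp only [Fintype.card_prod, Fintype.card_fin, Fintype.card_sum]
  ring

/-- The symmetric tensor of `f ^ (2 ρ)`, with positions split into two halves. -/
def splitTensor (ρ D : ℕ) (f : MvPolynomial (Fin n) ℝ) :
    (Fin (ρ * D) ⊕ Fin (ρ * D) → Fin n) → MvPolynomial (Fin n) ℝ :=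
  powTensor (Fintype.equivOfCardEq (card_powTensor_index ρ D)) (polyTensor (Fin D ⊕ Fin 2) f)

/-- At scaled basis vectors the multilinear form is a single entry times the product of the
scalings; dividing by that product costs `(9q)^{ρD}` and the square roots of the multiplicities. -/
theorem sosBdd_splitTensor (hf : f.IsHomogeneous (D + 2)) (hn : 0 < n) (hq : 0 < q)
    (hq' : q = 2 * ρ * (D + 2)) {N : ℝ} (hN : 0 ≤ N) (hG : CandidateBound f (D + 2) q N)
    (I J : Fin (ρ * D) → Fin n) :
    SosBdd (2 * ρ) (2 ^ (2 * (ρ * D)) * (2 * ((2 * Real.exp 1) ^ (D + 2) * N)) ^ (2 * ρ) /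
      (2 * (ρ * D))! * (9 * q) ^ (ρ * D) * (2 * Real.exp 1) ^ (ρ * D) *
        (√(facWeight I) * √(facWeight J))) (splitTensor ρ D f (Sum.elim I J)) := by
  have hρ : 1 ≤ ρ := by
    rcases Nat.eq_zero_or_pos ρ with h | h
    · subst h; simp at hq'; omega
    · exact h
  have hm : Fintype.card (Fin (ρ * D) ⊕ Fin (ρ * D)) = 2 * (ρ * D) := by
    simp only [Fintype.card_fin, Fintype.card_sum]; ring
  have hq2 : q = 2 * (ρ * D) + 4 * ρ := by rw [hq']; ring
  have hDρ : D ≤ ρ * D := Nat.le_mul_of_pos_left D hρ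
  set K := Sum.elim I J with hK
  have hb := sosBdd_mform_powTensor (f := f) (r := 2 * ρ)
    (Fintype.equivOfCardEq (card_powTensor_index ρ D)) (scaledVec q K)
    (Θ := 2 * ((2 * Real.exp 1) ^ (D + 2) * N)) (by
      intro S x
      have h := hess_bound_basePoint hf hn hq hN hG K S (u := 0) (c := 0) (by rw [hm]; omega)
        (by rw [hm]; omega) (Nat.zero_le q) (by simp) (by simp) x
      simpa using h)
  rw [hm] at hb
  set w : Fin (ρ * D) ⊕ Fin (ρ * D) → ℝ := fun j => 1 / (3 * √q * √(tupleType K (K j))) with hw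
  have e : mform (powTensor (Fintype.equivOfCardEq (card_powTensor_index ρ D))
      (polyTensor (Fin D ⊕ Fin 2) f)) (fun j i => C (scaledVec q K j i)) =
      C (∏ j, w j) * splitTensor ρ D f K := by
    have : (fun j i => (C (scaledVec q K j i) : MvPolynomial (Fin n) ℝ)) =
        fun j => Pi.single (K j) (C (w j)) := by
      ext1 j; ext1 i
      simp only [scaledVec, hw, Pi.single_apply]
      split_ifs <;> simp
    rw [this, mform_single, ← map_prod, mul_comm]
    rfl
  rw [e] at hb
  have hq0 : (0 : ℝ) < q := by exact_mod_cast hq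
  have hwpos : ∀ j, 0 < w j := by
    intro j
    have : 0 < tupleType K (K j) := by
      rw [tupleType_apply, card_pos]; exact ⟨j, by simp⟩
    have : (0 : ℝ) < tupleType K (K j) := by exact_mod_cast this
    positivity
  have hprod : 0 < ∏ j, w j := prod_pos fun j _ => hwpos j
  refine (hb.of_C_mul hprod).mono ?_
  have hinv : (∏ j, w j)⁻¹ = (9 * q) ^ (ρ * D) * ∏ j, √(tupleType K (K j) : ℝ) := by
    rw [← prod_inv_distrib]
    simp only [hw, one_div, inv_inv, prod_mul_distrib, prod_const, card_univ, hm]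
    rw [pow_mul (3 : ℝ) 2, pow_mul √(q : ℝ) 2, Real.sq_sqrt hq0.le, ← mul_pow]
    norm_num
  rw [hinv]
  have hle := prod_multiplicity_sum_elim_le I J
  rw [← hK] at hle
  calc _ ≤ (9 * q) ^ (ρ * D) * ((2 * Real.exp 1) ^ (ρ * D) *
        (√(facWeight I) * √(facWeight J))) *
        (2 ^ (2 * (ρ * D)) * (2 * ((2 * Real.exp 1) ^ (D + 2) * N)) ^ (2 * ρ) /
        (2 * (ρ * D))!) := by gcongr
    _ = _ := by ring

/-- Apart from constants to the power `q`, the AM-GM bound is `q^s n^s / (2s)!` times `N^{2ρ}`, and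
`q^{2s}/(2s)! ≤ e^q` turns it into `(n/q)^s`. The constants multiply to `432·12·3 = 15552`, so
`2000000` is generous. -/
theorem sosValue_le_general (hf : f.IsHomogeneous (D + 2)) (hq : 0 < q) (hqn : q ≤ n)
    (hq' : q = 2 * ρ * (D + 2)) {N : ℝ} (hN : 0 ≤ N) (hG : CandidateBound f (D + 2) q N) :
    sosValue (ρ * (D + 2)) (f ^ (2 * ρ)) ≤
      (2000000 : ℝ) ^ q * ((n : ℝ) / q) ^ (ρ * D) * N ^ (2 * ρ) := by
  have hn : 0 < n := by omega
  have hq0 : (0 : ℝ) < q := by exact_mod_cast hq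
  have hpos : ∀ x, 0 ≤ eval x (f ^ (2 * ρ)) := by
    intro x; rw [map_pow, pow_mul]; positivity
  have hq2 : q = 2 * (ρ * D) + 4 * ρ := by rw [hq']; ring
  set s := ρ * D with hs
  set c : ℝ := 2 ^ (2 * s) * (2 * ((2 * Real.exp 1) ^ (D + 2) * N)) ^ (2 * ρ) /
      (2 * s)! * (9 * q) ^ s * (2 * Real.exp 1) ^ s with hc
  have hmem := mem_sosCone_of_sosBdd (g := fun I => √(facWeight I))
    (fun I => Real.sqrt_pos.2 (by exact_mod_cast facWeight_pos I))
    (fun I J => sosBdd_splitTensor hf hn hq hq' hN hG I J)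
  rw [splitTensor, mform_powTensor_X hf] at hmem
  have hk : ρ * D + 2 * ρ = ρ * (D + 2) := by ring
  rw [hk, ← hs, ← hc] at hmem
  refine (sosValue_le_of_mem_sosCone hn hpos (by positivity) hmem).trans ?_
  have hG2 : ∑ I : Fin s → Fin n, √(facWeight I : ℝ) ^ 2 ≤ (2 * n) ^ s := by
    simp_rw [Real.sq_sqrt (Nat.cast_nonneg _)]
    exact_mod_cast sum_facWeight_le (n := n) (s := s) (by omega)
  have hfac : (q : ℝ) ^ (2 * s) / (2 * s)! ≤ Real.exp 1 ^ q := by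
    have := Real.pow_div_factorial_le_exp (q : ℝ) hq0.le (2 * s)
    rwa [← Real.exp_nat_mul, mul_one]
  have he : Real.exp 1 ≤ 3 := by have := Real.exp_one_lt_d9; linarith
  calc c * ∑ I : Fin s → Fin n, √(facWeight I : ℝ) ^ 2 ≤ c * (2 * n) ^ s := by gcongr
    _ = (144 * Real.exp 1) ^ s * (2 ^ (2 * ρ) * (2 * Real.exp 1) ^ q) *
        ((q : ℝ) ^ (2 * s) / (2 * s)!) * ((n : ℝ) / q) ^ s * N ^ (2 * ρ) := by
      have e1 : (2 * Real.exp 1) ^ q = ((2 * Real.exp 1) ^ (D + 2)) ^ (2 * ρ) := by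
        rw [← pow_mul, hq']; congr 1; ring
      rw [hc, e1, div_pow, pow_mul (q : ℝ) 2 s]
      have e2 : (144 * Real.exp 1) ^ s = 4 ^ s * 9 ^ s * (2 * Real.exp 1) ^ s * 2 ^ s := by
        rw [← mul_pow, ← mul_pow, ← mul_pow]; congr 1; ring
      rw [e2, mul_pow 2 ((2 * Real.exp 1) ^ (D + 2) * N), mul_pow ((2 * Real.exp 1) ^ (D + 2)),
        pow_mul 2 2 s, mul_pow 9, mul_pow 2 (n : ℝ), sq (q : ℝ), mul_pow (q : ℝ)]
      have : (q : ℝ) ^ s ≠ 0 := by positivity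
      field_simp
      norm_num
      ring
    _ ≤ (144 * 3) ^ q * (2 ^ q * (2 * 3) ^ q) * 3 ^ q * ((n : ℝ) / q) ^ s * N ^ (2 * ρ) := by
      have a1 : (144 * Real.exp 1) ^ s ≤ (144 * 3) ^ q := by
        calc (144 * Real.exp 1) ^ s ≤ (144 * 3) ^ s := by gcongr
          _ ≤ (144 * 3) ^ q := pow_le_pow_right₀ (by norm_num) (by omega)
      have a2 : (2 : ℝ) ^ (2 * ρ) ≤ 2 ^ q := pow_le_pow_right₀ (by norm_num) (by omega)
      have a3 : (q : ℝ) ^ (2 * s) / (2 * s)! ≤ 3 ^ q := hfac.trans (by gcongr)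
      gcongr
    _ ≤ _ := by
      rw [← mul_pow, ← mul_pow, ← mul_pow]
      gcongr
      norm_num

end General

/-! ### The bound for sparse polynomials -/

section Sparse

variable {n : ℕ} {ι : Type*} [Fintype ι]

theorem exists_perm_of_tupleType_eq {K K' : ι → Fin n} (h : tupleType K = tupleType K') :
    ∃ τ : Equiv.Perm ι, K' ∘ τ = K := by
  have hc : ∀ i, Fintype.card {a // K a = i} = Fintype.card {a // K' a = i} := by
    intro i
    rw [Fintype.card_subtype, Fintype.card_subtype, ← tupleType_apply, ← tupleType_apply, h]
  let e : ∀ i, {a // K a = i} ≃ {a // K' a = i} := fun i => Fintype.equivOfCardEq (hc i)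
  refine ⟨(Equiv.sigmaFiberEquiv K).symm.trans
    ((Equiv.sigmaCongrRight e).trans (Equiv.sigmaFiberEquiv K')), ?_⟩
  funext a
  simp only [Function.comp_apply, Equiv.trans_apply]
  exact (e (K a) ⟨a, rfl⟩).2

variable [DecidableEq ι]

theorem facWeight_eq_card (K : ι → Fin n) :
    facWeight K = Fintype.card {g : Equiv.Perm ι // K ∘ g = K} := by
  rw [DomMulAct.stabilizer_card, facWeight]
  refine prod_congr rfl fun i _ => ?_
  rw [tupleType_apply, Fintype.card_subtype]

/-- The permutations taking `K'` to `K` contain a coset of the stabilizer of `K`, and the order of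
the stabilizer is `facWeight K`. -/
theorem facWeight_le_card {K K' : ι → Fin n} (h : tupleType K = tupleType K') :
    facWeight K ≤ #{σ : Equiv.Perm ι | K' ∘ σ = K} := by
  obtain ⟨τ, hτ⟩ := exists_perm_of_tupleType_eq h
  rw [facWeight_eq_card, Fintype.card_subtype]
  refine card_le_card_of_injOn (fun g => τ * g) ?_ fun g _ g' _ hg => mul_left_cancel hg
  intro g hg
  simp only [coe_filter, mem_univ, true_and, Set.mem_ofPred_eq] at hg ⊢
  rw [Equiv.Perm.coe_mul, ← Function.comp_assoc, hτ, hg]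

/-- Orbit-stabilizer: for distinct `K` the sets of permutations taking a fixed `K₀` to `K` are
disjoint. -/
theorem sum_facWeight_type_le (γ : Fin n →₀ ℕ) :
    ∑ K : ι → Fin n with tupleType K = γ, facWeight K ≤ (Fintype.card ι)! := by
  by_cases h : ∃ K₀ : ι → Fin n, tupleType K₀ = γ
  · obtain ⟨K₀, hK₀⟩ := h
    calc ∑ K : ι → Fin n with tupleType K = γ, facWeight K
        ≤ ∑ K : ι → Fin n with tupleType K = γ, #{σ : Equiv.Perm ι | K₀ ∘ σ = K} := by
          refine sum_le_sum fun K hK => facWeight_le_card ?_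
          rw [(mem_filter.1 hK).2, hK₀]
      _ ≤ ∑ K : ι → Fin n, #{σ : Equiv.Perm ι | K₀ ∘ σ = K} :=
          sum_le_sum_of_subset (filter_subset _ _)
      _ = Fintype.card (Equiv.Perm ι) :=
          (card_eq_sum_card_fiberwise (s := univ) (f := fun σ : Equiv.Perm ι => K₀ ∘ σ)
            (t := univ) (by simp)).symm
      _ = _ := Fintype.card_perm
  · rw [filter_false_of_mem fun K _ hK => h ⟨K, hK⟩]
    simp

theorem exists_multiset_of_mem_support_pow {f : MvPolynomial (Fin n) ℝ} {R : ℕ}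
    {γ : Fin n →₀ ℕ} (h : γ ∈ (f ^ R).support) :
    ∃ s : Multiset f.support, s.card = R ∧ (s.map Subtype.val).sum = γ := by
  induction R generalizing γ with
  | zero =>
    refine ⟨0, rfl, ?_⟩
    rw [pow_zero, mem_support_iff, coeff_one] at h
    simpa using h
  | succ R ih =>
    rw [pow_succ] at h
    have := support_mul _ _ h
    obtain ⟨γ₁, h₁, γ₂, h₂, rfl⟩ := Finset.mem_add.1 this
    obtain ⟨s, hs, hsum⟩ := ih h₁
    refine ⟨⟨γ₂, h₂⟩ ::ₘ s, by simp [hs], ?_⟩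
    simp [hsum, add_comm]

theorem card_support_pow_le (f : MvPolynomial (Fin n) ℝ) (R : ℕ) :
    #(f ^ R).support ≤ (#f.support).multichoose R := by
  have h1 : Fintype.card (Sym f.support R) = (#f.support).multichoose R := by
    rw [Sym.card_sym_eq_multichoose, Fintype.card_coe]
  rw [← h1, ← Finset.card_univ]
  refine le_trans (card_le_card (t := univ.image fun s : Sym f.support R =>
    ((s : Multiset f.support).map Subtype.val).sum) ?_) card_image_le
  intro γ hγ
  obtain ⟨s, hs, hsum⟩ := exists_multiset_of_mem_support_pow hγ
  exact mem_image.2 ⟨⟨s, hs⟩, mem_univ _, hsum⟩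

theorem quadForm_le_frobenius {κ : Type*} [Fintype κ] (M : Matrix κ κ ℝ) {B : ℝ} (hB : 0 ≤ B)
    (hM : ∑ i, ∑ j, M i j ^ 2 ≤ B ^ 2) (z : κ → ℝ) (hz : z ⬝ᵥ z = 1) : z ⬝ᵥ M *ᵥ z ≤ B := by
  have e : z ⬝ᵥ M *ᵥ z = ∑ p : κ × κ, M p.1 p.2 * (z p.1 * z p.2) := by
    rw [Fintype.sum_prod_type]
    simp only [dotProduct, mulVec, mul_sum]
    exact sum_congr rfl fun i _ => sum_congr rfl fun j _ => by ring
  have h := Finset.sum_mul_sq_le_sq_mul_sq univ (fun p : κ × κ => M p.1 p.2)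
    (fun p => z p.1 * z p.2)
  have e2 : ∑ p : κ × κ, (z p.1 * z p.2) ^ 2 = 1 := by
    rw [Fintype.sum_prod_type]
    simp only [mul_pow]
    rw [← sum_mul_sum]
    have : ∑ i, z i ^ 2 = 1 := by rw [← hz]; simp [dotProduct, sq]
    rw [this, one_mul]
  have e3 : ∑ p : κ × κ, M p.1 p.2 ^ 2 = ∑ i, ∑ j, M i j ^ 2 := Fintype.sum_prod_type _
  rw [← e, e2, mul_one, e3] at h
  exact abs_le_of_sq_le_sq' (h.trans hM) hB |>.2

/-- All `q` positions of `f ^ R` are polarized here, so the bound `|f| ≤ N` at base points suffices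
and no Hessian enters. -/
theorem polyTensor_sq_le {f : MvPolynomial (Fin n) ℝ} {d q R : ℕ} (hf : f.IsHomogeneous d)
    (hqι : Fintype.card ι = q) (hdR : d * R = q) (hn : 0 < n) (hq : 0 < q) {N : ℝ} (hN : 0 ≤ N)
    (hG : CandidateBound f d q N) (K : ι → Fin n) :
    polyTensor ι (f ^ R) K ^ 2 ≤
      (2 ^ q * N ^ R / q !) ^ 2 * ((9 * q) ^ q * (Real.exp 1 ^ q * facWeight K)) := by
  have hh : (f ^ R).IsHomogeneous (Fintype.card ι) := by rw [hqι, ← hdR]; exact hf.pow R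
  have hp := polarization (isSymmTensor_polyTensor (ι := ι) (f ^ R)) (scaledVec q K)
  simp_rw [← eval_eq_mform hh] at hp
  have hq0 : (0 : ℝ) < q := by exact_mod_cast hq
  set w : ι → ℝ := fun j => 1 / (3 * √q * √(tupleType K (K j))) with hw
  have e : mform (polyTensor ι (f ^ R)) (scaledVec q K) = polyTensor ι (f ^ R) K * ∏ j, w j :=
    mform_single _ K w
  have hwpos : ∀ j, 0 < w j := by
    intro j
    have : 0 < tupleType K (K j) := by
      rw [tupleType_apply, card_pos]; exact ⟨j, by simp⟩
    have : (0 : ℝ) < tupleType K (K j) := by exact_mod_cast this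
    positivity
  have hprod : 0 < ∏ j, w j := prod_pos fun j _ => hwpos j
  have hb : |(q ! : ℝ) * (polyTensor ι (f ^ R) K * ∏ j, w j)| ≤ 2 ^ q * N ^ R := by
    rw [hqι] at hp
    rw [← e, hp]
    refine (abs_sum_le_sum_abs _ _).trans ?_
    have : ∀ S ∈ (univ : Finset (Finset ι)),
        |(-1) ^ #Sᶜ * eval (∑ j ∈ S, scaledVec q K j) (f ^ R)| ≤ N ^ R := by
      intro S _
      rw [abs_mul, abs_pow, abs_neg, abs_one, one_pow, one_mul, map_pow, abs_pow]
      exact pow_le_pow_left₀ (abs_nonneg _)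
        (abs_eval_basePoint_le hn hq hN hG K S hqι.le) R
    refine (sum_le_sum this).trans (le_of_eq ?_)
    simp [hqι]
  have hfac : (0 : ℝ) < q ! := by positivity
  have hinv : (∏ j, w j)⁻¹ ^ 2 = (9 * q) ^ q * (∏ j, √(tupleType K (K j) : ℝ)) ^ 2 := by
    rw [← prod_inv_distrib]
    simp only [hw, one_div, inv_inv, prod_mul_distrib, prod_const, card_univ, hqι]
    rw [mul_pow _ _ 2, ← mul_pow (3 : ℝ), ← pow_mul, mul_comm q 2, pow_mul, mul_pow,
      Real.sq_sqrt hq0.le]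
    norm_num
  have hle : |polyTensor ι (f ^ R) K| ≤ 2 ^ q * N ^ R / q ! * (∏ j, w j)⁻¹ := by
    rw [abs_mul, abs_mul, abs_of_pos hfac, abs_of_pos hprod] at hb
    rw [← div_eq_mul_inv, div_div, le_div_iff₀ (by positivity)]
    linarith
  rw [← sq_abs]
  calc |polyTensor ι (f ^ R) K| ^ 2 ≤ (2 ^ q * N ^ R / q ! * (∏ j, w j)⁻¹) ^ 2 :=
        pow_le_pow_left₀ (abs_nonneg _) hle 2
    _ = (2 ^ q * N ^ R / q !) ^ 2 * ((9 * q) ^ q * (∏ j, √(tupleType K (K j) : ℝ)) ^ 2) := by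
        rw [mul_pow, hinv]
    _ ≤ _ := by
        have := prod_multiplicity_sq_le K
        rw [hqι] at this
        gcongr

/-- Only tuples whose type is a monomial of `f ^ R` contribute. Each type has total weight at most
`q!`, which cancels one of the two factorials in the denominator; the other is met by `q^q ≤ e^q
q!`. -/
theorem sum_polyTensor_sq_le {f : MvPolynomial (Fin n) ℝ} {d q R : ℕ} (hf : f.IsHomogeneous d)
    (hqι : Fintype.card ι = q) (hdR : d * R = q) (hn : 0 < n) (hq : 0 < q) {N : ℝ} (hN : 0 ≤ N)
    (hG : CandidateBound f d q N) :
    ∑ K, polyTensor ι (f ^ R) K ^ 2 ≤ (36 * Real.exp 1 ^ 2) ^ q * (N ^ R) ^ 2 *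
      #(f ^ R).support := by
  set c : ℝ := (2 ^ q * N ^ R / q !) ^ 2 * ((9 * q) ^ q * Real.exp 1 ^ q) with hc
  have hc0 : 0 ≤ c := by positivity
  have h1 : ∀ K : ι → Fin n, polyTensor ι (f ^ R) K ^ 2 ≤
      ∑ γ ∈ (f ^ R).support, if tupleType K = γ then c * facWeight K else 0 := by
    intro K
    by_cases h0 : polyTensor ι (f ^ R) K = 0
    · rw [h0]
      refine le_trans (by norm_num) (sum_nonneg fun γ _ => ?_)
      split_ifs <;> positivity
    · rw [sum_ite_eq, if_pos (tupleType_mem_support h0)]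
      refine (polyTensor_sq_le hf hqι hdR hn hq hN hG K).trans (le_of_eq ?_)
      rw [hc]; ring
  refine (sum_le_sum fun K _ => h1 K).trans ?_
  rw [sum_comm]
  have h2 : ∀ γ ∈ (f ^ R).support, (∑ K : ι → Fin n, if tupleType K = γ then c * facWeight K
      else 0) ≤ c * q ! := by
    intro γ _
    rw [← sum_filter, ← mul_sum]
    refine mul_le_mul_of_nonneg_left ?_ hc0
    have := sum_facWeight_type_le (ι := ι) γ
    rw [hqι] at this
    exact_mod_cast this
  refine (sum_le_sum h2).trans ?_
  rw [sum_const, nsmul_eq_mul, mul_comm]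
  refine mul_le_mul_of_nonneg_right ?_ (Nat.cast_nonneg _)
  have hfac : (q : ℝ) ^ q / q ! ≤ Real.exp 1 ^ q := by
    have := Real.pow_div_factorial_le_exp (q : ℝ) (by positivity) q
    rwa [← Real.exp_nat_mul, mul_one]
  have e1 : (36 : ℝ) ^ q = (2 ^ q) ^ 2 * 9 ^ q := by
    rw [← pow_mul, mul_comm q 2, pow_mul, ← mul_pow]; norm_num
  calc c * q ! = (2 ^ q) ^ 2 * 9 ^ q * Real.exp 1 ^ q * (N ^ R) ^ 2 * ((q : ℝ) ^ q / q !) := by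
        rw [hc, mul_pow 9]; field_simp
    _ ≤ (2 ^ q) ^ 2 * 9 ^ q * Real.exp 1 ^ q * (N ^ R) ^ 2 * Real.exp 1 ^ q := by gcongr
    _ = _ := by rw [mul_pow, e1]; ring

/-- The count of multisets is at most `(m+R)^R / R!`. With `M = max(1, m/q)` one has `m + R ≤ (d+1)
R M ≤ 2^d R M`, and `2^{dR} = 2^q` is harmless. -/
theorem card_support_pow_le_max (f : MvPolynomial (Fin n) ℝ) {d q R : ℕ} (hd : 0 < d)
    (hR : 0 < R) (hdR : d * R = q) :
    (#(f ^ R).support : ℝ) ≤ (2 * Real.exp 1) ^ q * max 1 ((#f.support : ℝ) / q) ^ R := by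
  set m := #f.support
  set M := max 1 ((m : ℝ) / q) with hM
  have hR0 : (0 : ℝ) < R := by exact_mod_cast hR
  have hd0 : (0 : ℝ) < d := by exact_mod_cast hd
  have hq0 : (0 : ℝ) < q := by rw [← hdR]; push_cast; positivity
  have h1 : (#(f ^ R).support : ℝ) ≤ ((m + R : ℕ) : ℝ) ^ R / R ! := by
    have := card_support_pow_le f R
    rw [Nat.multichoose_eq] at this
    calc (#(f ^ R).support : ℝ) ≤ ((m + R - 1).choose R : ℕ) := by exact_mod_cast this
      _ ≤ ((m + R - 1 : ℕ) : ℝ) ^ R / R ! := Nat.choose_le_pow_div _ _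
      _ ≤ _ := by gcongr; omega
  have hMm : (m : ℝ) ≤ q * M := by
    rw [mul_comm, ← div_le_iff₀ hq0]; exact le_max_right _ _
  have hM1 : 1 ≤ M := le_max_left _ _
  have h2 : ((m + R : ℕ) : ℝ) ≤ R * (2 ^ d * M) := by
    have hdd : ((d : ℝ) + 1) ≤ 2 ^ d := by exact_mod_cast Nat.lt_two_pow_self
    have hqR : (q : ℝ) = d * R := by exact_mod_cast hdR.symm
    push_cast
    calc (m : ℝ) + R ≤ q * M + R * M := by nlinarith
      _ = R * ((d + 1) * M) := by rw [hqR]; ring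
      _ ≤ _ := by gcongr
  have hfac : (R : ℝ) ^ R / R ! ≤ Real.exp 1 ^ R := by
    have := Real.pow_div_factorial_le_exp (R : ℝ) (by positivity) R
    rwa [← Real.exp_nat_mul, mul_one]
  have hRq : R ≤ q := by rw [← hdR]; exact Nat.le_mul_of_pos_left R hd
  calc (#(f ^ R).support : ℝ) ≤ ((m + R : ℕ) : ℝ) ^ R / R ! := h1
    _ ≤ (R * (2 ^ d * M)) ^ R / R ! := by gcongr
    _ = ((R : ℝ) ^ R / R !) * 2 ^ q * M ^ R := by
        rw [mul_pow, mul_pow, ← pow_mul, hdR]; ring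
    _ ≤ Real.exp 1 ^ R * 2 ^ q * M ^ R := by gcongr
    _ ≤ Real.exp 1 ^ q * 2 ^ q * M ^ R := by
        gcongr
        exact Real.one_le_exp zero_le_one
    _ = _ := by rw [mul_pow]; ring

/-- The flattened symmetric tensor of `f^{2ρ}` is a matrix representation, and its Frobenius norm
dominates its quadratic form. -/
theorem sosValue_le_sparse {f : MvPolynomial (Fin n) ℝ} {d ρ q : ℕ} (hf : f.IsHomogeneous d)
    (hq : 0 < q) (hqn : q ≤ n) (hq' : q = 2 * ρ * d) {N : ℝ} (hN : 0 ≤ N)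
    (hG : CandidateBound f d q N) :
    sosValue (ρ * d) (f ^ (2 * ρ)) ≤
      (50 : ℝ) ^ q * √(max 1 ((#f.support : ℝ) / q)) ^ (2 * ρ) * N ^ (2 * ρ) := by
  have hn : 0 < n := by omega
  have hρ : 0 < ρ := by
    rcases Nat.eq_zero_or_pos ρ with h | h
    · subst h; simp at hq'; omega
    · exact h
  have hd : 0 < d := by
    rcases Nat.eq_zero_or_pos d with h | h
    · subst h; simp at hq'; omega
    · exact h
  have hpos : ∀ x, 0 ≤ eval x (f ^ (2 * ρ)) := by
    intro x; rw [map_pow, pow_mul]; positivity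
  have hcard : Fintype.card (Fin (ρ * d) ⊕ Fin (ρ * d)) = q := by
    simp only [Fintype.card_sum, Fintype.card_fin, hq']; ring
  have hdR : d * (2 * ρ) = q := by rw [hq']; ring
  have hh : (f ^ (2 * ρ)).IsHomogeneous (Fintype.card (Fin (ρ * d) ⊕ Fin (ρ * d))) := by
    rw [hcard, ← hdR]; exact hf.pow _
  set T := polyTensor (Fin (ρ * d) ⊕ Fin (ρ * d)) (f ^ (2 * ρ)) with hT
  set M : Matrix (Fin (ρ * d) → Fin n) (Fin (ρ * d) → Fin n) ℝ := fun I J => T (Sum.elim I J)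
    with hM
  have hrep : IsMatrixRep (ρ * d) (f ^ (2 * ρ)) M := by
    constructor
    · ext I J
      refine Eq.trans (congrArg T ?_) (isSymmTensor_polyTensor (f ^ (2 * ρ))
        (Equiv.sumComm (Fin (ρ * d)) (Fin (ρ * d))) (Sum.elim I J))
      funext j
      rcases j with j | j <;> rfl
    · intro x
      rw [eval_eq_mform hh, mform,
        ← (Equiv.sumArrowEquivProdArrow (Fin (ρ * d)) (Fin (ρ * d)) (Fin n)).symm.sum_comp,
        Fintype.sum_prod_type]
      simp only [dotProduct, mulVec, mul_sum, tensorPow]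
      refine sum_congr rfl fun I _ => sum_congr rfl fun J _ => ?_
      simp [Equiv.sumArrowEquivProdArrow, hM, hT]
      ring
  refine sosValue_le_of_isMatrixRep hn hpos hrep (by positivity)
    (quadForm_le_frobenius M (by positivity) ?_)
  have e : ∑ I, ∑ J, M I J ^ 2 = ∑ K, T K ^ 2 := by
    rw [← (Equiv.sumArrowEquivProdArrow (Fin (ρ * d)) (Fin (ρ * d)) (Fin n)).symm.sum_comp,
      Fintype.sum_prod_type]
    rfl
  rw [e]
  refine (sum_polyTensor_sq_le hf hcard hdR hn hq hN hG).trans ?_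
  have hs := card_support_pow_le_max f hd (by omega : 0 < 2 * ρ) hdR
  have he : Real.exp 1 ≤ 3 := by have := Real.exp_one_lt_d9; linarith
  set Mx := max 1 ((#f.support : ℝ) / q) with hMx
  have hM1 : 1 ≤ Mx := le_max_left _ _
  calc (36 * Real.exp 1 ^ 2) ^ q * (N ^ (2 * ρ)) ^ 2 * #(f ^ (2 * ρ)).support
      ≤ (36 * Real.exp 1 ^ 2) ^ q * (N ^ (2 * ρ)) ^ 2 *
        ((2 * Real.exp 1) ^ q * Mx ^ (2 * ρ)) := by gcongr
    _ ≤ (36 * 3 ^ 2) ^ q * (N ^ (2 * ρ)) ^ 2 * ((2 * 3) ^ q * Mx ^ (2 * ρ)) := by gcongr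
    _ = (36 * 3 ^ 2 * (2 * 3)) ^ q * ((N ^ (2 * ρ)) ^ 2 * Mx ^ (2 * ρ)) := by
        rw [mul_pow (36 * 3 ^ 2 : ℝ)]; ring
    -- `36·9·6 = 1944 ≤ 50²`.
    _ ≤ (50 ^ 2) ^ q * ((N ^ (2 * ρ)) ^ 2 * Mx ^ (2 * ρ)) := by gcongr; norm_num
    _ = _ := by
        have h2 : (√Mx ^ (2 * ρ)) ^ 2 = Mx ^ (2 * ρ) := by
          rw [← pow_mul, mul_comm, pow_mul, Real.sq_sqrt (by linarith)]
        rw [mul_pow, mul_pow, h2, ← pow_mul, mul_comm 2 q, pow_mul]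
        ring

end Sparse

/-! ### The bound for polynomials with non-negative coefficients -/

section Nonneg

variable {n : ℕ}

/-- Forms of degree `e` with non-negative coefficients. -/
def NonnegForm (e : ℕ) (W : MvPolynomial (Fin n) ℝ) : Prop :=
  W.IsHomogeneous e ∧ ∀ μ, 0 ≤ W.coeff μ

theorem NonnegForm.sum {κ : Type*} (s : Finset κ) {e : ℕ} {W : κ → MvPolynomial (Fin n) ℝ}
    (h : ∀ i ∈ s, NonnegForm e (W i)) : NonnegForm e (∑ i ∈ s, W i) := by
  refine ⟨IsHomogeneous.sum _ _ _ fun i hi => (h i hi).1, fun μ => ?_⟩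
  rw [coeff_sum]
  exact sum_nonneg fun i hi => (h i hi).2 μ

theorem NonnegForm.mul {e e' : ℕ} {W W' : MvPolynomial (Fin n) ℝ} (h : NonnegForm e W)
    (h' : NonnegForm e' W') : NonnegForm (e + e') (W * W') := by
  refine ⟨h.1.mul h'.1, fun μ => ?_⟩
  rw [coeff_mul]
  exact sum_nonneg fun p _ => mul_nonneg (h.2 _) (h'.2 _)

theorem nonnegForm_C {c : ℝ} (hc : 0 ≤ c) : NonnegForm 0 (C c : MvPolynomial (Fin n) ℝ) := by
  refine ⟨isHomogeneous_C _ _, fun μ => ?_⟩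
  rw [coeff_C]; split_ifs <;> simp [hc]

theorem nonnegForm_X (i : Fin n) : NonnegForm 1 (X i : MvPolynomial (Fin n) ℝ) := by
  refine ⟨isHomogeneous_X _ _, fun μ => ?_⟩
  rw [coeff_X]; split_ifs <;> simp

theorem NonnegForm.prod {κ : Type*} (s : Finset κ) {e : ℕ} {W : κ → MvPolynomial (Fin n) ℝ}
    (h : ∀ i ∈ s, NonnegForm e (W i)) : NonnegForm (e * #s) (∏ i ∈ s, W i) := by
  classical
  induction s using Finset.induction_on with
  | empty => simpa using nonnegForm_C (n := n) zero_le_one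
  | insert a s ha ih =>
    rw [prod_insert ha, card_insert_of_notMem ha, mul_add, mul_one, add_comm]
    exact (h a (mem_insert_self a s)).mul (ih fun i hi => h i (mem_insert_of_mem hi))

theorem nonnegForm_quadPoly {Q : Matrix (Fin n) (Fin n) ℝ} (hQ : ∀ i j, 0 ≤ Q i j) :
    NonnegForm 2 (quadPoly Q) := by
  refine NonnegForm.sum _ fun i _ => NonnegForm.sum _ fun j _ => ?_
  simpa using (nonnegForm_C (hQ i j)).mul ((nonnegForm_X i).mul (nonnegForm_X j))

/-- The entries are averages of products of `2ρ` quadratic forms. Their degree `4ρ` equals `2q/d`,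
the degree of the moment constraints. -/
theorem nonnegForm_splitTensor {f : MvPolynomial (Fin n) ℝ} (hf : ∀ μ, 0 ≤ f.coeff μ)
    (ρ D : ℕ) (K : Fin (ρ * D) ⊕ Fin (ρ * D) → Fin n) :
    NonnegForm (2 * (2 * ρ)) (splitTensor ρ D f K) := by
  unfold splitTensor powTensor symmetrize
  rw [MvPolynomial.smul_eq_C_mul]
  have h := (nonnegForm_C (n := n) (c := ((Fintype.card (Fin (ρ * D) ⊕ Fin (ρ * D)))! : ℝ)⁻¹)
    (by positivity)).mul (NonnegForm.sum (univ : Finset (Equiv.Perm (Fin (ρ * D) ⊕ Fin (ρ * D))))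
    (W := fun σ => prodTensor (2 * ρ) (polyTensor (Fin D ⊕ Fin 2) f)
      ((K ∘ σ) ∘ (Fintype.equivOfCardEq (card_powTensor_index ρ D)))) (e := 2 * (2 * ρ))
    fun σ _ => ?_)
  · simpa using h
  · have := NonnegForm.prod (univ : Finset (Fin (2 * ρ))) (e := 2)
      (W := fun l => quadPoly fun i k => polyTensor (Fin D ⊕ Fin 2) f (Sum.elim (fun j =>
        ((K ∘ σ) ∘ (Fintype.equivOfCardEq (card_powTensor_index ρ D))) (l, j)) ![i, k]))
      fun l _ => nonnegForm_quadPoly fun i k => polyTensor_nonneg hf _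
    simpa [prodTensor] using this

/-! #### Pseudoexpectations -/

/-- A linear extension to all polynomials of a pseudoexpectation of degree `q` that respects the
sphere constraint and the moment constraints of degree `e`. -/
structure ExtPseudo (q e : ℕ) (E : MvPolynomial (Fin n) ℝ →ₗ[ℝ] ℝ) : Prop where
  map_one : E 1 = 1
  sq_nonneg : ∀ p : MvPolynomial (Fin n) ℝ, (p ^ 2).totalDegree ≤ q → 0 ≤ E (p ^ 2)
  sphere : ∀ p : MvPolynomial (Fin n) ℝ, (p * (normSqPoly n - 1)).totalDegree ≤ q →
    E (p * (normSqPoly n - 1)) = 0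
  moment : ∀ (β : Fin n →₀ ℕ) (p : MvPolynomial (Fin n) ℝ), β.degree = e →
    (p ^ 2 * monomial β 1).totalDegree ≤ q → 0 ≤ E (p ^ 2 * monomial β 1)

/-- A functional on all polynomials can be manipulated linearly without membership proofs. Of the
product constraints only those with a single moment are kept. -/
theorem exists_extPseudo {q e : ℕ} {E : restrictTotalDegree (Fin n) ℝ q →ₗ[ℝ] ℝ}
    (hE : IsPseudoexpectation E) (hC : Respects E (sphereConstraint n) (momentConstraints n e)) :
    ∃ E' : MvPolynomial (Fin n) ℝ →ₗ[ℝ] ℝ, ExtPseudo q e E' ∧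
      ∀ p (hp : p ∈ restrictTotalDegree (Fin n) ℝ q), E' p = E ⟨p, hp⟩ := by
  obtain ⟨E', hE'⟩ := E.exists_extend
  have hext : ∀ p (hp : p ∈ restrictTotalDegree (Fin n) ℝ q), E' p = E ⟨p, hp⟩ := by
    intro p hp
    rw [← hE']; rfl
  refine ⟨E', ⟨?_, ?_, ?_, ?_⟩, hext⟩
  · rw [hext 1 (one_mem_restrictTotalDegree n q)]; exact hE.map_one _
  · intro p hp
    rw [hext _ (by rwa [mem_restrictTotalDegree])]; exact hE.sq_nonneg _ _
  · intro p hp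
    rw [hext _ (by rwa [mem_restrictTotalDegree])]
    exact hC.eq_zero _ rfl _ _
  · intro β p hβ hp
    have h := hC.nonneg {monomial β 1} (by
      intro g hg; rw [mem_singleton] at hg; exact ⟨β, hβ, hg⟩) p
    simp only [prod_singleton] at h
    have hp' : p ^ 2 * monomial β 1 ∈ restrictTotalDegree (Fin n) ℝ q := by
      rwa [mem_restrictTotalDegree]
    rw [hext _ hp']
    exact h hp'

variable {q e : ℕ} {E : MvPolynomial (Fin n) ℝ →ₗ[ℝ] ℝ}

theorem ExtPseudo.nonneg_of_mem_sosCone (hE : ExtPseudo q e E) {k : ℕ} (hk : 2 * k ≤ q)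
    {p : MvPolynomial (Fin n) ℝ} (hp : p ∈ sosCone n k) : 0 ≤ E p := by
  induction hp using AddSubmonoid.closure_induction with
  | mem p hp =>
    obtain ⟨g, hg, rfl⟩ := hp
    exact hE.sq_nonneg g ((hg.pow 2).totalDegree_le.trans (by omega))
  | zero => simp
  | add p p' _ _ h h' => rw [map_add]; exact add_nonneg h h'

theorem isHomogeneous_normSqPoly : (normSqPoly n).IsHomogeneous 2 :=
  IsHomogeneous.sum _ _ _ fun i _ => isHomogeneous_X_pow i 2

theorem ExtPseudo.map_normSqPoly_pow (hE : ExtPseudo q e E) {k : ℕ} (hk : 2 * k ≤ q) :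
    E (normSqPoly n ^ k) = 1 := by
  induction k with
  | zero => simpa using hE.map_one
  | succ k ih =>
    have h := hE.sphere (normSqPoly n ^ k) (by
      rw [mul_sub, mul_one, ← pow_succ]
      refine (totalDegree_sub _ _).trans (max_le ?_ ?_)
      · exact (isHomogeneous_normSqPoly.pow _).totalDegree_le.trans (by omega)
      · exact (isHomogeneous_normSqPoly.pow _).totalDegree_le.trans (by omega))
    rw [mul_sub, mul_one, ← pow_succ, map_sub, ih (by omega)] at h
    linarith

/-- Expanded into monomials of degree `e`, each term is a non-negative multiple of a moment
constraint times a square. -/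
theorem ExtPseudo.nonneg_sq_mul (hE : ExtPseudo q e E) {s : ℕ} (hs : 2 * s + e ≤ q)
    {p W : MvPolynomial (Fin n) ℝ} (hp : p.IsHomogeneous s) (hW : NonnegForm e W) :
    0 ≤ E (p ^ 2 * W) := by
  conv_rhs => rw [W.as_sum]
  rw [mul_sum, map_sum]
  refine sum_nonneg fun β hβ => ?_
  have hdeg : β.degree = e := by
    by_contra h
    exact (mem_support_iff.1 hβ) (hW.1.coeff_eq_zero h)
  have : p ^ 2 * monomial β (W.coeff β) = W.coeff β • (p ^ 2 * monomial β 1) := by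
    rw [MvPolynomial.smul_eq_C_mul, mul_left_comm, C_mul_monomial, mul_one]
  rw [this, map_smul]
  refine mul_nonneg (hW.2 β) (hE.moment β p hdeg ?_)
  exact ((hp.pow 2).mul (isHomogeneous_monomial 1 hdeg)).totalDegree_le.trans (by omega)

/-- Bound for `E (∑ X^I X^J T_{IJ})` by weighted row sums. -/
theorem ExtPseudo.map_mform_le (hE : ExtPseudo q e E) {s : ℕ} (hs : 2 * s + e ≤ q)
    {T : (Fin s ⊕ Fin s → Fin n) → MvPolynomial (Fin n) ℝ} (hT : IsSymmTensor T)
    (hTn : ∀ K, NonnegForm e (T K)) {g : (Fin s → Fin n) → ℝ} (hg : ∀ I, 0 < g I) :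
    E (mform T (fun _ => X)) ≤
      ∑ I, ∑ J, g J / g I * E (tupleMonomial I ^ 2 * T (Sum.elim I J)) := by
  have hTs : ∀ I J : Fin s → Fin n, T (Sum.elim J I) = T (Sum.elim I J) := by
    intro I J
    rw [← hT (Equiv.sumComm _ _) (Sum.elim I J)]
    congr 1
    funext j
    rcases j with j | j <;> rfl
  have hcross : ∀ I J : Fin s → Fin n, E (tupleMonomial I * tupleMonomial J * T (Sum.elim I J)) ≤
      1 / 2 * (g J / g I * E (tupleMonomial I ^ 2 * T (Sum.elim I J))) +
      1 / 2 * (g I / g J * E (tupleMonomial J ^ 2 * T (Sum.elim I J))) := by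
    intro I J
    have hI := hg I
    have hJ := hg J
    -- Expanding `E[(g_J x^I - g_I x^J)² T_{IJ}] ≥ 0` and dividing by `2 g_I g_J` bounds the cross
    -- term by two diagonal ones; symmetry in `I` and `J` merges them into one row sum.
    have h := hE.nonneg_sq_mul hs (((isHomogeneous_tupleMonomial I).C_mul (g J)).sub
      ((isHomogeneous_tupleMonomial J).C_mul (g I))) (hTn (Sum.elim I J))
    have e1 : (C (g J) * tupleMonomial I - C (g I) * tupleMonomial J) ^ 2 * T (Sum.elim I J) =
        (g J ^ 2) • (tupleMonomial I ^ 2 * T (Sum.elim I J)) -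
        (2 * g I * g J) • (tupleMonomial I * tupleMonomial J * T (Sum.elim I J)) +
        (g I ^ 2) • (tupleMonomial J ^ 2 * T (Sum.elim I J)) := by
      simp only [MvPolynomial.smul_eq_C_mul, map_pow, map_mul, map_ofNat]
      ring
    rw [e1, map_add, map_sub, map_smul, map_smul, map_smul, smul_eq_mul, smul_eq_mul,
      smul_eq_mul] at h
    set x := E (tupleMonomial I * tupleMonomial J * T (Sum.elim I J))
    set y := E (tupleMonomial I ^ 2 * T (Sum.elim I J))
    set z := E (tupleMonomial J ^ 2 * T (Sum.elim I J))
    have h2 : 1 / 2 * (g J / g I * y) + 1 / 2 * (g I / g J * z) - x =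
        (g J ^ 2 * y - 2 * g I * g J * x + g I ^ 2 * z) / (2 * g I * g J) := by
      field_simp
      ring
    have h3 : 0 ≤ (g J ^ 2 * y - 2 * g I * g J * x + g I ^ 2 * z) / (2 * g I * g J) := by
      positivity
    linarith
  rw [mform_X_sum, map_sum]
  simp_rw [map_sum]
  refine (sum_le_sum fun I _ => sum_le_sum fun J _ => hcross I J).trans (le_of_eq ?_)
  simp_rw [sum_add_distrib, ← mul_sum]
  have e2 : ∑ I : Fin s → Fin n, ∑ J : Fin s → Fin n,
      g I / g J * E (tupleMonomial J ^ 2 * T (Sum.elim I J)) =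
      ∑ I : Fin s → Fin n, ∑ J : Fin s → Fin n,
        g J / g I * E (tupleMonomial I ^ 2 * T (Sum.elim I J)) := by
    rw [sum_comm]
    exact sum_congr rfl fun J _ => sum_congr rfl fun I _ => by rw [hTs]
  rw [e2]
  ring

/-! #### Peaked vectors dominate the multiplicity weights -/

/-- Extension by zero of a bounded vector of multiplicities. -/
def extNat {q : ℕ} (c : Fin n → Fin (q + 1)) : ℕ → ℕ := fun i =>
  if h : i < n then c ⟨i, h⟩ else 0

theorem extNat_apply {q : ℕ} (c : Fin n → Fin (q + 1)) (i : Fin n) :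
    extNat c i = c i := by simp [extNat]

/-- The multiplicity vectors of total size at most `q`. -/
def peakSet (n q : ℕ) : Finset (Fin n → Fin (q + 1)) := {c | ∑ i, (c i : ℕ) ≤ q}

/-- Without the size restriction the sum is a product of `n` truncated geometric series, each at
most `1 + 2x` for `x = q/(2n) ≤ 1/2`, and `(1 + q/n)^n ≤ e^q`. -/
theorem sum_peakSet_le (hn : 0 < n) {q : ℕ} (hq : q ≤ n) :
    ∑ c ∈ peakSet n q, ((q : ℝ) / (2 * n)) ^ (∑ i, (c i : ℕ)) ≤ Real.exp 1 ^ q := by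
  have hn' : (0 : ℝ) < n := by exact_mod_cast hn
  have hqn : (q : ℝ) ≤ n := by exact_mod_cast hq
  set x : ℝ := (q : ℝ) / (2 * n) with hx
  have hx0 : 0 ≤ x := by positivity
  have hx1 : x ≤ 1 / 2 := by rw [hx, div_le_iff₀ (by positivity)]; linarith
  have hgeom : ∑ j : Fin (q + 1), x ^ (j : ℕ) ≤ 1 + 2 * x := by
    rw [Fin.sum_univ_eq_sum_range (fun j => x ^ j)]
    have h := geom_sum_mul_neg x (q + 1)
    have hpos : 0 ≤ x ^ (q + 1) := by positivity
    have h1 : (∑ j ∈ range (q + 1), x ^ j) * (1 - x) ≤ (1 + 2 * x) * (1 - x) := by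
      rw [h]; nlinarith
    exact le_of_mul_le_mul_right h1 (by linarith)
  calc ∑ c ∈ peakSet n q, x ^ (∑ i, (c i : ℕ))
      ≤ ∑ c : Fin n → Fin (q + 1), x ^ (∑ i, (c i : ℕ)) :=
        sum_le_sum_of_subset_of_nonneg (subset_univ _) fun c _ _ => by positivity
    _ = (∑ j : Fin (q + 1), x ^ (j : ℕ)) ^ n := by
        have h := Finset.prod_univ_sum (fun _ : Fin n => (univ : Finset (Fin (q + 1))))
          (fun _ j => x ^ (j : ℕ))
        simp only [prod_const, card_univ, Fintype.card_fin, Fintype.piFinset_univ] at h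
        rw [h]
        exact sum_congr rfl fun c _ => by rw [prod_pow_eq_pow_sum]
    _ ≤ (1 + 2 * x) ^ n := by gcongr
    _ ≤ Real.exp (2 * x) ^ n := by
        gcongr
        have := Real.add_one_le_exp (2 * x); linarith
    _ = Real.exp 1 ^ q := by
        rw [← Real.exp_nat_mul, ← Real.exp_nat_mul]
        congr 1
        rw [hx]; field_simp

/-- Put `c = ⌊α/2⌋` and let `Y` be `√n` times the peaked coordinate. Then `Y ≥ 1` and `Y² ≥ nc/q`,
so `Y^α ≥ (nc/q)^c` and the factor `(q/2n)^c` leaves `(c/2)^c`; finally `5^α (c/2)^c ≥ α^{α/2}`. The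
height `c` is half of `α` so that `(Y²)^c` fits into `Y^α` and pays for a weight that is summable
over `c`. -/
theorem sqrt_pow_le_peak {n q : ℕ} (hn : 0 < n) (hq : 0 < q) (α : ℕ) :
    √(α : ℝ) ^ α ≤ (5 * √n) ^ α * ((q : ℝ) / (2 * n)) ^ (α / 2) *
      (1 / √n + √(((α / 2 : ℕ) : ℝ) / q)) ^ α := by
  have hn' : (0 : ℝ) < n := by exact_mod_cast hn
  have hq' : (0 : ℝ) < q := by exact_mod_cast hq
  have hsn : (0 : ℝ) < √n := Real.sqrt_pos.2 hn'
  set c := α / 2 with hc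
  set Y : ℝ := √n * (1 / √n + √((c : ℝ) / q)) with hY
  have hY1 : 1 ≤ Y := by
    rw [hY, mul_add, mul_one_div_cancel hsn.ne']
    have : 0 ≤ √(n : ℝ) * √((c : ℝ) / q) := by positivity
    linarith
  have hY2 : (n : ℝ) * c / q ≤ Y ^ 2 := by
    have h0 : √(n : ℝ) * √((c : ℝ) / q) ≤ Y := by
      rw [hY, mul_add, mul_one_div_cancel hsn.ne']; linarith
    have h1 : (√(n : ℝ) * √((c : ℝ) / q)) ^ 2 = n * c / q := by
      rw [mul_pow, Real.sq_sqrt hn'.le, Real.sq_sqrt (by positivity)]; ring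
    rw [← h1]
    exact pow_le_pow_left₀ (by positivity) h0 2
  have hY3 : ((c : ℝ) / 2) ^ c ≤ ((q : ℝ) / (2 * n)) ^ c * (Y ^ 2) ^ c := by
    rw [← mul_pow]
    refine pow_le_pow_left₀ (by positivity) ?_ c
    calc (c : ℝ) / 2 = (q : ℝ) / (2 * n) * (n * c / q) := by field_simp
      _ ≤ _ := by gcongr
  have hrhs : (5 * √n) ^ α * ((q : ℝ) / (2 * n)) ^ c * (1 / √n + √((c : ℝ) / q)) ^ α =
      5 ^ α * (((q : ℝ) / (2 * n)) ^ c * Y ^ α) := by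
    rw [hY, mul_pow √(n : ℝ), mul_pow 5]; ring
  rw [hrhs]
  have hYα : (Y ^ 2) ^ c ≤ Y ^ α := by
    rw [← pow_mul]; exact pow_le_pow_right₀ hY1 (by omega)
  have hmain : ((c : ℝ) / 2) ^ c ≤ ((q : ℝ) / (2 * n)) ^ c * Y ^ α :=
    hY3.trans (by gcongr)
  refine le_trans ?_ (mul_le_mul_of_nonneg_left hmain (by positivity))
  rcases Nat.even_or_odd' α with ⟨m, hm | hm⟩
  · have hcm : c = m := by omega
    rw [hcm, hm, pow_mul, Real.sq_sqrt (Nat.cast_nonneg _), pow_mul, ← mul_pow]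
    refine pow_le_pow_left₀ (by positivity) ?_ m
    push_cast
    have : (0 : ℝ) ≤ m := Nat.cast_nonneg m
    linarith
  · have hcm : c = m := by omega
    rw [hcm, hm, pow_succ, pow_mul, Real.sq_sqrt (Nat.cast_nonneg _), pow_succ, pow_mul]
    rcases Nat.eq_zero_or_pos m with h0 | h0
    · subst h0; simp
    · have hm1 : (1 : ℝ) ≤ m := by exact_mod_cast h0
      -- For odd `α = 2m + 1`, the half power `√(2m+1)` is absorbed by `3^m`, and `9m ≤ 25·(m/2)`.
      have h1 : (((2 * m + 1 : ℕ) : ℝ)) ^ m ≤ (3 * m) ^ m := by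
        refine pow_le_pow_left₀ (by positivity) ?_ m
        push_cast; linarith
      have h2 : √((2 * m + 1 : ℕ) : ℝ) ≤ 3 ^ m := by
        have hb : ((2 * m + 1 : ℕ) : ℝ) ≤ 3 ^ m := by
          have := one_add_mul_le_pow (show (-2 : ℝ) ≤ 2 by norm_num) m
          norm_num at this
          push_cast; linarith
        rw [Real.sqrt_le_left (by positivity)]
        refine hb.trans ?_
        rw [sq]
        exact le_mul_of_one_le_left (by positivity) (one_le_pow₀ (by norm_num))
      calc _ ≤ (3 * (m : ℝ)) ^ m * 3 ^ m := by gcongr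
        _ = (9 * (m : ℝ)) ^ m := by rw [← mul_pow]; congr 1; ring
        _ ≤ (5 ^ 2 * ((m : ℝ) / 2)) ^ m := by
            refine pow_le_pow_left₀ (by positivity) ?_ m
            linarith
        _ ≤ _ := by
            rw [mul_pow]
            have : (0 : ℝ) ≤ (5 ^ 2) ^ m * ((m : ℝ) / 2) ^ m := by positivity
            linarith

/-- One summand suffices for a given `J`, the one whose peaks are half its multiplicities, and the
others are non-negative. The sum over all `c` is a combination of tensor powers that no longer
depends on `J`, and tensor powers can be contracted with `T` by polarization. -/
theorem prod_multiplicity_le_peak {q s : ℕ} (hn : 0 < n) (hq : 0 < q) (hs : s ≤ q)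
    (J : Fin s → Fin n) :
    ∏ j, √(tupleType J (J j) : ℝ) ≤ (5 * √n) ^ s * ∑ c ∈ peakSet n q,
      ((q : ℝ) / (2 * n)) ^ (∑ i, (c i : ℕ)) * ∏ j, peakVec n q (extNat c) (J j) := by
  have hsum : ∑ i, tupleType J i = s := by simpa using sum_tupleType J
  have hle : ∀ i, tupleType J i ≤ s := fun i =>
    (single_le_sum (f := fun i => tupleType J i) (fun _ _ => Nat.zero_le _) (mem_univ i)).trans
      hsum.le
  let c : Fin n → Fin (q + 1) := fun i => ⟨tupleType J i / 2, by have := hle i; omega⟩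
  have hc : c ∈ peakSet n q := by
    simp only [peakSet, mem_filter, mem_univ, true_and, c]
    calc ∑ i, tupleType J i / 2 ≤ ∑ i, tupleType J i := sum_le_sum fun i _ => Nat.div_le_self _ _
      _ ≤ q := by omega
  have hpk : ∀ (c : Fin n → Fin (q + 1)) i, 0 ≤ peakVec n q (extNat c) i := fun c i => by
    unfold peakVec; positivity
  have hterm : ∏ j, √(tupleType J (J j) : ℝ) ≤ (5 * √n) ^ s *
      (((q : ℝ) / (2 * n)) ^ (∑ i, (c i : ℕ)) * ∏ j, peakVec n q (extNat c) (J j)) := by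
    rw [prod_comp_eq_prod_pow J (fun i => √(tupleType J i : ℝ)),
      prod_comp_eq_prod_pow J (peakVec n q (extNat c))]
    have e1 : (5 * √(n : ℝ)) ^ s = ∏ i, (5 * √(n : ℝ)) ^ tupleType J i := by
      rw [prod_pow_eq_pow_sum, hsum]
    rw [e1, ← prod_pow_eq_pow_sum, ← prod_mul_distrib, ← prod_mul_distrib]
    refine prod_le_prod (fun i _ => by positivity) fun i _ => ?_
    have := sqrt_pow_le_peak hn hq (tupleType J i)
    rw [← mul_assoc]
    simpa [peakVec, extNat_apply, c] using this
  refine hterm.trans (mul_le_mul_of_nonneg_left ?_ (by positivity))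
  exact single_le_sum (f := fun c : Fin n → Fin (q + 1) => ((q : ℝ) / (2 * n)) ^ (∑ i, (c i : ℕ)) *
    ∏ j, peakVec n q (extNat c) (J j)) (fun c _ => mul_nonneg (by positivity)
      (prod_nonneg fun j _ => hpk c _)) hc

/-! #### Row sums -/

theorem mform_sum_elim_single {s : ℕ} (T : (Fin s ⊕ Fin s → Fin n) → MvPolynomial (Fin n) ℝ)
    (I : Fin s → Fin n) (w : Fin s → ℝ) (y : Fin n → ℝ) :
    mform T (fun j i => C ((Sum.elim (fun j => Pi.single (I j) (w j)) (fun _ => y) :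
      Fin s ⊕ Fin s → Fin n → ℝ) j i)) =
      C (∏ j, w j) * ∑ J : Fin s → Fin n, C (∏ j, y (J j)) * T (Sum.elim I J) := by
  unfold mform
  rw [← (Equiv.sumArrowEquivProdArrow (Fin s) (Fin s) (Fin n)).symm.sum_comp,
    Fintype.sum_prod_type, sum_eq_single I]
  · rw [mul_sum]
    refine sum_congr rfl fun J _ => ?_
    simp [Equiv.sumArrowEquivProdArrow]
    ring
  · intro I' _ hI'
    obtain ⟨j, hj⟩ := Function.ne_iff.1 hI'
    refine sum_eq_zero fun J _ => ?_
    rw [prod_eq_zero (mem_univ (Sum.inl j)), mul_zero]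
    simp [Equiv.sumArrowEquivProdArrow, hj]
  · simp

variable {D ρ : ℕ} {f : MvPolynomial (Fin n) ℝ}

/-- Half of the arguments are the scaled `e_{I_j}`, the other half one and the same multiple of a
peaked vector. A subset sum is then a base point whose peak coefficient is the number of chosen
positions in the second half. -/
theorem sosBdd_rowSum (hf : f.IsHomogeneous (D + 2)) (hn : 0 < n) (hq : 0 < q)
    (hq' : q = 2 * ρ * (D + 2)) {N : ℝ} (hN : 0 ≤ N) (hG : CandidateBound f (D + 2) q N)
    (I : Fin (ρ * D) → Fin n) {c : Fin n → Fin (q + 1)} (hc : c ∈ peakSet n q) :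
    SosBdd (2 * ρ) ((∏ j, √(tupleType I (I j) : ℝ)) * ((9 * q * √q) ^ (ρ * D) *
      (2 ^ (2 * (ρ * D)) * (2 * ((2 * Real.exp 1) ^ (D + 2) * N)) ^ (2 * ρ) / (2 * (ρ * D))!)))
      (∑ J : Fin (ρ * D) → Fin n, C (∏ j, peakVec n q (extNat c) (J j)) *
        splitTensor ρ D f (Sum.elim I J)) := by
  have hρ : 1 ≤ ρ := by
    rcases Nat.eq_zero_or_pos ρ with h | h
    · subst h; simp at hq'; omega
    · exact h
  have hm : Fintype.card (Fin (ρ * D) ⊕ Fin (ρ * D)) = 2 * (ρ * D) := by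
    simp only [Fintype.card_fin, Fintype.card_sum]; ring
  have hq2 : q = 2 * (ρ * D) + 4 * ρ := by rw [hq']; ring
  have hDρ : D ≤ ρ * D := Nat.le_mul_of_pos_left D hρ
  have hq0 : (0 : ℝ) < q := by exact_mod_cast hq
  set w : Fin (ρ * D) → ℝ := fun j => 1 / (3 * √q * √(tupleType I (I j))) with hw
  set y : Fin n → ℝ := (1 / (3 * (q : ℝ))) • peakVec n q (extNat c) with hy
  have hcs : ∑ i : Fin n, extNat c i ≤ q := by
    simp only [extNat_apply]
    simpa [peakSet] using hc
  have hb := sosBdd_mform_powTensor (f := f) (r := 2 * ρ)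
    (Fintype.equivOfCardEq (card_powTensor_index ρ D))
    (Sum.elim (fun j => Pi.single (I j) (w j)) (fun _ => y))
    (Θ := 2 * ((2 * Real.exp 1) ^ (D + 2) * N)) (by
      intro S x
      have hS : ∑ j ∈ S, (Sum.elim (fun j => Pi.single (I j) (w j)) (fun _ => y) :
          Fin (ρ * D) ⊕ Fin (ρ * D) → Fin n → ℝ) j =
          ∑ j ∈ S.toLeft, scaledVec q I j +
            ((#S.toRight : ℝ) / (3 * q)) • peakVec n q (extNat c) := by
        conv_lhs => rw [← toLeft_disjSum_toRight (u := S)]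
        rw [sum_disjSum]
        simp only [Sum.elim_inl, Sum.elim_inr, sum_const, hy]
        congr 1
        rw [← Nat.cast_smul_eq_nsmul ℝ, smul_smul]
        congr 1
        ring
      have hcr : #S.toRight ≤ ρ * D := by simpa using card_le_univ S.toRight
      rw [hS]
      exact hess_bound_basePoint hf hn hq hN hG I S.toLeft (by
        rw [Fintype.card_fin]; omega) (by rw [Fintype.card_fin]; omega) (by omega) hcs
        (fun i hi => by simp [extNat, Nat.not_lt.2 hi]) x)
  rw [mform_sum_elim_single, hm] at hb
  have hwpos : ∀ j, 0 < w j := by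
    intro j
    have : 0 < tupleType I (I j) := by
      rw [tupleType_apply, card_pos]; exact ⟨j, by simp⟩
    have : (0 : ℝ) < tupleType I (I j) := by exact_mod_cast this
    positivity
  have hprod : 0 < ∏ j, w j := prod_pos fun j _ => hwpos j
  have hb2 := hb.of_C_mul hprod
  have e1 : ∑ J : Fin (ρ * D) → Fin n, C (∏ j, y (J j)) *
      powTensor (Fintype.equivOfCardEq (card_powTensor_index ρ D))
        (polyTensor (Fin D ⊕ Fin 2) f) (Sum.elim I J) =
      C ((1 / (3 * (q : ℝ))) ^ (ρ * D)) * ∑ J : Fin (ρ * D) → Fin n,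
        C (∏ j, peakVec n q (extNat c) (J j)) * splitTensor ρ D f (Sum.elim I J) := by
    rw [mul_sum]
    refine sum_congr rfl fun J _ => ?_
    rw [← mul_assoc, ← MvPolynomial.C_mul]
    congr 2
    simp [hy, prod_mul_distrib]
  rw [e1] at hb2
  refine (hb2.of_C_mul (by positivity)).mono (le_of_eq ?_)
  have hinv : (∏ j, w j)⁻¹ = (3 * √q) ^ (ρ * D) * ∏ j, √(tupleType I (I j) : ℝ) := by
    rw [← prod_inv_distrib]
    simp only [hw, one_div, inv_inv, prod_mul_distrib, prod_const, card_univ, Fintype.card_fin]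
    rw [← mul_pow]
  rw [hinv, one_div, inv_pow, inv_inv]
  have e2 : (9 * (q : ℝ) * √q) ^ (ρ * D) = (3 * q) ^ (ρ * D) * (3 * √q) ^ (ρ * D) := by
    rw [← mul_pow]; congr 1; ring
  rw [e2]
  ring

/-- The weights `g_J` in a row sum may be replaced by their peaked majorants because every `E[x^{2I}
T_{IJ}]` is non-negative. The bound for each peaked row is proportional to `g_I`, which cancels the
division by `g_I`; the sphere constraint then sums the rows. -/
theorem ExtPseudo.map_pow_le {E : MvPolynomial (Fin n) ℝ →ₗ[ℝ] ℝ}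
    (hE : ExtPseudo q (2 * (2 * ρ)) E) (hf : f.IsHomogeneous (D + 2))
    (hfn : ∀ μ, 0 ≤ f.coeff μ) (hq : 0 < q) (hqn : q ≤ n)
    (hq' : q = 2 * ρ * (D + 2)) {N : ℝ} (hN : 0 ≤ N) (hG : CandidateBound f (D + 2) q N) :
    E (f ^ (2 * ρ)) ≤ (5 * √n) ^ (ρ * D) * Real.exp 1 ^ q * ((9 * q * √q) ^ (ρ * D) *
      (2 ^ (2 * (ρ * D)) * (2 * ((2 * Real.exp 1) ^ (D + 2) * N)) ^ (2 * ρ) /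
        (2 * (ρ * D))!)) := by
  have hn : 0 < n := by omega
  have hq2 : q = 2 * (ρ * D) + 4 * ρ := by rw [hq']; ring
  set s := ρ * D with hs
  set b : ℝ := (9 * q * √q) ^ s *
      (2 ^ (2 * s) * (2 * ((2 * Real.exp 1) ^ (D + 2) * N)) ^ (2 * ρ) / (2 * s)!) with hb
  have hb0 : 0 ≤ b := by positivity
  set g : (Fin s → Fin n) → ℝ := fun I => ∏ j, √(tupleType I (I j) : ℝ) with hg
  have hg0 : ∀ I, 0 < g I := by
    intro I
    refine prod_pos fun j _ => Real.sqrt_pos.2 ?_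
    have : 0 < tupleType I (I j) := by
      rw [tupleType_apply, card_pos]; exact ⟨j, by simp⟩
    exact_mod_cast this
  set p : (Fin n → Fin (q + 1)) → ℝ := fun c => ((q : ℝ) / (2 * n)) ^ (∑ i, (c i : ℕ)) with hp
  have hp0 : ∀ c, 0 ≤ p c := fun c => by positivity
  set Y : (Fin n → Fin (q + 1)) → (Fin s → Fin n) → ℝ := fun c J =>
    ∏ j, peakVec n q (extNat c) (J j) with hY
  set T := splitTensor ρ D f with hT
  have hTn : ∀ K, NonnegForm (2 * (2 * ρ)) (T K) := nonnegForm_splitTensor hfn ρ D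
  have hmain := hE.map_mform_le (s := s) (T := T) (by omega) (isSymmTensor_powTensor _ _) hTn hg0
  have hX : mform T (fun _ => X) = f ^ (2 * ρ) := mform_powTensor_X hf _
  rw [hX] at hmain
  refine hmain.trans ?_
  have hrow : ∀ I : Fin s → Fin n,
      ∑ J, g J / g I * E (tupleMonomial I ^ 2 * T (Sum.elim I J)) ≤
        (5 * √n) ^ s * Real.exp 1 ^ q * b * E (tupleMonomial I ^ 2 * normSqPoly n ^ (2 * ρ)) := by
    intro I
    have hE0 : ∀ J, 0 ≤ E (tupleMonomial I ^ 2 * T (Sum.elim I J)) := fun J =>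
      hE.nonneg_sq_mul (s := s) (by omega) (isHomogeneous_tupleMonomial I) (hTn _)
    have hEN : 0 ≤ E (tupleMonomial I ^ 2 * normSqPoly n ^ (2 * ρ)) :=
      hE.nonneg_of_mem_sosCone (k := s + 2 * ρ) (by omega)
        (mul_mem_sosCone (sq_mem_sosCone (isHomogeneous_tupleMonomial I)) (normSqPoly_pow_mem _))
    have hpeak : ∀ c ∈ peakSet n q, ∑ J, Y c J * E (tupleMonomial I ^ 2 * T (Sum.elim I J)) ≤
        g I * b * E (tupleMonomial I ^ 2 * normSqPoly n ^ (2 * ρ)) := by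
      intro c hc
      have hbd := sosBdd_rowSum hf hn hq hq' hN hG I hc
      have h := hE.nonneg_of_mem_sosCone (k := s + 2 * ρ) (by omega)
        (mul_mem_sosCone (sq_mem_sosCone (isHomogeneous_tupleMonomial I)) hbd.2)
      have e1 : tupleMonomial I ^ 2 * (C (g I * b) * normSqPoly n ^ (2 * ρ) -
          ∑ J : Fin s → Fin n, C (Y c J) * T (Sum.elim I J)) =
          (g I * b) • (tupleMonomial I ^ 2 * normSqPoly n ^ (2 * ρ)) -
          ∑ J : Fin s → Fin n, Y c J • (tupleMonomial I ^ 2 * T (Sum.elim I J)) := by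
        simp only [MvPolynomial.smul_eq_C_mul, mul_sub, mul_sum]
        congr 1
        · ring
        · exact sum_congr rfl fun J _ => by ring
      have h' : 0 ≤ E (tupleMonomial I ^ 2 * (C (g I * b) * normSqPoly n ^ (2 * ρ) -
          ∑ J : Fin s → Fin n, C (Y c J) * T (Sum.elim I J))) := h
      rw [e1, map_sub, map_smul, map_sum, smul_eq_mul] at h'
      simp_rw [map_smul, smul_eq_mul] at h'
      linarith
    have hgI := hg0 I
    calc ∑ J, g J / g I * E (tupleMonomial I ^ 2 * T (Sum.elim I J))
        ≤ ∑ J, ((5 * √n) ^ s * ∑ c ∈ peakSet n q, p c * Y c J) / g I *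
          E (tupleMonomial I ^ 2 * T (Sum.elim I J)) := by
          refine sum_le_sum fun J _ => mul_le_mul_of_nonneg_right ?_ (hE0 J)
          exact div_le_div_of_nonneg_right
            (prod_multiplicity_le_peak hn hq (by omega) J) hgI.le
      _ = (5 * √n) ^ s / g I * ∑ c ∈ peakSet n q, p c *
          ∑ J, Y c J * E (tupleMonomial I ^ 2 * T (Sum.elim I J)) := by
          simp_rw [mul_sum, sum_div, sum_mul]
          rw [sum_comm]
          exact sum_congr rfl fun c _ => sum_congr rfl fun J _ => by ring
      _ ≤ (5 * √n) ^ s / g I * ∑ c ∈ peakSet n q, p c *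
          (g I * b * E (tupleMonomial I ^ 2 * normSqPoly n ^ (2 * ρ))) := by
          refine mul_le_mul_of_nonneg_left (sum_le_sum fun c hc => ?_) (by positivity)
          exact mul_le_mul_of_nonneg_left (hpeak c hc) (hp0 c)
      _ = (5 * √n) ^ s * (∑ c ∈ peakSet n q, p c) * b *
          E (tupleMonomial I ^ 2 * normSqPoly n ^ (2 * ρ)) := by
          rw [← sum_mul]; field_simp
      _ ≤ _ := by
          have := sum_peakSet_le hn hqn
          gcongr
  refine (sum_le_sum fun I _ => hrow I).trans (le_of_eq ?_)
  rw [← mul_sum, ← map_sum, ← sum_mul, sum_tupleMonomial_sq, ← pow_add,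
    hE.map_normSqPoly_pow (by omega), mul_one]

/-- Apart from constants the bound is `n^{s/2} q^{3s/2} / (2s)!`, which `q^{2s}/(2s)! ≤ e^q` turns
into `(n/q)^{s/2}`. -/
theorem constrainedSosValue_le_nonneg (hf : f.IsHomogeneous (D + 2))
    (hfn : ∀ μ, 0 ≤ f.coeff μ) (hq : 0 < q) (hqn : q ≤ n)
    (hq' : q = 2 * ρ * (D + 2)) {N : ℝ} (hN : 0 ≤ N) (hG : CandidateBound f (D + 2) q N) :
    constrainedSosValue q (2 * (2 * ρ)) (f ^ (2 * ρ)) ≤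
      (2000000 : ℝ) ^ q * √((n : ℝ) / q) ^ (ρ * D) * N ^ (2 * ρ) := by
  have hq0 : (0 : ℝ) < q := by exact_mod_cast hq
  have hn0 : (0 : ℝ) < n := by exact_mod_cast (by omega : 0 < n)
  have hq2 : q = 2 * (ρ * D) + 4 * ρ := by rw [hq']; ring
  -- Non-negativity of the bound covers the case that no pseudoexpectation respects the constraints,
  -- where the supremum is `0`.
  refine Real.sSup_le ?_ (by positivity)
  rintro v ⟨E, hE, hC, hh, rfl⟩
  obtain ⟨E', hE', hext⟩ := exists_extPseudo hE hC
  rw [← hext]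
  refine (hE'.map_pow_le hf hfn hq hqn hq' hN hG).trans ?_
  set s := ρ * D with hs
  have hfac : (q : ℝ) ^ (2 * s) / (2 * s)! ≤ Real.exp 1 ^ q := by
    have := Real.pow_div_factorial_le_exp (q : ℝ) hq0.le (2 * s)
    rwa [← Real.exp_nat_mul, mul_one]
  have he : Real.exp 1 ≤ 3 := by have := Real.exp_one_lt_d9; linarith
  calc
    _ = 180 ^ s * (2 ^ (2 * ρ) * (2 * Real.exp 1) ^ q) * Real.exp 1 ^ q *
        ((q : ℝ) ^ (2 * s) / (2 * s)!) * √((n : ℝ) / q) ^ s * N ^ (2 * ρ) := by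
      have e1 : (2 * Real.exp 1) ^ q = ((2 * Real.exp 1) ^ (D + 2)) ^ (2 * ρ) := by
        rw [← pow_mul, hq']; congr 1; ring
      have e2 : (180 : ℝ) ^ s * ((q : ℝ) ^ (2 * s)) * √((n : ℝ) / q) ^ s =
          (5 * √n) ^ s * (9 * q * √q) ^ s * 2 ^ (2 * s) := by
        rw [pow_mul (q : ℝ) 2 s, pow_mul (2 : ℝ) 2 s, ← mul_pow, ← mul_pow, ← mul_pow, ← mul_pow]
        congr 1
        rw [Real.sqrt_div hn0.le]
        have h1 : √(q : ℝ) * √(q : ℝ) = q := Real.mul_self_sqrt hq0.le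
        have h2 : √(q : ℝ) ≠ 0 := (Real.sqrt_pos.2 hq0).ne'
        field_simp
        nlinarith
      rw [e1, mul_pow 2 ((2 * Real.exp 1) ^ (D + 2) * N), mul_pow ((2 * Real.exp 1) ^ (D + 2))]
      linear_combination (-(2 ^ (2 * ρ) * ((2 * Real.exp 1) ^ (D + 2)) ^ (2 * ρ) * N ^ (2 * ρ) *
        Real.exp 1 ^ q / (2 * s)!)) * e2
    _ ≤ 180 ^ q * (2 ^ q * (2 * 3) ^ q) * 3 ^ q * 3 ^ q * √((n : ℝ) / q) ^ s * N ^ (2 * ρ) := by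
      have a1 : (180 : ℝ) ^ s ≤ 180 ^ q := pow_le_pow_right₀ (by norm_num) (by omega)
      have a2 : (2 : ℝ) ^ (2 * ρ) ≤ 2 ^ q := pow_le_pow_right₀ (by norm_num) (by omega)
      have a3 : (q : ℝ) ^ (2 * s) / (2 * s)! ≤ 3 ^ q := hfac.trans (by gcongr)
      gcongr
    _ ≤ _ := by
      rw [← mul_pow, ← mul_pow, ← mul_pow, ← mul_pow]
      gcongr
      norm_num

end Nonneg

end SphereOpt

namespace RealRAM

/-! ### Reasoning about programs -/

namespace State

/-- Assignment to a variable of natural type. -/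
def setN (s : State) (i v : ℕ) : State := { s with nat := Function.update s.nat i v }

/-- Assignment to a variable of real type. -/
def setR (s : State) (i : ℕ) (v : ℝ) : State := { s with real := Function.update s.real i v }

/-- Assignment to a cell of an array of natural numbers. -/
def putN (s : State) (a j v : ℕ) : State :=
  { s with natArr := Function.update s.natArr a (Function.update (s.natArr a) j v) }

/-- Assignment to a cell of an array of real numbers. -/
def putR (s : State) (a j : ℕ) (v : ℝ) : State :=
  { s with realArr := Function.update s.realArr a (Function.update (s.realArr a) j v) }

variable (s : State) (i j a a' b : ℕ) (v : ℕ) (x : ℝ)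

@[simp] theorem setN_nat : (s.setN i v).nat j = if j = i then v else s.nat j := by
  simp [setN, Function.update_apply]
@[simp] theorem setN_real : (s.setN i v).real = s.real := rfl
@[simp] theorem setN_natArr : (s.setN i v).natArr = s.natArr := rfl
@[simp] theorem setN_realArr : (s.setN i v).realArr = s.realArr := rfl

@[simp] theorem setR_real : (s.setR i x).real j = if j = i then x else s.real j := by
  simp [setR, Function.update_apply]
@[simp] theorem setR_nat : (s.setR i x).nat = s.nat := rfl
@[simp] theorem setR_natArr : (s.setR i x).natArr = s.natArr := rfl
@[simp] theorem setR_realArr : (s.setR i x).realArr = s.realArr := rfl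

@[simp] theorem putN_natArr : (s.putN a i v).natArr a' j =
    if a' = a ∧ j = i then v else s.natArr a' j := by
  by_cases h : a' = a
  · subst h; simp [putN, Function.update_apply]
  · simp [putN, h]
@[simp] theorem putN_nat : (s.putN a i v).nat = s.nat := rfl
@[simp] theorem putN_real : (s.putN a i v).real = s.real := rfl
@[simp] theorem putN_realArr : (s.putN a i v).realArr = s.realArr := rfl

@[simp] theorem putR_realArr : (s.putR a i x).realArr a' j =
    if a' = a ∧ j = i then x else s.realArr a' j := by
  by_cases h : a' = a
  · subst h; simp [putR, Function.update_apply]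
  · simp [putR, h]
@[simp] theorem putR_nat : (s.putR a i x).nat = s.nat := rfl
@[simp] theorem putR_real : (s.putR a i x).real = s.real := rfl
@[simp] theorem putR_natArr : (s.putR a i x).natArr = s.natArr := rfl

end State

namespace Prog

/-- The variables of natural type that a program may change. -/
def natVars : Prog → List ℕ
  | setNat i _ => [i]
  | seq P Q => P.natVars ++ Q.natVars
  | ifNat _ _ P Q => P.natVars ++ Q.natVars
  | ifReal _ _ P Q => P.natVars ++ Q.natVars
  | whileLt _ _ P => P.natVars
  | _ => []

/-- The variables of real type that a program may change. -/
def realVars : Prog → List ℕ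
  | setReal i _ => [i]
  | seq P Q => P.realVars ++ Q.realVars
  | ifNat _ _ P Q => P.realVars ++ Q.realVars
  | ifReal _ _ P Q => P.realVars ++ Q.realVars
  | whileLt _ _ P => P.realVars
  | _ => []

/-- The arrays of natural numbers that a program may change. -/
def natArrs : Prog → List ℕ
  | putNat a _ _ => [a]
  | seq P Q => P.natArrs ++ Q.natArrs
  | ifNat _ _ P Q => P.natArrs ++ Q.natArrs
  | ifReal _ _ P Q => P.natArrs ++ Q.natArrs
  | whileLt _ _ P => P.natArrs
  | _ => []

/-- The arrays of real numbers that a program may change. -/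
def realArrs : Prog → List ℕ
  | putReal a _ _ => [a]
  | seq P Q => P.realArrs ++ Q.realArrs
  | ifNat _ _ P Q => P.realArrs ++ Q.realArrs
  | ifReal _ _ P Q => P.realArrs ++ Q.realArrs
  | whileLt _ _ P => P.realArrs
  | _ => []

/-- Nesting depth of the loops of a program. -/
def depth : Prog → ℕ
  | seq P Q => max P.depth Q.depth
  | ifNat _ _ P Q => max P.depth Q.depth
  | ifReal _ _ P Q => max P.depth Q.depth
  | whileLt _ _ P => P.depth + 1
  | _ => 0

/-- A weighted size: if every loop makes at most `W` iterations, then a program `P` takes at most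
`P.weight * W ^ P.depth` steps. -/
def weight : Prog → ℕ
  | skip => 1
  | setNat _ e => e.cost + 1
  | setReal _ r => r.cost + 1
  | putNat _ e v => e.cost + v.cost + 1
  | putReal _ e v => e.cost + v.cost + 1
  | seq P Q => P.weight + Q.weight
  | ifNat e₁ e₂ P Q => e₁.cost + e₂.cost + 1 + P.weight + Q.weight
  | ifReal r₁ r₂ P Q => r₁.cost + r₂.cost + 1 + P.weight + Q.weight
  | whileLt e₁ e₂ P => P.weight + 2 * (e₁.cost + e₂.cost + 1)

/-- `for i < e do P`. -/
def forLt (i : ℕ) (e : NExp) (P : Prog) : Prog :=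
  .seq (.setNat i (.lit 0)) (.whileLt (.var i) e (.seq P (.setNat i (.add (.var i) (.lit 1)))))

end Prog

/-- The states `s` and `s'` differ only in places that `P` may change. -/
structure Frame (P : Prog) (s s' : State) : Prop where
  nat : ∀ i, i ∉ P.natVars → s'.nat i = s.nat i
  real : ∀ i, i ∉ P.realVars → s'.real i = s.real i
  natArr : ∀ i, i ∉ P.natArrs → s'.natArr i = s.natArr i
  realArr : ∀ i, i ∉ P.realArrs → s'.realArr i = s.realArr i

theorem Frame.rfl' (P : Prog) (s : State) : Frame P s s :=
  ⟨fun _ _ => rfl, fun _ _ => rfl, fun _ _ => rfl, fun _ _ => rfl⟩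

theorem Frame.trans {P : Prog} {s s' s'' : State} (h : Frame P s s') (h' : Frame P s' s'') :
    Frame P s s'' :=
  ⟨fun i hi => (h'.nat i hi).trans (h.nat i hi), fun i hi => (h'.real i hi).trans (h.real i hi),
    fun i hi => (h'.natArr i hi).trans (h.natArr i hi),
    fun i hi => (h'.realArr i hi).trans (h.realArr i hi)⟩

theorem Frame.mono {P Q : Prog} {s s' : State} (h : Frame P s s')
    (h₁ : P.natVars ⊆ Q.natVars) (h₂ : P.realVars ⊆ Q.realVars)
    (h₃ : P.natArrs ⊆ Q.natArrs) (h₄ : P.realArrs ⊆ Q.realArrs) : Frame Q s s' :=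
  ⟨fun i hi => h.nat i fun hh => hi (h₁ hh), fun i hi => h.real i fun hh => hi (h₂ hh),
    fun i hi => h.natArr i fun hh => hi (h₃ hh), fun i hi => h.realArr i fun hh => hi (h₄ hh)⟩

theorem Frame.left {P Q : Prog} {s s' : State} (h : Frame P s s') : Frame (.seq P Q) s s' := by
  apply h.mono <;> simp [Prog.natVars, Prog.realVars, Prog.natArrs, Prog.realArrs]

theorem Frame.right {P Q : Prog} {s s' : State} (h : Frame Q s s') : Frame (.seq P Q) s s' := by
  apply h.mono <;> simp [Prog.natVars, Prog.realVars, Prog.natArrs, Prog.realArrs]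

theorem Exec.frame {P : Prog} {s s' : State} {t : ℕ} (h : Exec P s t s') : Frame P s s' := by
  induction h with
  | skip => exact Frame.rfl' _ _
  | setNat i e s =>
    refine ⟨fun j hj => ?_, fun _ _ => rfl, fun _ _ => rfl, fun _ _ => rfl⟩
    exact Function.update_of_ne (by simpa [Prog.natVars] using hj) _ _
  | setReal i e s =>
    refine ⟨fun _ _ => rfl, fun j hj => ?_, fun _ _ => rfl, fun _ _ => rfl⟩
    exact Function.update_of_ne (by simpa [Prog.realVars] using hj) _ _
  | putNat a e v s =>
    refine ⟨fun _ _ => rfl, fun _ _ => rfl, fun j hj => ?_, fun _ _ => rfl⟩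
    exact Function.update_of_ne (by simpa [Prog.natArrs] using hj) _ _
  | putReal a e v s =>
    refine ⟨fun _ _ => rfl, fun _ _ => rfl, fun _ _ => rfl, fun j hj => ?_⟩
    exact Function.update_of_ne (by simpa [Prog.realArrs] using hj) _ _
  | seq _ _ ih ih' => exact ih.left.trans ih'.right
  | ifNatTrue _ _ ih | ifNatFalse _ _ ih | ifRealTrue _ _ ih | ifRealFalse _ _ ih =>
    apply ih.mono <;> simp [Prog.natVars, Prog.realVars, Prog.natArrs, Prog.realArrs]
  | whileDone _ => exact Frame.rfl' _ _
  | whileStep _ _ _ ih ih' =>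
    refine Frame.trans ?_ ih'
    apply ih.mono <;> simp [Prog.natVars, Prog.realVars, Prog.natArrs, Prog.realArrs]

/-- Started in `s`, the program `P` halts in a state satisfying `Q`, within the time that is
available when every loop makes at most `W` iterations. -/
def Runs (W : ℕ) (P : Prog) (s : State) (Q : State → Prop) : Prop :=
  ∃ t s', Exec P s t s' ∧ t ≤ P.weight * W ^ P.depth ∧ Q s'

namespace Runs

variable {W : ℕ} {P P' : Prog} {s : State} {Q Q' : State → Prop}

theorem mono (h : Runs W P s Q) (hQ : ∀ s', Frame P s s' → Q s' → Q' s') : Runs W P s Q' := by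
  obtain ⟨t, s', h1, h2, h3⟩ := h
  exact ⟨t, s', h1, h2, hQ s' h1.frame h3⟩

theorem skip (h : Q s) : Runs W .skip s Q := ⟨1, s, .skip s, by simp [Prog.weight, Prog.depth], h⟩

theorem setNat {i : ℕ} {e : NExp} (h : Q (s.setN i (e.eval s))) : Runs W (.setNat i e) s Q :=
  ⟨_, _, .setNat i e s, by simp [Prog.weight, Prog.depth], h⟩

theorem setReal {i : ℕ} {e : RExp} (h : Q (s.setR i (e.eval s))) : Runs W (.setReal i e) s Q :=
  ⟨_, _, .setReal i e s, by simp [Prog.weight, Prog.depth], h⟩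

theorem putNat {a : ℕ} {e v : NExp} (h : Q (s.putN a (e.eval s) (v.eval s))) :
    Runs W (.putNat a e v) s Q :=
  ⟨_, _, .putNat a e v s, by simp [Prog.weight, Prog.depth], h⟩

theorem putReal {a : ℕ} {e : NExp} {v : RExp} (h : Q (s.putR a (e.eval s) (v.eval s))) :
    Runs W (.putReal a e v) s Q :=
  ⟨_, _, .putReal a e v s, by simp [Prog.weight, Prog.depth], h⟩

theorem seq (hW : 0 < W) (h : Runs W P s fun s' => Frame P s s' → Runs W P' s' Q) :
    Runs W (.seq P P') s Q := by
  obtain ⟨t, s', h1, h2, h3⟩ := h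
  obtain ⟨t', s'', h1', h2', h3'⟩ := h3 h1.frame
  refine ⟨_, s'', .seq h1 h1', ?_, h3'⟩
  rw [Prog.weight, Prog.depth, add_mul]
  exact add_le_add (h2.trans (Nat.mul_le_mul_left _ (Nat.pow_le_pow_right hW (le_max_left _ _))))
    (h2'.trans (Nat.mul_le_mul_left _ (Nat.pow_le_pow_right hW (le_max_right _ _))))

theorem branch_time_le (hW : 0 < W) {c w w' t k k' : ℕ} (h : t ≤ w * W ^ k) :
    c + t ≤ (c + w + w') * W ^ max k k' := by
  have h1 : t ≤ w * W ^ max k k' :=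
    h.trans (Nat.mul_le_mul_left _ (Nat.pow_le_pow_right hW (le_max_left _ _)))
  have h2 : 1 ≤ W ^ max k k' := Nat.one_le_pow _ _ hW
  have h3 : c ≤ c * W ^ max k k' := Nat.le_mul_of_pos_right c h2
  rw [add_mul, add_mul]
  omega

theorem ifNat (hW : 0 < W) {e₁ e₂ : NExp} (h : e₁.eval s ≤ e₂.eval s → Runs W P s Q)
    (h' : ¬ e₁.eval s ≤ e₂.eval s → Runs W P' s Q) : Runs W (.ifNat e₁ e₂ P P') s Q := by
  by_cases hc : e₁.eval s ≤ e₂.eval s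
  · obtain ⟨t, s', h1, h2, h3⟩ := h hc
    exact ⟨_, s', .ifNatTrue hc h1, branch_time_le hW h2, h3⟩
  · obtain ⟨t, s', h1, h2, h3⟩ := h' hc
    refine ⟨_, s', .ifNatFalse hc h1, ?_, h3⟩
    rw [Prog.weight, Prog.depth, max_comm, add_right_comm _ P.weight P'.weight]
    exact branch_time_le hW h2

theorem ifReal (hW : 0 < W) {e₁ e₂ : RExp} (h : e₁.eval s ≤ e₂.eval s → Runs W P s Q)
    (h' : ¬ e₁.eval s ≤ e₂.eval s → Runs W P' s Q) : Runs W (.ifReal e₁ e₂ P P') s Q := by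
  by_cases hc : e₁.eval s ≤ e₂.eval s
  · obtain ⟨t, s', h1, h2, h3⟩ := h hc
    exact ⟨_, s', .ifRealTrue hc h1, branch_time_le hW h2, h3⟩
  · obtain ⟨t, s', h1, h2, h3⟩ := h' hc
    refine ⟨_, s', .ifRealFalse hc h1, ?_, h3⟩
    rw [Prog.weight, Prog.depth, max_comm, add_right_comm _ P.weight P'.weight]
    exact branch_time_le hW h2

/-- The rule for bounded loops: `I k` has to hold before round `k`. -/
theorem forLt (hW : 0 < W) {i N : ℕ} {e : NExp} (I : ℕ → State → Prop) (hNW : N ≤ W)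
    (hi : i ∉ P.natVars)
    (he : ∀ s', Frame (.forLt i e P) s s' → e.eval s' = N)
    (h0 : I 0 (s.setN i 0))
    (hstep : ∀ k < N, ∀ s', Frame (.forLt i e P) s s' → s'.nat i = k → I k s' →
      Runs W P s' fun s'' => Frame P s' s'' → I (k + 1) (s''.setN i (k + 1)))
    (hQ : ∀ s', Frame (.forLt i e P) s s' → I N s' → Q s') :
    Runs W (.forLt i e P) s Q := by
  set B : Prog := .seq P (.setNat i (.add (.var i) (.lit 1))) with hB
  set c := (NExp.var i).cost + e.cost + 1 with hc
  set T := B.weight * W ^ B.depth with hT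
  have hloop : ∀ j k, k + j = N → ∀ s', Frame (.forLt i e P) s s' → s'.nat i = k → I k s' →
      ∃ t s'', Exec (.whileLt (.var i) e B) s' t s'' ∧ t ≤ j * (c + T) + c ∧
        Frame (.forLt i e P) s s'' ∧ I N s'' := by
    intro j
    induction j with
    | zero =>
      intro k hk s' hf hs hI
      refine ⟨_, s', .whileDone ?_, by omega, hf, by simpa [← hk] using hI⟩
      rw [he s' hf]; simp [NExp.eval, hs]; omega
    | succ j ih =>
      intro k hk s' hf hs hI
      obtain ⟨t, s₁, h1, h2, h3⟩ := hstep k (by omega) s' hf hs hI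
      have hs₁ : s₁.nat i = k := (h1.frame.nat i hi).trans hs
      -- Incrementing the counter costs `4`: three nodes of the expression and the assignment.
      have hB' : Exec B s' (t + 4) (s₁.setN i (k + 1)) := by
        have := Exec.seq h1 (.setNat i (.add (.var i) (.lit 1)) s₁)
        simpa [NExp.eval, hs₁, NExp.cost, State.setN] using this
      have hf' : Frame (.forLt i e P) s (s₁.setN i (k + 1)) := by
        refine hf.trans (Frame.mono hB'.frame ?_ ?_ ?_ ?_) <;>
          simp [Prog.forLt, Prog.natVars, Prog.realVars, Prog.natArrs, Prog.realArrs, hB]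
      obtain ⟨t', s₂, h1', h2', h3'⟩ := ih (k + 1) (by omega) _ hf' (by simp) (h3 h1.frame)
      have hlt : (NExp.var i).eval s' < e.eval s' := by
        rw [he s' hf]; simp [NExp.eval, hs]; omega
      refine ⟨_, s₂, .whileStep hlt hB' h1', ?_, h3'⟩
      have htT : t + 4 ≤ T := by
        have h5 : 1 ≤ W ^ P.depth := Nat.one_le_pow _ _ hW
        simp only [hT, hB, Prog.weight, Prog.depth, NExp.cost, Nat.max_zero]
        rw [add_mul]
        omega
      rw [add_mul]
      omega
  have hf0 : Frame (.forLt i e P) s (s.setN i 0) := by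
    refine ⟨fun j hj => ?_, fun _ _ => rfl, fun _ _ => rfl, fun _ _ => rfl⟩
    have : j ≠ i := fun h => hj (by simp [Prog.forLt, Prog.natVars, h])
    simp [this]
  obtain ⟨t, s', h1, h2, h3, h4⟩ := hloop N 0 (by omega) _ hf0 (by simp) h0
  have h1' : Exec (.setNat i (.lit 0)) s 2 (s.setN i 0) := .setNat i (.lit 0) s
  refine ⟨_, s', .seq h1' h1, ?_, hQ s' h3 h4⟩
  have e1 : (Prog.forLt i e P).weight = 2 + (B.weight + 2 * c) := by
    simp [Prog.forLt, Prog.weight, hB, hc, NExp.cost]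
  have e2 : (Prog.forLt i e P).depth = B.depth + 1 := by simp [Prog.forLt, Prog.depth, hB]
  rw [e1, e2, pow_succ]
  have h5 : 1 ≤ W ^ B.depth := Nat.one_le_pow _ _ hW
  have h6 : N * (c + T) ≤ W * (c + T) := Nat.mul_le_mul_right _ hNW
  have h7 : 2 + W * (c + T) + c ≤ (2 + (B.weight + 2 * c)) * (W ^ B.depth * W) := by
    rw [hT]
    have h8 : 1 ≤ W ^ B.depth * W := Nat.mul_pos h5 hW
    have h9 : W ≤ W ^ B.depth * W := Nat.le_mul_of_pos_left W h5
    nlinarith [Nat.mul_le_mul_left c h8, Nat.mul_le_mul_left c h9]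
  omega

end Runs

open MvPolynomial Finset
open SphereOpt (nrm polStep candU candT CandidateBound)

local infixr:40 " ;; " => Prog.seq

/-! ### The program -/

/-- The program leaves the input untouched. -/
def Prog.KeepsInput (P : Prog) : Prop :=
  0 ∉ P.natVars ∧ 1 ∉ P.natVars ∧ 2 ∉ P.natVars ∧ 3 ∉ P.natVars ∧ 0 ∉ P.natArrs ∧ 0 ∉ P.realArrs

instance (P : Prog) : Decidable P.KeepsInput := by unfold Prog.KeepsInput; infer_instance

section Spec

variable {W n d q : ℕ} {f : MvPolynomial (Fin n) ℝ} {s s' : State}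

theorem HoldsInput.of_eq (h : HoldsInput s n d q f) (h0 : s'.nat 0 = s.nat 0)
    (h1 : s'.nat 1 = s.nat 1) (h2 : s'.nat 2 = s.nat 2) (h3 : s'.nat 3 = s.nat 3)
    (h4 : s'.natArr 0 = s.natArr 0) (h5 : s'.realArr 0 = s.realArr 0) :
    HoldsInput s' n d q f := by
  unfold HoldsInput at h ⊢
  rwa [h0, h1, h2, h3, h4, h5]

theorem HoldsInput.frame {P : Prog} (h : HoldsInput s n d q f) (hf : Frame P s s')
    (hP : P.KeepsInput) : HoldsInput s' n d q f :=
  h.of_eq (hf.nat _ hP.1) (hf.nat _ hP.2.1) (hf.nat _ hP.2.2.1) (hf.nat _ hP.2.2.2.1)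
    (hf.natArr _ hP.2.2.2.2.1) (hf.realArr _ hP.2.2.2.2.2)

theorem HoldsInput.setR (h : HoldsInput s n d q f) {i : ℕ} (v : ℝ) :
    HoldsInput (s.setR i v) n d q f := h

theorem HoldsInput.putR (h : HoldsInput s n d q f) {a : ℕ} (i : ℕ) (v : ℝ) (ha : a ≠ 0) :
    HoldsInput (s.putR a i v) n d q f :=
  h.of_eq rfl rfl rfl rfl rfl (by ext j; simp [ha.symm])

/-- `u := array 3`; variable `0` receives `f u`. -/
def evalP : Prog :=
  .setReal 0 (.ofNat (.lit 0)) ;; .setNat 21 (.lit 0) ;;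
  .forLt 18 (.var 3)
    (.setReal 1 (.get 0 (.var 18)) ;;
    .forLt 19 (.var 0)
      (.forLt 20 (.get 0 (.var 21)) (.setReal 1 (.mul (.var 1) (.get 3 (.var 19)))) ;;
      .setNat 21 (.add (.var 21) (.lit 1))) ;;
    .setReal 0 (.add (.var 0) (.var 1)))

theorem eval_eq_sum_range (hs : HoldsInput s n d q f) (U : ℕ → ℝ) :
    eval (fun i : Fin n => U i) f = ∑ j ∈ range #f.support,
      s.realArr 0 j * ∏ i ∈ range n, U i ^ s.natArr 0 (j * n + i) := by
  obtain ⟨-, -, -, -, μ, hμ⟩ := hs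
  rw [eval_eq', ← sum_coe_sort, ← μ.sum_comp, sum_range]
  refine sum_congr rfl fun j _ => ?_
  rw [(hμ j).1, prod_range]
  congr 1
  exact prod_congr rfl fun i _ => by rw [(hμ j).2 i]

/-- The address `j * n + i` is maintained as a running pointer in variable `21`, since natural
numbers cannot be multiplied by the machine. Homogeneity bounds every exponent, hence the innermost
loop, by `d`. -/
theorem runs_evalP (hW : 0 < W) (hs : HoldsInput s n d q f) (hf : f.IsHomogeneous d)
    (hnW : n ≤ W) (hdW : d ≤ W) (hmW : #f.support ≤ W) :
    Runs W evalP s fun s' => s'.real 0 = eval (fun i : Fin n => s.realArr 3 i) f := by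
  have hexp : ∀ j < #f.support, ∀ i < n, s.natArr 0 (j * n + i) ≤ W := by
    intro j hj i hi
    obtain ⟨-, -, -, -, μ, hμ⟩ := hs
    have h1 := (hμ ⟨j, hj⟩).2 ⟨i, hi⟩
    simp only at h1
    rw [h1]
    refine le_trans ?_ hdW
    exact (Finsupp.le_degree _ _).trans (hf.degree_eq_sum_deg_support (μ ⟨j, hj⟩).2).ge
  rw [eval_eq_sum_range hs]
  set U := s.realArr 3 with hU
  refine Runs.seq hW (Runs.setReal fun _ => Runs.seq hW (Runs.setNat fun _ => ?_))
  refine Runs.forLt hW (N := #f.support) (fun j s' => s'.nat 21 = j * n ∧ s'.real 0 =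
    ∑ j ∈ range j, s.realArr 0 j * ∏ i ∈ range n, U i ^ s.natArr 0 (j * n + i)) hmW (by decide)
    ?_ ?_ ?_ ?_
  · intro s' hfr
    simpa [NExp.eval, hs.2.2.2.1] using hfr.nat 3 (by decide)
  · simp [NExp.eval, RExp.eval]
  · rintro j hj s₁ hfr hk ⟨h21, h0⟩
    have hA0 : s₁.natArr 0 = s.natArr 0 := hfr.natArr 0 (by decide)
    have hR0 : s₁.realArr 0 = s.realArr 0 := hfr.realArr 0 (by decide)
    have hR3 : s₁.realArr 3 = U := hfr.realArr 3 (by decide)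
    have hn1 : s₁.nat 0 = n := by simpa [hs.1] using hfr.nat 0 (by decide)
    refine Runs.seq hW (Runs.setReal fun _ => Runs.seq hW ?_)
    refine Runs.forLt hW (N := n) (fun i s' => s'.nat 21 = j * n + i ∧ s'.real 1 =
      s.realArr 0 j * ∏ i ∈ range i, U i ^ s.natArr 0 (j * n + i)) hnW (by decide)
      ?_ ?_ ?_ ?_
    · intro s' hfr'
      simpa [NExp.eval, hn1] using hfr'.nat 0 (by decide)
    · simp [NExp.eval, RExp.eval, hk, hR0, h21]
    · rintro i hi s₂ hfr' hk' ⟨h21', h1⟩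
      have hA0' : s₂.natArr 0 = s.natArr 0 := (hfr'.natArr 0 (by decide)).trans hA0
      have hR3' : s₂.realArr 3 = U := (hfr'.realArr 3 (by decide)).trans hR3
      refine Runs.seq hW ?_
      refine Runs.forLt hW (N := s.natArr 0 (j * n + i)) (fun e s' => s'.real 1 =
        s.realArr 0 j * (∏ i ∈ range i, U i ^ s.natArr 0 (j * n + i)) * U i ^ e)
        (hexp j hj i hi) (by decide) ?_ ?_ ?_ ?_
      · intro s' hfr''
        simp [NExp.eval, hfr''.natArr 0 (by decide), hfr''.nat 21 (by decide), hA0', h21']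
      · simpa using h1
      · intro e he s₃ hfr'' hk'' hI
        refine Runs.setReal fun _ => ?_
        have e1 : s₃.realArr 3 = U := (hfr''.realArr 3 (by decide)).trans hR3'
        have e2 : s₃.nat 19 = i := (hfr''.nat 19 (by decide)).trans hk'
        simp [RExp.eval, NExp.eval, hI, e1, e2, pow_succ, mul_assoc]
      · intro s₃ hfr'' hI hfr3
        refine Runs.setNat fun _ => ?_
        have e2 : s₃.nat 21 = j * n + i := (hfr''.nat 21 (by decide)).trans h21'
        simp [NExp.eval, e2, hI, prod_range_succ]
        exact ⟨by ring, by ring⟩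
    · rintro s₂ hfr' ⟨h21', h1⟩ hfr2
      refine Runs.setReal fun _ => ?_
      have e2 : s₂.real 0 = s₁.real 0 := hfr'.real 0 (by decide)
      simp [RExp.eval, e2, h21', h1, sum_range_succ, h0]
      ring
  · rintro s' hfr ⟨-, h⟩
    exact h

/-- `array a := e`, where `e` may refer to the index as variable `17`. -/
def fillP (a : ℕ) (e : RExp) : Prog := .forLt 17 (.var 0) (.putReal a (.var 17) e)

/-- The premise that cell `j` still has its old value when it is reached lets `e` read the array
being overwritten, as in the normalization of a vector in place. -/
theorem runs_fillP (hW : 0 < W) {a : ℕ} {e : RExp} (hn : s.nat 0 = n) (hnW : n ≤ W) (g : ℕ → ℝ)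
    (he : ∀ j < n, ∀ s', Frame (fillP a e) s s' → s'.nat 17 = j →
      s'.realArr a j = s.realArr a j → e.eval s' = g j) :
    Runs W (fillP a e) s fun s' => ∀ j < n, s'.realArr a j = g j := by
  refine Runs.forLt hW (N := n) (fun k s' => (∀ j < k, s'.realArr a j = g j) ∧
    ∀ j, k ≤ j → s'.realArr a j = s.realArr a j) hnW (by simp [Prog.natVars]) ?_ ?_ ?_ ?_
  · intro s' hfr
    simpa [NExp.eval, hn] using hfr.nat 0 (by simp [Prog.natVars, Prog.forLt])
  · simp
  · rintro k hk s₁ hfr h17 ⟨h1, h2⟩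
    refine Runs.putReal fun _ => ?_
    have := he k hk s₁ hfr h17 (h2 k le_rfl)
    constructor
    · intro j hj
      rcases Nat.lt_succ_iff_lt_or_eq.1 hj with h | rfl
      · simp [NExp.eval, h17, h1 j h, h.ne]
      · simp [NExp.eval, h17, this]
    · intro j hj
      have : j ≠ k := by omega
      simp [NExp.eval, h17, h2 j (by omega), this]
  · rintro s₁ hfr ⟨h1, -⟩
    exact h1

/-- Variable `r` receives the Euclidean norm of the array `a`. -/
def normP (a r : ℕ) : Prog :=
  .setReal 2 (.ofNat (.lit 0)) ;;
  .forLt 22 (.var 0) (.setReal 2 (.add (.var 2) (.mul (.get a (.var 22)) (.get a (.var 22))))) ;;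
  .setReal r (.sqrt (.var 2))

theorem runs_normP (hW : 0 < W) {a r : ℕ} (hn : s.nat 0 = n) (hnW : n ≤ W) :
    Runs W (normP a r) s fun s' => s'.real r = nrm (fun i : Fin n => s.realArr a i) := by
  refine Runs.seq hW (Runs.setReal fun _ => Runs.seq hW ?_)
  refine Runs.forLt hW (N := n) (fun k s' => s'.real 2 =
    ∑ i ∈ range k, s.realArr a i * s.realArr a i) hnW (by simp [Prog.natVars]) ?_ ?_ ?_ ?_
  · intro s' hfr
    simpa [NExp.eval, hn] using hfr.nat 0 (by simp [Prog.natVars, Prog.forLt])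
  · simp [RExp.eval, NExp.eval]
  · rintro k hk s₁ hfr h22 h1
    refine Runs.setReal fun _ => ?_
    have h3 : s₁.realArr a = s.realArr a :=
      hfr.realArr a (by simp [Prog.realArrs, Prog.forLt])
    simp [RExp.eval, NExp.eval, h1, h22, h3, sum_range_succ]
  · rintro s₁ hfr h1 _
    refine Runs.setReal ?_
    simp [RExp.eval, h1, nrm, dotProduct, sum_range]

/-- Let `w` be the vector with entries `e` and `i` the value of variable `15`; the increment
`f (w + e_i) - f w` is added to variable `6`. -/
def incrementP (e : RExp) : Prog :=
  fillP 3 e ;; evalP ;; .setReal 6 (.sub (.var 6) (.var 0)) ;;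
  .putReal 3 (.var 15) (.add (.get 3 (.var 15)) (.ofNat (.lit 1))) ;;
  evalP ;; .setReal 6 (.add (.var 6) (.var 0))

theorem runs_incrementP (hW : 0 < W) (hs : HoldsInput s n d q f) (hf : f.IsHomogeneous d)
    (hnW : n ≤ W) (hdW : d ≤ W) (hmW : #f.support ≤ W) {e : RExp} {w : Fin n → ℝ} {i : Fin n}
    (hi : s.nat 15 = i) (he : ∀ j : Fin n, ∀ s', Frame (fillP 3 e) s s' → s'.nat 17 = j →
      e.eval s' = w j) :
    Runs W (incrementP e) s fun s' => s'.real 6 =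
      s.real 6 + eval (w + Pi.single i 1) f - eval w f := by
  refine Runs.seq hW ((runs_fillP hW hs.1 hnW (fun j => if h : j < n then w ⟨j, h⟩ else 0)
    fun j hj s' hfr h17 _ => ?_).mono fun s₁ fr₁ h₁ _ => ?_)
  · rw [he ⟨j, hj⟩ s' hfr h17, dif_pos hj]
  have hs₁ := hs.frame fr₁ (by simp [Prog.KeepsInput, fillP, Prog.forLt, Prog.natVars,
    Prog.natArrs, Prog.realArrs])
  have e₁ : ∀ j : Fin n, s₁.realArr 3 j = w j := fun j => by simp [h₁ j j.2]
  refine Runs.seq hW ((runs_evalP hW hs₁ hf hnW hdW hmW).mono fun s₂ fr₂ h₂ _ => ?_)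
  refine Runs.seq hW (Runs.setReal fun _ => Runs.seq hW (Runs.putReal fun _ => ?_))
  set s₃ := (s₂.setR 6 (RExp.eval s₂ (.sub (.var 6) (.var 0)))) with hs₃
  set s₄ := s₃.putR 3 (NExp.eval s₃ (.var 15))
    (RExp.eval s₃ (.add (.get 3 (.var 15)) (.ofNat (.lit 1)))) with hs₄
  have hi₃ : s₃.nat 15 = i := by
    simp [hs₃, fr₂.nat 15 (by decide), fr₁.nat 15 (by simp [fillP, Prog.forLt, Prog.natVars]), hi]
  have hs₄' : HoldsInput s₄ n d q f :=
    ((hs₁.frame fr₂ (by decide)).setR _).putR _ _ (by decide)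
  refine Runs.seq hW ((runs_evalP hW hs₄' hf hnW hdW hmW).mono fun s₅ fr₅ h₅ _ => ?_)
  refine Runs.setReal ?_
  have e₄ : (fun j : Fin n => s₄.realArr 3 j) = w + Pi.single i 1 := by
    ext j
    by_cases h : j = i
    · simp [hs₄, NExp.eval, RExp.eval, h, hi₃]
      simp [hs₃, fr₂.realArr 3 (by decide), e₁]
    · have h' : (j : ℕ) ≠ i := fun hh => h (Fin.ext hh)
      simp [hs₄, NExp.eval, h', h, hi₃]
      simp [hs₃, fr₂.realArr 3 (by decide), e₁]
  have e₅ : s₄.real 6 = s.real 6 - eval w f := by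
    simp [hs₄, hs₃, RExp.eval, h₂, e₁, fr₂.real 6 (by decide),
      fr₁.real 6 (by simp [fillP, Prog.forLt, Prog.realVars])]
  simp [RExp.eval, h₅, fr₅.real 6 (by decide), e₄, e₅]
  ring

/-- For `t := array 2` and `v := array 4`, the entry of `polStep f d t v` whose index is held by
variable `15` is stored in variable `4`. -/
def polStepEntryP : Prog :=
  .setReal 4 (.ofNat (.lit 0)) ;; .setReal 5 (.ofNat (.lit 1)) ;;
  .forLt 16 (.add (.sub (.var 1) (.lit 2)) (.lit 1))
    (.setReal 6 (.ofNat (.lit 0)) ;;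
    incrementP (.mul (.ofNat (.var 16)) (.get 2 (.var 17))) ;;
    .setReal 6 (.sub (.ofNat (.lit 0)) (.var 6)) ;;
    incrementP (.add (.mul (.ofNat (.var 16)) (.get 2 (.var 17))) (.get 4 (.var 17))) ;;
    .setReal 4 (.add (.var 4) (.mul (.var 5) (.var 6))) ;;
    .setReal 5 (.div (.mul (.sub (.ofNat (.lit 0)) (.var 5))
      (.ofNat (.sub (.sub (.var 1) (.lit 2)) (.var 16)))) (.ofNat (.add (.var 16) (.lit 1)))))

theorem runs_polStepEntryP (hW : 0 < W) (hs : HoldsInput s n d q f) (hf : f.IsHomogeneous d)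
    (hnW : n ≤ W) (hdW : d + 1 ≤ W) (hmW : #f.support ≤ W) {t v : Fin n → ℝ} {i : Fin n}
    (ht : ∀ j : Fin n, s.realArr 2 j = t j) (hv : ∀ j : Fin n, s.realArr 4 j = v j)
    (hi : s.nat 15 = i) :
    Runs W polStepEntryP s fun s' => s'.real 4 = polStep f d t v i := by
  refine Runs.seq hW (Runs.setReal fun _ => Runs.seq hW (Runs.setReal fun _ => ?_))
  refine Runs.forLt hW (N := d - 2 + 1) (fun k s' =>
    s'.real 5 = (-1) ^ k * ((d - 2).choose k : ℝ) ∧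
    s'.real 4 = ∑ l ∈ range k, (-1) ^ l * ((d - 2).choose l : ℝ) *
      (eval ((l : ℝ) • t + v + Pi.single i 1) f - eval ((l : ℝ) • t + v) f
        - eval ((l : ℝ) • t + Pi.single i 1) f + eval ((l : ℝ) • t) f)) (by omega) (by decide)
    ?_ ?_ ?_ ?_
  · intro s' hfr
    simp [NExp.eval, hfr.nat 1 (by decide), hs.2.1]
  · simp [NExp.eval, RExp.eval]
  · rintro l hl s₁ fr₁ h16 ⟨h5, h4⟩
    have hs₁ : HoldsInput s₁ n d q f := ((hs.setR _).setR _).frame fr₁ (by decide)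
    have hi₁ : s₁.nat 15 = i := (fr₁.nat 15 (by decide)).trans hi
    have ht₁ : ∀ j : Fin n, s₁.realArr 2 j = t j := fun j => by
      rw [fr₁.realArr 2 (by decide)]; exact ht j
    have hv₁ : ∀ j : Fin n, s₁.realArr 4 j = v j := fun j => by
      rw [fr₁.realArr 4 (by decide)]; exact hv j
    refine Runs.seq hW (Runs.setReal fun _ => Runs.seq hW ?_)
    refine (runs_incrementP hW (hs₁.setR _) hf hnW (by omega) hmW (w := (l : ℝ) • t) hi₁
      fun j s' fr h17 => ?_).mono fun s₂ fr₂ h₂ _ => ?_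
    · simp [RExp.eval, NExp.eval, h17, fr.nat 16 (by decide), fr.realArr 2 (by decide), ht₁, h16]
    refine Runs.seq hW (Runs.setReal fun _ => Runs.seq hW ?_)
    have hs₂ : HoldsInput s₂ n d q f := (hs₁.setR _).frame fr₂ (by decide)
    refine (runs_incrementP hW (hs₂.setR _) hf hnW (by omega) hmW (w := (l : ℝ) • t + v)
      ((fr₂.nat 15 (by decide)).trans hi₁)
      fun j s' fr h17 => ?_).mono fun s₃ fr₃ h₃ _ => ?_
    · simp [RExp.eval, NExp.eval, h17, fr.nat 16 (by decide), fr.realArr 2 (by decide),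
        fr.realArr 4 (by decide), fr₂.nat 16 (by decide), fr₂.realArr 2 (by decide),
        fr₂.realArr 4 (by decide), ht₁, hv₁, h16]
    refine Runs.seq hW (Runs.setReal fun _ => Runs.setReal fun _ => ?_)
    have v6 : s₃.real 6 = eval ((l : ℝ) • t + v + Pi.single i 1) f - eval ((l : ℝ) • t + v) f
        - eval ((l : ℝ) • t + Pi.single i 1) f + eval ((l : ℝ) • t) f := by
      rw [h₃]
      simp [RExp.eval, NExp.eval, h₂]
      ring
    have v5 : s₃.real 5 = (-1) ^ l * ((d - 2).choose l : ℝ) := by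
      rw [← h5]
      simp [fr₃.real 5 (by decide), fr₂.real 5 (by decide)]
    have v4 : s₃.real 4 = s₁.real 4 := by
      simp [fr₃.real 4 (by decide), fr₂.real 4 (by decide)]
    have v16 : s₃.nat 16 = l := by
      simp [fr₃.nat 16 (by decide), fr₂.nat 16 (by decide), h16]
    have v1 : s₃.nat 1 = d := (hs₂.setR _).frame fr₃ (by decide) |>.2.1
    constructor
    · simp [RExp.eval, NExp.eval, v5, v16, v1]
      -- The signed binomial coefficient is updated through `choose D (l+1) * (l+1) = choose D l *
      -- (D-l)`.
      rw [div_eq_iff (by positivity), pow_succ]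
      have := congrArg (Nat.cast : ℕ → ℝ) (Nat.choose_succ_right_eq (d - 2) l)
      push_cast at this
      linear_combination ((-1) ^ l) * this
    · simp [RExp.eval, v5, v4, v6, h4, sum_range_succ]
  · rintro s₁ fr₁ ⟨-, h⟩
    exact h

/-- For `t := array 2` and `v := array 4`, the array `5` receives `polStep f d t v`. -/
def polStepP : Prog :=
  .forLt 15 (.var 0) (polStepEntryP ;; .putReal 5 (.var 15) (.var 4))

theorem runs_polStepP (hW : 0 < W) (hs : HoldsInput s n d q f) (hf : f.IsHomogeneous d)
    (hnW : n ≤ W) (hdW : d + 1 ≤ W) (hmW : #f.support ≤ W) {t v : Fin n → ℝ}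
    (ht : ∀ j : Fin n, s.realArr 2 j = t j) (hv : ∀ j : Fin n, s.realArr 4 j = v j) :
    Runs W polStepP s fun s' => ∀ j : Fin n, s'.realArr 5 j = polStep f d t v j := by
  refine Runs.forLt hW (N := n) (fun k s' => ∀ j : Fin n, (j : ℕ) < k →
    s'.realArr 5 j = polStep f d t v j) hnW (by decide) ?_ ?_ ?_ ?_
  · intro s' hfr
    simp [NExp.eval, hfr.nat 0 (by decide), hs.1]
  · simp
  · intro k hk s₁ fr₁ h15 hI
    refine Runs.seq hW ((runs_polStepEntryP hW (hs.frame fr₁ (by decide)) hf hnW hdW hmW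
      (t := t) (v := v) (i := ⟨k, hk⟩) (fun j => ?_) (fun j => ?_) h15).mono
      fun s₂ fr₂ h₂ _ => Runs.putReal fun _ j hj => ?_)
    · rw [fr₁.realArr 2 (by decide), ht]
    · rw [fr₁.realArr 4 (by decide), hv]
    · have h15' : s₂.nat 15 = k := (fr₂.nat 15 (by decide)).trans h15
      by_cases h : (j : ℕ) = k
      · have : j = ⟨k, hk⟩ := Fin.ext h
        simp [NExp.eval, RExp.eval, h15', h₂, this]
      · simp [NExp.eval, h15', h, fr₂.realArr 5 (by decide)]
        exact hI j (by omega)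
  · intro s₁ fr₁ h j
    exact h j j.2

end Spec

/-! ### Recording the best direction and sweeping over the power iterates -/

section Search

variable {W n d q : ℕ} {f : MvPolynomial (Fin n) ℝ} {s s' : State}

/-- The value of `f ^ 2` at the direction of `u`. -/
def score (f : MvPolynomial (Fin n) ℝ) (u : Fin n → ℝ) : ℝ := eval ((nrm u)⁻¹ • u) f ^ 2

/-- The array `1` holds a unit vector, and variable `3` is a lower bound for the value of `f ^ 2`
there. -/
def Valid (f : MvPolynomial (Fin n) ℝ) (s : State) : Prop :=
  nrm (fun i : Fin n => s.realArr 1 i) = 1 ∧ 0 ≤ s.real 3 ∧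
    s.real 3 ≤ eval (fun i : Fin n => s.realArr 1 i) f ^ 2

theorem Valid.of_eq (h : Valid f s) (h1 : s'.realArr 1 = s.realArr 1)
    (h3 : s'.real 3 = s.real 3) : Valid f s' := by
  unfold Valid at h ⊢
  rwa [h1, h3]

theorem Valid.frame {P : Prog} (h : Valid f s) (hf : Frame P s s') (h1 : 1 ∉ P.realArrs)
    (h3 : 3 ∉ P.realVars) : Valid f s' := h.of_eq (hf.realArr 1 h1) (hf.real 3 h3)

/-- The direction of the vector `u := array 3` is recorded if it beats the record. -/
def recordP : Prog :=
  normP 3 9 ;;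
  .ifReal (.var 9) (.ofNat (.lit 0)) .skip
    (fillP 3 (.div (.get 3 (.var 17)) (.var 9)) ;; evalP ;;
    .ifReal (.mul (.var 0) (.var 0)) (.var 3) .skip
      (fillP 1 (.get 3 (.var 17)) ;; .setReal 3 (.mul (.var 0) (.var 0))))

theorem nrm_inv_smul_self {u : Fin n → ℝ} (hu : 0 < nrm u) : nrm ((nrm u)⁻¹ • u) = 1 := by
  rw [SphereOpt.nrm_eq_norm] at hu ⊢
  rw [SphereOpt.nrm_eq_norm, WithLp.toLp_smul, norm_smul, norm_inv, norm_norm,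
    inv_mul_cancel₀ hu.ne']

theorem runs_recordP (hW : 0 < W) (hs : HoldsInput s n d q f) (hf : f.IsHomogeneous d)
    (hd : 0 < d) (hnW : n ≤ W) (hdW : d ≤ W) (hmW : #f.support ≤ W) (hval : Valid f s)
    {u : Fin n → ℝ} (hu : ∀ j : Fin n, s.realArr 3 j = u j) :
    Runs W recordP s fun s' => Valid f s' ∧ s.real 3 ≤ s'.real 3 ∧ score f u ≤ s'.real 3 := by
  refine Runs.seq hW ((runs_normP hW hs.1 hnW).mono fun s₁ fr₁ h₁ _ => ?_)
  have hs₁ := hs.frame fr₁ (by decide)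
  have hval₁ := hval.frame fr₁ (by decide) (by decide)
  have hu' : (fun j : Fin n => s.realArr 3 j) = u := funext hu
  rw [hu'] at h₁
  have h3 : s₁.real 3 = s.real 3 := fr₁.real 3 (by decide)
  refine Runs.ifReal hW (fun hc => Runs.skip ⟨hval₁, h3.ge, ?_⟩) fun hc => ?_
  · simp only [RExp.eval, NExp.eval, Nat.cast_zero, h₁] at hc
    have h0 : nrm u = 0 := le_antisymm hc (Real.sqrt_nonneg _)
    -- The zero vector has score `f(0)² = 0` because `d > 0`, so skipping it is safe.
    have e0 : eval (fun i => (0 : ℝ) * u i) f = 0 := by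
      rw [SphereOpt.eval_smul_of_isHomogeneous hf, zero_pow hd.ne', zero_mul]
    have e1 : (nrm u)⁻¹ • u = fun i => (0 : ℝ) * u i := by ext; simp [h0]
    rw [score, e1, e0]
    simpa using hval₁.2.1
  simp only [RExp.eval, NExp.eval, Nat.cast_zero, h₁, not_le] at hc
  have hu₁ : s₁.realArr 3 = s.realArr 3 := fr₁.realArr 3 (by decide)
  refine Runs.seq hW ((runs_fillP hW hs₁.1 hnW (fun j => s.realArr 3 j / nrm u)
    fun j hj s' hfr h17 h => ?_).mono fun s₂ fr₂ h₂ _ => ?_)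
  · simp [RExp.eval, NExp.eval, h17, h, hu₁, hfr.real 9 (by decide), h₁]
  have hs₂ := hs₁.frame fr₂ (by decide)
  have hval₂ := hval₁.frame fr₂ (by decide) (by decide)
  have hu₂ : (fun j : Fin n => s₂.realArr 3 j) = (nrm u)⁻¹ • u := by
    ext j
    rw [h₂ j j.2, hu]
    simp [div_eq_inv_mul]
  refine Runs.seq hW ((runs_evalP hW hs₂ hf hnW hdW hmW).mono fun s₃ fr₃ h₃ _ => ?_)
  have hs₃ := hs₂.frame fr₃ (by decide)
  have hval₃ := hval₂.frame fr₃ (by decide) (by decide)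
  have h3' : s₃.real 3 = s.real 3 :=
    ((fr₃.real 3 (by decide)).trans (fr₂.real 3 (by decide))).trans h3
  have hsc : s₃.real 0 * s₃.real 0 = score f u := by rw [h₃, hu₂, score, sq]
  refine Runs.ifReal hW (fun hc' => Runs.skip ⟨hval₃, h3'.ge, ?_⟩) fun hc' => ?_
  · simp only [RExp.eval] at hc'
    rwa [hsc] at hc'
  simp only [RExp.eval, not_le, hsc] at hc'
  refine Runs.seq hW ((runs_fillP hW hs₃.1 hnW (s₃.realArr 3)
    fun j hj s' hfr h17 h => ?_).mono fun s₄ fr₄ h₄ _ => ?_)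
  · simp [RExp.eval, NExp.eval, h17, hfr.realArr 3 (by decide)]
  refine Runs.setReal ?_
  have hv : s₄.real 0 * s₄.real 0 = score f u := by rw [fr₄.real 0 (by decide), hsc]
  have hout : (fun j : Fin n => s₄.realArr 1 j) = (nrm u)⁻¹ • u := by
    rw [← hu₂, ← fr₃.realArr 3 (by decide)]
    exact funext fun j => h₄ j j.2
  refine ⟨⟨?_, ?_, ?_⟩, ?_, ?_⟩
  · simp only [State.setR_realArr]
    rw [hout, nrm_inv_smul_self hc]
  · simpa [RExp.eval] using mul_self_nonneg _
  · simp only [State.setR_realArr, State.setR_real, if_true, RExp.eval]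
    rw [hout, hv, score]
  · simp only [State.setR_real, if_true, RExp.eval, hv]
    rw [← h3']; exact hc'.le
  · simp [RExp.eval, hv]

/-- With `t := array 2`, `v := array 4`: the candidate `candU` is formed and recorded, and `v` is
replaced by `polStep f d t v`. -/
def candidateP : Prog :=
  polStepP ;; normP 4 7 ;; normP 5 8 ;;
  fillP 3 (.add (.add
    (.mul (.ofNat (.get 1 (.add (.var 0) (.lit 1)))) (.get 2 (.var 17)))
    (.mul (.ofNat (.get 1 (.add (.var 0) (.lit 2)))) (.div (.get 4 (.var 17)) (.var 7))))
    (.mul (.ofNat (.get 1 (.add (.var 0) (.lit 3)))) (.div (.get 5 (.var 17)) (.var 8)))) ;;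
  recordP ;; fillP 4 (.get 5 (.var 17))

theorem runs_candidateP (hW : 0 < W) (hs : HoldsInput s n d q f) (hf : f.IsHomogeneous d)
    (hd : 0 < d) (hnW : n ≤ W) (hdW : d + 1 ≤ W) (hmW : #f.support ≤ W) (hval : Valid f s)
    {t v : Fin n → ℝ}
    (ht : ∀ j : Fin n, s.realArr 2 j = t j) (hv : ∀ j : Fin n, s.realArr 4 j = v j) :
    Runs W candidateP s fun s' => Valid f s' ∧ s.real 3 ≤ s'.real 3 ∧
      score f (candU f d t v (s.natArr 1 (n + 1)) (s.natArr 1 (n + 2)) (s.natArr 1 (n + 3))) ≤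
        s'.real 3 ∧ ∀ j : Fin n, s'.realArr 4 j = polStep f d t v j := by
  refine Runs.seq hW ((runs_polStepP hW hs hf hnW hdW hmW ht hv).mono fun s₁ fr₁ h₁ _ => ?_)
  have hs₁ := hs.frame fr₁ (by decide)
  refine Runs.seq hW ((runs_normP hW hs₁.1 hnW).mono fun s₂ fr₂ h₂ _ => ?_)
  have hs₂ := hs₁.frame fr₂ (by decide)
  refine Runs.seq hW ((runs_normP hW hs₂.1 hnW).mono fun s₃ fr₃ h₃ _ => ?_)
  have hs₃ := hs₂.frame fr₃ (by decide)
  have hn₃ : s₃.nat 0 = n := hs₃.1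
  have a2 : ∀ j : Fin n, s₃.realArr 2 j = t j := fun j => by
    rw [fr₃.realArr 2 (by decide), fr₂.realArr 2 (by decide), fr₁.realArr 2 (by decide), ht]
  have a4 : ∀ j : Fin n, s₃.realArr 4 j = v j := fun j => by
    rw [fr₃.realArr 4 (by decide), fr₂.realArr 4 (by decide), fr₁.realArr 4 (by decide), hv]
  have a5 : ∀ j : Fin n, s₃.realArr 5 j = polStep f d t v j := fun j => by
    rw [fr₃.realArr 5 (by decide), fr₂.realArr 5 (by decide), h₁]
  have r7 : s₃.real 7 = nrm v := by
    rw [fr₃.real 7 (by decide), h₂]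
    congr 1; ext j
    rw [fr₁.realArr 4 (by decide), hv]
  have r8 : s₃.real 8 = nrm (polStep f d t v) := by
    rw [h₃]
    congr 1; ext j
    rw [fr₂.realArr 5 (by decide), h₁]
  have na : s₃.natArr 1 = s.natArr 1 := by
    rw [fr₃.natArr 1 (by decide), fr₂.natArr 1 (by decide), fr₁.natArr 1 (by decide)]
  set U := candU f d t v (s.natArr 1 (n + 1)) (s.natArr 1 (n + 2)) (s.natArr 1 (n + 3)) with hU
  refine Runs.seq hW ((runs_fillP hW hn₃ hnW (fun j => if h : j < n then U ⟨j, h⟩ else 0)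
    fun j hj s' hfr h17 _ => ?_).mono fun s₄ fr₄ h₄ _ => ?_)
  · rw [dif_pos hj, hU]
    have b2 := a2 ⟨j, hj⟩
    have b4 := a4 ⟨j, hj⟩
    have b5 := a5 ⟨j, hj⟩
    simp only at b2 b4 b5
    simp only [RExp.eval, NExp.eval, h17, hfr.realArr 2 (by decide), hfr.realArr 4 (by decide),
      hfr.realArr 5 (by decide), hfr.natArr 1 (by decide), hfr.nat 0 (by decide),
      hfr.real 7 (by decide), hfr.real 8 (by decide), r7, r8, na, hn₃, b2, b4, b5, candU,
      Pi.add_apply, Pi.smul_apply, smul_eq_mul, div_eq_inv_mul]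
  have hs₄ := hs₃.frame fr₄ (by decide)
  have hval₄ := (((hval.frame fr₁ (by decide) (by decide)).frame fr₂ (by decide)
    (by decide)).frame fr₃ (by decide) (by decide)).frame fr₄ (by decide) (by decide)
  have h3 : s₄.real 3 = s.real 3 := by
    rw [fr₄.real 3 (by decide), fr₃.real 3 (by decide), fr₂.real 3 (by decide),
      fr₁.real 3 (by decide)]
  refine Runs.seq hW ((runs_recordP hW hs₄ hf hd hnW (by omega) hmW hval₄ (u := U)
    fun j => by rw [h₄ j j.2, dif_pos]).mono fun s₅ fr₅ h₅ _ => ?_)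
  have hs₅ := hs₄.frame fr₅ (by decide)
  obtain ⟨hval₅, hm₅, hsc⟩ := h₅
  refine (runs_fillP hW hs₅.1 hnW (s₃.realArr 5)
    fun j hj s' hfr h17 _ => ?_).mono fun s₆ fr₆ h₆ => ?_
  · simp [RExp.eval, NExp.eval, h17, hfr.realArr 5 (by decide), fr₅.realArr 5 (by decide),
      fr₄.realArr 5 (by decide)]
  have h36 : s₆.real 3 = s₅.real 3 := fr₆.real 3 (by decide)
  refine ⟨hval₅.frame fr₆ (by decide) (by decide), ?_, ?_, fun j => ?_⟩
  · rw [h36, ← h3]; exact hm₅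
  · rw [h36]; exact hsc
  · rw [h₆ j j.2, a5]

/-- All candidates for the base point `t := array 2`. -/
def sweepP : Prog :=
  .forLt 13 (.var 0) (fillP 4 (.ofNat (.lit 0)) ;; .putReal 4 (.var 13) (.ofNat (.lit 1)) ;;
    .forLt 14 (.var 0) candidateP)

theorem runs_sweepP (hW : 0 < W) (hs : HoldsInput s n d q f) (hf : f.IsHomogeneous d)
    (hd : 0 < d) (hnW : n ≤ W) (hdW : d + 1 ≤ W) (hmW : #f.support ≤ W) (hval : Valid f s)
    {t : Fin n → ℝ} (ht : ∀ j : Fin n, s.realArr 2 j = t j) :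
    Runs W sweepP s fun s' => Valid f s' ∧ s.real 3 ≤ s'.real 3 ∧
      ∀ i : Fin n, ∀ p < n, score f (candU f d t ((polStep f d t)^[p] (Pi.single i 1))
        (s.natArr 1 (n + 1)) (s.natArr 1 (n + 2)) (s.natArr 1 (n + 3))) ≤ s'.real 3 := by
  refine Runs.forLt hW (N := n) (fun k s' => Valid f s' ∧ s.real 3 ≤ s'.real 3 ∧
      ∀ i : Fin n, (i : ℕ) < k → ∀ p < n, score f (candU f d t ((polStep f d t)^[p]
        (Pi.single i 1)) (s.natArr 1 (n + 1)) (s.natArr 1 (n + 2)) (s.natArr 1 (n + 3))) ≤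
          s'.real 3) hnW (by decide) ?_ ?_ ?_ ?_
  · intro s' hfr
    simp [NExp.eval, hfr.nat 0 (by decide), hs.1]
  · exact ⟨hval.of_eq rfl rfl, le_rfl, fun i hi => absurd hi (Nat.not_lt_zero _)⟩
  · rintro k hk s₁ fr₁ h13 ⟨hval₁, hm₁, hI₁⟩
    have hs₁ := hs.frame fr₁ (by decide)
    refine Runs.seq hW ((runs_fillP hW hs₁.1 hnW (fun _ => 0)
      fun j hj s' hfr h17 _ => by simp [RExp.eval, NExp.eval]).mono fun s₂ fr₂ h₂ _ => ?_)
    have hs₂ := hs₁.frame fr₂ (by decide)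
    have hval₂ := hval₁.frame fr₂ (by decide) (by decide)
    have h13' : s₂.nat 13 = k := (fr₂.nat 13 (by decide)).trans h13
    refine Runs.seq hW (Runs.putReal fun fr₃ => ?_)
    set s₃ := s₂.putR 4 (NExp.eval s₂ (.var 13)) (RExp.eval s₂ (.ofNat (.lit 1))) with hs₃e
    have hs₃ := hs₂.frame fr₃ (by decide)
    have hval₃ := hval₂.frame fr₃ (by decide) (by decide)
    set i₀ : Fin n := ⟨k, hk⟩ with hi₀
    have h4 : ∀ j : Fin n, s₃.realArr 4 j = (Pi.single i₀ 1 : Fin n → ℝ) j := by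
      intro j
      by_cases h : j = i₀
      · simp [hs₃e, NExp.eval, RExp.eval, h13', h, hi₀]
      · have h' : (j : ℕ) ≠ k := fun hh => h (Fin.ext hh)
        simp [hs₃e, NExp.eval, h13', h, h', h₂ j j.2]
    have h33 : s₃.real 3 = s₁.real 3 :=
      (fr₃.real 3 (by decide)).trans (fr₂.real 3 (by decide))
    have na : s₃.natArr 1 = s.natArr 1 := by
      rw [fr₃.natArr 1 (by decide), fr₂.natArr 1 (by decide), fr₁.natArr 1 (by decide)]
    have h2 : s₃.realArr 2 = s.realArr 2 := by
      rw [fr₃.realArr 2 (by decide), fr₂.realArr 2 (by decide), fr₁.realArr 2 (by decide)]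
    refine Runs.forLt hW (N := n) (fun p s' => Valid f s' ∧ s₁.real 3 ≤ s'.real 3 ∧
      (∀ p' < p, score f (candU f d t ((polStep f d t)^[p'] (Pi.single i₀ 1))
        (s.natArr 1 (n + 1)) (s.natArr 1 (n + 2)) (s.natArr 1 (n + 3))) ≤ s'.real 3) ∧
      ∀ j : Fin n, s'.realArr 4 j = (polStep f d t)^[p] (Pi.single i₀ 1) j)
      hnW (by decide) ?_ ?_ ?_ ?_
    · intro s' hfr
      simp [NExp.eval, hfr.nat 0 (by decide), hs₃.1]
    · exact ⟨hval₃.of_eq rfl rfl, h33.ge, fun i hi => absurd hi (Nat.not_lt_zero _), h4⟩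
    · rintro p hp s₄ fr₄ h14 ⟨hval₄, hm₄, hI₄, hv₄⟩
      refine (runs_candidateP hW (hs₃.frame fr₄ (by decide)) hf hd hnW hdW hmW hval₄
        (t := t) (fun j => ?_) hv₄).mono fun s₅ fr₅ h₅ _ => ?_
      · rw [fr₄.realArr 2 (by decide), h2, ht]
      · obtain ⟨c1, c2, c3, c4⟩ := h₅
        rw [fr₄.natArr 1 (by decide), na] at c3
        refine ⟨c1.of_eq rfl rfl, hm₄.trans c2, fun p' hp' => ?_, fun j => ?_⟩
        · rcases Nat.lt_succ_iff_lt_or_eq.1 hp' with h | rfl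
          · exact (hI₄ p' h).trans c2
          · exact c3
        · rw [Function.iterate_succ_apply']
          exact c4 j
    · rintro s₄ fr₄ ⟨hval₄, hm₄, hI₄, -⟩ -
      refine ⟨hval₄.of_eq rfl rfl, hm₁.trans hm₄, fun i hi => ?_⟩
      rcases Nat.lt_succ_iff_lt_or_eq.1 hi with h | h
      · exact fun p hp => (hI₁ i h p hp).trans hm₄
      · obtain rfl : i = i₀ := Fin.ext h
        exact hI₄
  · rintro s₁ fr₁ ⟨h1, h2, h3⟩
    exact ⟨h1, h2, fun i => h3 i i.2⟩

end Search

/-! ### Encoding vectors of multiplicities by digit counts -/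

section Digits

/-- The number of occurrences of the digit `i` among the lowest `L` digits of `x` in base `B`. -/
def digitCount (B : ℕ) : ℕ → ℕ → ℕ → ℕ
  | 0, _, _ => 0
  | L + 1, x, i => (if i = x % B then 1 else 0) + digitCount B L (x / B) i

/-- Every vector of counts with sum at most `L` is the vector of digit counts of the lowest digits
of some number, whose higher digits can be prescribed. -/
theorem exists_digitCount_eq (B : ℕ) (L : ℕ) (a : ℕ → ℕ) (ha : ∑ i ∈ range B, a i ≤ L)
    {y Y : ℕ} (hy : y < Y) :
    ∃ x < (B + 1) ^ L * Y, (fun x => x / (B + 1))^[L] x = y ∧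
      ∀ i < B, digitCount (B + 1) L x i = a i := by
  induction L generalizing a with
  | zero =>
    refine ⟨y, by simpa using hy, rfl, fun i hi => ?_⟩
    have := (sum_eq_zero_iff.1 (Nat.le_zero.1 ha)) i (mem_range.2 hi)
    simp [digitCount, this]
  | succ L ih =>
    obtain ⟨c, hc, a', ha', haa'⟩ : ∃ c ≤ B, ∃ a' : ℕ → ℕ, ∑ i ∈ range B, a' i ≤ L ∧
        ∀ i < B, (if i = c then 1 else 0) + a' i = a i := by
      by_cases h0 : ∑ i ∈ range B, a i = 0
      · refine ⟨B, le_rfl, a, by omega, fun i hi => ?_⟩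
        simp [hi.ne]
      · obtain ⟨c, hc, hac⟩ := exists_ne_zero_of_sum_ne_zero h0
        rw [mem_range] at hc
        refine ⟨c, hc.le, Function.update a c (a c - 1), ?_, fun i hi => ?_⟩
        · have h1 := sum_update_of_mem (mem_range.2 hc) a (a c - 1)
          have h2 := add_sum_erase (range B) a (mem_range.2 hc)
          rw [← erase_eq] at h1
          omega
        · by_cases h : i = c
          · subst h; simp; omega
          · simp [h]
    obtain ⟨x, hx, hxy, hxa⟩ := ih a' ha'
    have hdiv : (c + (B + 1) * x) / (B + 1) = x := by
      rw [Nat.add_mul_div_left _ _ (Nat.succ_pos B), Nat.div_eq_of_lt (by omega), zero_add]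
    have hmod : (c + (B + 1) * x) % (B + 1) = c := by
      rw [Nat.add_mul_mod_self_left, Nat.mod_eq_of_lt (by omega)]
    refine ⟨c + (B + 1) * x, ?_, ?_, fun i hi => ?_⟩
    · have h1 : x + 1 ≤ (B + 1) ^ L * Y := hx
      have h2 := Nat.mul_le_mul_left (B + 1) h1
      rw [pow_succ]
      nlinarith
    · rw [Function.iterate_succ_apply, hdiv, hxy]
    · rw [digitCount, hdiv, hmod, hxa i hi, haa' i hi]

end Digits

/-! ### Enumerating the codes and the corresponding base points -/

section Enumeration

variable {W n d q : ℕ} {f : MvPolynomial (Fin n) ℝ} {s s' : State}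

/-- Variables `10` and `11` receive quotient and remainder of the variables `8` and `4`. -/
def divideP : Prog :=
  .setNat 10 (.lit 0) ;; .setNat 11 (.var 8) ;;
  .forLt 12 (.var 8) (.ifNat (.var 4) (.var 11)
    (.setNat 11 (.sub (.var 11) (.var 4)) ;; .setNat 10 (.add (.var 10) (.lit 1))) .skip)

theorem runs_divideP (hW : 0 < W) {x B : ℕ} (hx : s.nat 8 = x) (hB : s.nat 4 = B) (hB2 : 2 ≤ B)
    (hxW : x ≤ W) :
    Runs W divideP s fun s' => s'.nat 10 = x / B ∧ s'.nat 11 = x % B := by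
  refine Runs.seq hW (Runs.setNat fun _ => Runs.seq hW (Runs.setNat fun _ => ?_))
  -- `x` rounds of subtraction are more than enough: either the remainder is already below `B`, or
  -- each round so far has raised the quotient.
  refine Runs.forLt hW (N := x) (fun k s' => s'.nat 11 + B * s'.nat 10 = x ∧
    (s'.nat 11 < B ∨ k ≤ s'.nat 10)) hxW (by decide) ?_ ?_ ?_ ?_
  · intro s' hfr
    simp [NExp.eval, hfr.nat 8 (by decide), hx]
  · simp [NExp.eval, hx]
  · rintro k hk s₁ fr₁ h12 ⟨h1, h2⟩
    have hB₁ : s₁.nat 4 = B := by simp [fr₁.nat 4 (by decide), hB]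
    refine Runs.ifNat hW (fun hc => Runs.seq hW (Runs.setNat fun _ => Runs.setNat fun _ => ?_))
      fun hc => Runs.skip fun _ => ?_
    · simp only [NExp.eval, hB₁] at hc
      simp only [State.setN_nat, NExp.eval, hB₁]
      norm_num
      rw [mul_add]
      omega
    · simp only [NExp.eval, hB₁, not_le] at hc
      simp only [State.setN_nat]
      norm_num
      exact ⟨h1, Or.inl hc⟩
  · rintro s₁ fr₁ ⟨h1, h2⟩
    have hlt : s₁.nat 11 < B := by
      rcases h2 with h | h
      · exact h
      · by_contra hcon
        have := Nat.mul_le_mul_left B h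
        have := Nat.mul_le_mul_right x hB2
        nlinarith
    rw [← h1]
    rw [Nat.add_mul_div_left _ _ (by omega), Nat.div_eq_of_lt hlt, Nat.add_mul_mod_self_left,
      Nat.mod_eq_of_lt hlt]
    simp

/-- The array `a` receives the digit counts for the lowest digits of variable `8` in the base held
by variable `4`; these digits, whose number is held by variable `5`, are then removed. -/
def decodeP (a : ℕ) : Prog :=
  .forLt 25 (.var 4) (.putNat a (.var 25) (.lit 0)) ;;
  .forLt 9 (.var 5) (divideP ;; .putNat a (.var 11) (.add (.get a (.var 11)) (.lit 1)) ;;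
    .setNat 8 (.var 10))

theorem iterate_div_le (B x L : ℕ) : (fun x => x / B)^[L] x ≤ x := by
  induction L generalizing x with
  | zero => exact le_rfl
  | succ L ih => exact (ih _).trans (Nat.div_le_self x B)

theorem runs_decodeP (hW : 0 < W) {a x B L : ℕ} (hx : s.nat 8 = x) (hB : s.nat 4 = B)
    (hL : s.nat 5 = L) (hB2 : 2 ≤ B) (hBW : B ≤ W) (hLW : L ≤ W) (hxW : x ≤ W) :
    Runs W (decodeP a) s fun s' => s'.nat 8 = (fun x => x / B)^[L] x ∧
      ∀ i < B, s'.natArr a i = digitCount B L x i := by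
  refine Runs.seq hW ?_
  refine Runs.forLt hW (N := B) (fun k s' => ∀ i < k, s'.natArr a i = 0) hBW
    (by simp [Prog.natVars]) ?_ ?_ ?_ ?_
  · intro s' hfr
    simpa [NExp.eval, hB] using hfr.nat 4 (by simp [Prog.natVars, Prog.forLt])
  · simp
  · intro k hk s₁ fr₁ h25 hI
    refine Runs.putNat fun _ i hi => ?_
    by_cases h : i = k
    · simp [NExp.eval, h25, h]
    · simp [NExp.eval, h25, h, hI i (by omega)]
  intro s₁ fr₁ h₁ _
  -- Counts already recorded plus counts of the digits still to be read are constant.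
  refine Runs.forLt hW (N := L) (fun k s' => s'.nat 8 = (fun x => x / B)^[k] x ∧
    ∀ i < B, s'.natArr a i + digitCount B (L - k) (s'.nat 8) i = digitCount B L x i) hLW
    (by simp +decide [Prog.natVars, Prog.forLt, divideP]) ?_ ?_ ?_ ?_
  · intro s' hfr
    have e1 := hfr.nat 5 (by simp +decide [Prog.natVars, Prog.forLt, divideP])
    have e2 := fr₁.nat 5 (by simp [Prog.natVars, Prog.forLt])
    simp [NExp.eval, e1, e2, hL]
  · have e2 : s₁.nat 8 = x := (fr₁.nat 8 (by simp [Prog.natVars, Prog.forLt])).trans hx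
    simp [e2]
    intro i hi
    simp [h₁ i hi]
  · rintro k hk s₂ fr₂ h9 ⟨h8, hI⟩
    have hB' : s₂.nat 4 = B := by
      rw [fr₂.nat 4 (by simp +decide [Prog.natVars, Prog.forLt, divideP]),
        fr₁.nat 4 (by simp [Prog.natVars, Prog.forLt]), hB]
    have hxk := iterate_div_le B x k
    refine Runs.seq hW ((runs_divideP hW rfl hB' hB2 (by omega)).mono fun s₃ fr₃ h₃ _ => ?_)
    obtain ⟨h10, h11⟩ := h₃
    refine Runs.seq hW (Runs.putNat fun _ => Runs.setNat fun _ => ?_)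
    have ha : s₃.natArr a = s₂.natArr a := fr₃.natArr a (by
      simp [divideP, Prog.natArrs, Prog.forLt])
    simp only [State.setN_nat, NExp.eval, State.putN_nat, State.setN_natArr, State.putN_natArr]
    norm_num
    constructor
    · rw [h10, h8]
      exact (Function.iterate_succ_apply' (fun x => x / B) k x).symm
    · intro i hi
      have := hI i hi
      rw [show L - k = (L - (k + 1)) + 1 by omega, digitCount] at this
      rw [h10, h11, ha, ← this]
      by_cases h : i = s₂.nat 8 % B
      · simp [← h]; omega
      · simp [h]
  · rintro s₂ fr₂ ⟨h8, hI⟩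
    refine ⟨h8, fun i hi => ?_⟩
    have := hI i hi
    simpa [digitCount] using this

/-- Variable `6` receives the number of codes. -/
def countP : Prog :=
  .setNat 6 (.lit 1) ;; .setNat 26 (.add (.var 5) (.add (.var 5) (.var 5))) ;;
  .forLt 27 (.var 26) (.setNat 24 (.lit 0) ;;
    .forLt 28 (.var 4) (.setNat 24 (.add (.var 24) (.var 6))) ;; .setNat 6 (.var 24))

theorem runs_countP (hW : 0 < W) {B L : ℕ} (hB : s.nat 4 = B) (hL : s.nat 5 = L)
    (hBW : B ≤ W) (hLW : L + (L + L) ≤ W) :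
    Runs W countP s fun s' => s'.nat 6 = B ^ (L + (L + L)) := by
  refine Runs.seq hW (Runs.setNat fun _ => Runs.seq hW (Runs.setNat fun _ => ?_))
  refine Runs.forLt hW (N := L + (L + L)) (fun k s' => s'.nat 6 = B ^ k) hLW (by decide)
    ?_ ?_ ?_ fun _ _ h => h
  · intro s' hfr
    simp [NExp.eval, hfr.nat 26 (by decide), hL]
  · simp [NExp.eval]
  · intro k hk s₁ fr₁ h27 hI
    refine Runs.seq hW (Runs.setNat fun _ => Runs.seq hW ?_)
    refine Runs.forLt hW (N := B) (fun k' s' => s'.nat 24 = k' * B ^ k) hBW (by decide)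
      ?_ ?_ ?_ ?_
    · intro s' hfr
      simp [NExp.eval, hfr.nat 4 (by decide), fr₁.nat 4 (by decide), hB]
    · simp [NExp.eval]
    · intro k' hk' s₂ fr₂ h28 hI'
      refine Runs.setNat fun _ => ?_
      simp [NExp.eval, hI', fr₂.nat 6 (by decide), hI]
      ring
    · intro s₂ fr₂ h₂ _
      refine Runs.setNat fun _ => ?_
      simp [NExp.eval, h₂, pow_succ]
      ring

/-- The array `2` receives the base point with the counts in the arrays `1`, `2`, `3`. -/
def basePointP : Prog :=
  fillP 2 (.add
    (.div (.ofNat (.get 1 (.var 17))) (.mul (.ofNat (.lit 3)) (.sqrt (.mul (.ofNat (.var 2))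
      (.add (.ofNat (.get 1 (.var 17))) (.ofNat (.get 2 (.var 17))))))))
    (.mul (.div (.ofNat (.get 1 (.var 0))) (.mul (.ofNat (.lit 3)) (.ofNat (.var 2))))
      (.add (.div (.ofNat (.lit 1)) (.sqrt (.ofNat (.var 0))))
        (.sqrt (.div (.ofNat (.get 3 (.var 17))) (.ofNat (.var 2)))))))

theorem runs_basePointP (hW : 0 < W) (hs : HoldsInput s n d q f) (hnW : n ≤ W) {a b c : ℕ → ℕ}
    (ha : ∀ i < n + 4, s.natArr 1 i = a i) (hb : ∀ i < n + 4, s.natArr 2 i = b i)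
    (hc : ∀ i < n + 4, s.natArr 3 i = c i) :
    Runs W basePointP s fun s' => ∀ j : Fin n, s'.realArr 2 j = candT n q a b c j := by
  refine (runs_fillP hW hs.1 hnW (fun j => if h : j < n then candT n q a b c ⟨j, h⟩ else 0)
    fun j hj s' hfr h17 _ => ?_).mono fun s₄ fr₄ h₄ j => by rw [h₄ j j.2, dif_pos]
  rw [dif_pos hj]
  simp [RExp.eval, NExp.eval, h17, hfr.nat 2 (by decide), hfr.nat 0 (by decide), hs.1, hs.2.2.1,
    hfr.natArr 1 (by decide), hfr.natArr 2 (by decide), hfr.natArr 3 (by decide), candT,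
    ha j (by omega), hb j (by omega), hc j (by omega), ha n (by omega)]

/-- All candidates for the code in variable `7`. -/
def codeP : Prog :=
  .setNat 8 (.var 7) ;; decodeP 1 ;; decodeP 2 ;; decodeP 3 ;; basePointP ;; sweepP

theorem runs_codeP (hW : 0 < W) (hs : HoldsInput s n d q f) (hf : f.IsHomogeneous d)
    (hd : 0 < d) (hnW : n + 5 ≤ W) (hdW : d + 1 ≤ W) (hmW : #f.support ≤ W) (hval : Valid f s)
    {L x y z : ℕ} (hB : s.nat 4 = n + 5) (hL : s.nat 5 = L) (hLW : L ≤ W) (hx : s.nat 7 = x)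
    (hxW : x ≤ W) (hy : (fun x => x / (n + 5))^[L] x = y)
    (hz : (fun x => x / (n + 5))^[L] y = z) {a b c : ℕ → ℕ}
    (ha : ∀ i < n + 4, digitCount (n + 5) L x i = a i)
    (hb : ∀ i < n + 4, digitCount (n + 5) L y i = b i)
    (hc : ∀ i < n + 4, digitCount (n + 5) L z i = c i) :
    Runs W codeP s fun s' => Valid f s' ∧ s.real 3 ≤ s'.real 3 ∧
      ∀ i : Fin n, ∀ p < n, score f (candU f d (candT n q a b c)
        ((polStep f d (candT n q a b c))^[p] (Pi.single i 1))
        (a (n + 1)) (a (n + 2)) (a (n + 3))) ≤ s'.real 3 := by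
  have hyW : y ≤ W := (hy ▸ iterate_div_le (n + 5) x L).trans hxW
  have hzW : z ≤ W := (hz ▸ iterate_div_le (n + 5) y L).trans hyW
  refine Runs.seq hW (Runs.setNat fun fr₀ => ?_)
  set s₀ := s.setN 8 (NExp.eval s (.var 7)) with hs₀e
  have hs₀ := hs.frame fr₀ (by decide)
  have h8₀ : s₀.nat 8 = x := by simp [hs₀e, NExp.eval, hx]
  have h4₀ : s₀.nat 4 = n + 5 := (fr₀.nat 4 (by decide)).trans hB
  have h5₀ : s₀.nat 5 = L := (fr₀.nat 5 (by decide)).trans hL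
  refine Runs.seq hW ((runs_decodeP hW h8₀ h4₀ h5₀ (by omega) hnW hLW hxW).mono
    fun s₁ fr₁ h₁ _ => ?_)
  rw [hy] at h₁
  have hs₁ := hs₀.frame fr₁ (by decide)
  have h4₁ : s₁.nat 4 = n + 5 := (fr₁.nat 4 (by decide)).trans h4₀
  have h5₁ : s₁.nat 5 = L := (fr₁.nat 5 (by decide)).trans h5₀
  refine Runs.seq hW ((runs_decodeP hW h₁.1 h4₁ h5₁ (by omega) hnW hLW hyW).mono
    fun s₂ fr₂ h₂ _ => ?_)
  rw [hz] at h₂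
  have hs₂ := hs₁.frame fr₂ (by decide)
  have h4₂ : s₂.nat 4 = n + 5 := (fr₂.nat 4 (by decide)).trans h4₁
  have h5₂ : s₂.nat 5 = L := (fr₂.nat 5 (by decide)).trans h5₁
  refine Runs.seq hW ((runs_decodeP hW h₂.1 h4₂ h5₂ (by omega) hnW hLW hzW).mono
    fun s₃ fr₃ h₃ _ => ?_)
  have hs₃ := hs₂.frame fr₃ (by decide)
  have hval₃ := (((hval.frame fr₀ (by decide) (by decide)).frame fr₁ (by decide)
    (by decide)).frame fr₂ (by decide) (by decide)).frame fr₃ (by decide) (by decide)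
  have a₃ : ∀ i < n + 4, s₃.natArr 1 i = a i := fun i hi => by
    rw [fr₃.natArr 1 (by decide), fr₂.natArr 1 (by decide), h₁.2 i (by omega), ha i hi]
  have b₃ : ∀ i < n + 4, s₃.natArr 2 i = b i := fun i hi => by
    rw [fr₃.natArr 2 (by decide), h₂.2 i (by omega), hb i hi]
  have c₃ : ∀ i < n + 4, s₃.natArr 3 i = c i := fun i hi => by
    rw [h₃.2 i (by omega), hc i hi]
  refine Runs.seq hW ((runs_basePointP hW hs₃ (by omega) a₃ b₃ c₃).mono fun s₄ fr₄ h₄ _ => ?_)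
  refine (runs_sweepP hW (hs₃.frame fr₄ (by decide)) hf hd (by omega) hdW hmW
    (hval₃.frame fr₄ (by decide) (by decide)) h₄).mono fun s₅ fr₅ h₅ => ?_
  rw [fr₄.natArr 1 (by decide), a₃ _ (by omega), a₃ _ (by omega), a₃ _ (by omega),
    fr₄.real 3 (by decide), fr₃.real 3 (by decide), fr₂.real 3 (by decide),
    fr₁.real 3 (by decide), fr₀.real 3 (by decide)] at h₅
  exact h₅

/-- By homogeneity a bound in the direction of `u` is a bound `|y| ‖u‖^d` at `u`; this converts the
record into `CandidateBound`. -/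
theorem abs_eval_le_of_score_le (hf : f.IsHomogeneous d) {u : Fin n → ℝ} {y : ℝ}
    (h : score f u ≤ y ^ 2) : |eval u f| ≤ |y| * nrm u ^ d := by
  have h' := sq_le_sq.1 h
  have h0 : 0 ≤ nrm u := Real.sqrt_nonneg _
  have hu : u = fun i => nrm u * ((nrm u)⁻¹ • u) i := by
    rcases h0.eq_or_lt with h1 | h1
    · have : WithLp.toLp 2 u = 0 := by rw [← norm_eq_zero, ← SphereOpt.nrm_eq_norm, h1]
      have hu0 : u = 0 := by simpa using this
      ext i; simp [hu0]
    · ext i; simp [h1.ne']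
  conv_lhs => rw [hu, SphereOpt.eval_smul_of_isHomogeneous hf, abs_mul,
    abs_of_nonneg (pow_nonneg h0 d), mul_comm]
  gcongr

/-- The search over all candidates. -/
def searchP : Prog :=
  .setNat 4 (.add (.var 0) (.lit 5)) ;; .setNat 5 (.add (.var 2) (.var 2)) ;; countP ;;
  fillP 1 (.ofNat (.lit 0)) ;; .putReal 1 (.lit 0) (.ofNat (.lit 1)) ;;
  .setReal 3 (.ofNat (.lit 0)) ;; .forLt 7 (.var 6) codeP

/-- Each of `a`, `b`, `c` has `n + 4` entries with sum at most `2q` and is the digit count of a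
block of `2q` digits in base `n + 5`. Hence the codes below `W` exhaust all triples, and the same
`W` bounds all loops. -/
theorem runs_searchP (hs : HoldsInput s n d q f) (hf : f.IsHomogeneous d) (hd : 0 < d)
    (hn : 0 < n) (hW : 0 < W) (hWe : W = (n + 5) ^ (2 * q + (2 * q + 2 * q)))
    (hnW : n + 5 ≤ W) (hdW : d + 1 ≤ W) (hmW : #f.support ≤ W)
    (hqW : 2 * q + (2 * q + 2 * q) ≤ W) :
    Runs W searchP s fun s' => nrm (fun i : Fin n => s'.realArr 1 i) = 1 ∧
      CandidateBound f d q |eval (fun i : Fin n => s'.realArr 1 i) f| := by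
  refine Runs.seq hW (Runs.setNat fun fr₁ => Runs.seq hW (Runs.setNat fun fr₂ => ?_))
  set s₁ := s.setN 4 (NExp.eval s (.add (.var 0) (.lit 5))) with hs₁e
  set s₂ := s₁.setN 5 (NExp.eval s₁ (.add (.var 2) (.var 2))) with hs₂e
  have hs₁ := hs.frame fr₁ (by decide)
  have hs₂ := hs₁.frame fr₂ (by decide)
  have h4 : s₂.nat 4 = n + 5 := by simp [hs₂e, hs₁e, NExp.eval, hs.1]
  have h5 : s₂.nat 5 = 2 * q := by simp [hs₂e, NExp.eval, hs₁.2.2.1, two_mul]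
  refine Runs.seq hW ((runs_countP hW h4 h5 hnW hqW).mono fun s₃ fr₃ h₃ _ => ?_)
  rw [← hWe] at h₃
  have hs₃ := hs₂.frame fr₃ (by decide)
  refine Runs.seq hW ((runs_fillP hW hs₃.1 (by omega) (fun _ => 0)
    fun j hj s' hfr h17 _ => by simp [RExp.eval, NExp.eval]).mono fun s₄ fr₄ h₄ _ => ?_)
  refine Runs.seq hW (Runs.putReal fun fr₅ => Runs.seq hW (Runs.setReal fun fr₆ => ?_))
  set s₅ := s₄.putR 1 (NExp.eval s₄ (.lit 0)) (RExp.eval s₄ (.ofNat (.lit 1))) with hs₅e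
  set s₆ := s₅.setR 3 (RExp.eval s₅ (.ofNat (.lit 0))) with hs₆e
  have hs₆ := ((hs₃.frame fr₄ (by decide)).frame fr₅ (by decide)).frame fr₆ (by decide)
  have hout : (fun i : Fin n => s₆.realArr 1 i) = Pi.single ⟨0, hn⟩ 1 := by
    ext j
    by_cases h : (j : ℕ) = 0
    · have : j = ⟨0, hn⟩ := Fin.ext h
      simp [hs₆e, hs₅e, NExp.eval, RExp.eval, this]
    · have h' : j ≠ ⟨0, hn⟩ := fun hh => h (by simp [hh])
      simp [hs₆e, hs₅e, NExp.eval, h, h', h₄ j j.2]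
  have hval₆ : Valid f s₆ := by
    refine ⟨?_, ?_, ?_⟩
    · rw [hout]; simp [nrm]
    · simp [hs₆e, RExp.eval, NExp.eval]
    · have : s₆.real 3 = 0 := by simp [hs₆e, RExp.eval, NExp.eval]
      rw [this]; positivity
  have h4₆ : s₆.nat 4 = n + 5 := by
    rw [fr₆.nat 4 (by decide), fr₅.nat 4 (by decide), fr₄.nat 4 (by decide),
      fr₃.nat 4 (by decide), h4]
  have h5₆ : s₆.nat 5 = 2 * q := by
    rw [fr₆.nat 5 (by decide), fr₅.nat 5 (by decide), fr₄.nat 5 (by decide),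
      fr₃.nat 5 (by decide), h5]
  have h6₆ : s₆.nat 6 = W := by
    rw [fr₆.nat 6 (by decide), fr₅.nat 6 (by decide), fr₄.nat 6 (by decide), h₃]
  set A : ℕ → ℕ → ℕ := digitCount (n + 5) (2 * q) with hA
  set Y : ℕ → ℕ := (fun x => x / (n + 5))^[2 * q] with hY
  refine Runs.forLt hW (N := W) (fun k s' => Valid f s' ∧ ∀ x < k, ∀ i : Fin n, ∀ p < n,
    score f (candU f d (candT n q (A x) (A (Y x)) (A (Y (Y x))))
      ((polStep f d (candT n q (A x) (A (Y x)) (A (Y (Y x)))))^[p] (Pi.single i 1))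
      (A x (n + 1)) (A x (n + 2)) (A x (n + 3))) ≤ s'.real 3) le_rfl (by decide) ?_ ?_ ?_ ?_
  · intro s' hfr
    simp [NExp.eval, hfr.nat 6 (by decide), h6₆]
  · exact ⟨hval₆.of_eq rfl rfl, fun x hx => absurd hx (Nat.not_lt_zero _)⟩
  · rintro x hx s₇ fr₇ h7 ⟨hval₇, hI⟩
    refine (runs_codeP hW (hs₆.frame fr₇ (by decide)) hf hd hnW hdW hmW hval₇
      ((fr₇.nat 4 (by decide)).trans h4₆) ((fr₇.nat 5 (by decide)).trans h5₆) (by omega) h7 hx.le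
      rfl rfl (fun _ _ => rfl) (fun _ _ => rfl) (fun _ _ => rfl)).mono fun s₈ fr₈ h₈ _ => ?_
    obtain ⟨c1, c2, c3⟩ := h₈
    refine ⟨c1.of_eq rfl rfl, fun x' hx' => ?_⟩
    rcases Nat.lt_succ_iff_lt_or_eq.1 hx' with h | rfl
    · exact fun i p hp => (hI x' h i p hp).trans c2
    · exact c3
  · rintro s₇ fr₇ ⟨⟨v1, v2, v3⟩, hI⟩
    refine ⟨v1, fun a b c ha hb hc i p hp => ?_⟩
    -- The code is built from the top: `c` fills the highest block of digits, `b` the middle one,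
    -- `a` the lowest.
    obtain ⟨z, hz, -, hzc⟩ := exists_digitCount_eq (n + 4) (2 * q) c hc Nat.one_pos
    obtain ⟨y, hy, hyz, hyb⟩ := exists_digitCount_eq (n + 4) (2 * q) b hb hz
    obtain ⟨x, hx, hxy, hxa⟩ := exists_digitCount_eq (n + 4) (2 * q) a ha hy
    have hxW : x < W := by
      rw [hWe, pow_add, pow_add]
      simpa using hx
    have h := hI x hxW i p hp
    have hYx : Y x = y := hxy
    have hYy : Y y = z := hyz
    have hT : candT n q (A x) (A y) (A z) = candT n q a b c := by
      ext j
      have hj := j.2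
      simp only [candT, hA]
      rw [hxa j (by omega), hyb j (by omega), hzc j (by omega), hxa n (by omega)]
    rw [hYx, hYy, hT, hA, hxa _ (by omega), hxa _ (by omega), hxa _ (by omega)] at h
    exact abs_eval_le_of_score_le hf (h.trans v3)

end Enumeration

/-! ### The running time of the search -/

theorem card_support_le {n d : ℕ} {f : MvPolynomial (Fin n) ℝ} (hf : f.IsHomogeneous d) :
    #f.support ≤ n ^ d := by
  have h : f.support ⊆ (univ : Finset (Fin d → Fin n)).image SphereOpt.tupleType := by
    intro μ hμ
    obtain ⟨L, hL⟩ := SphereOpt.exists_tupleType_eq (ι := Fin d) μ (by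
      rw [Fintype.card_fin]; exact (hf.degree_eq_sum_deg_support hμ).symm)
    exact mem_image.2 ⟨L, mem_univ _, hL⟩
  refine (card_le_card h).trans (card_image_le.trans ?_)
  simp

/-- Since `n ≥ 2`, constants go into the exponent: `n + 5 ≤ n³` and `w ≤ n^w`. The exponents `6q`,
`3` and `k` give `18kq`. -/
theorem time_le {n q : ℕ} (hn : 2 ≤ n) (hq : 0 < q) {w k : ℕ} :
    w * ((n + 5) ^ (2 * q + (2 * q + 2 * q))) ^ k ≤ n ^ ((w + 18 * k) * q) := by
  have h1 : n + 5 ≤ n ^ 3 := by nlinarith [Nat.mul_le_mul hn hn]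
  have h2 : w ≤ n ^ (w * q) := (Nat.lt_pow_self (show 1 < n by omega)).le.trans
    (Nat.pow_le_pow_right (by omega) (Nat.le_mul_of_pos_right _ hq))
  calc w * ((n + 5) ^ (2 * q + (2 * q + 2 * q))) ^ k
      ≤ n ^ (w * q) * ((n ^ 3) ^ (2 * q + (2 * q + 2 * q))) ^ k := by gcongr
    _ = _ := by rw [← pow_mul, ← pow_mul, ← pow_add]; congr 1; ring

theorem exec_searchP {n d q : ℕ} {f : MvPolynomial (Fin n) ℝ} {s : State} (hd : 0 < d)
    (hdq : 2 * d ≤ q) (hqn : q ≤ n) (hf : f.IsHomogeneous d) (hs : HoldsInput s n d q f) :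
    ∃ t s', Exec searchP s t s' ∧ t ≤ n ^ ((searchP.weight + 18 * searchP.depth) * q) ∧
      ‖output n s'‖ = 1 ∧
      SphereOpt.CandidateBound f d q |eval (fun i => output n s' i) f| := by
  set W := (n + 5) ^ (2 * q + (2 * q + 2 * q)) with hW
  have hW0 : 0 < W := by positivity
  have hnW : n + 5 ≤ W := Nat.le_self_pow (by omega) _
  have hmW : #f.support ≤ W :=
    (card_support_le hf).trans ((Nat.pow_le_pow_left (by omega) d).trans
      (Nat.pow_le_pow_right (by omega) (by omega)))
  have hqW : 2 * q + (2 * q + 2 * q) ≤ W := (Nat.lt_pow_self (by omega)).le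
  obtain ⟨t, s', h1, h2, h3, h4⟩ := runs_searchP hs hf hd (by omega) hW0 hW hnW (by omega) hmW hqW
  refine ⟨t, s', h1, h2.trans ?_, ?_, h4⟩
  · exact time_le (by omega) (by omega)
  · rw [output, ← SphereOpt.nrm_eq_norm]; exact h3

/-- Every input is held by some state. -/
theorem exists_holdsInput (n d q : ℕ) (f : MvPolynomial (Fin n) ℝ) :
    ∃ s, HoldsInput s n d q f := by
  let μ : Fin #f.support ≃ f.support := f.support.equivFin.symm
  refine ⟨⟨fun i => if i = 0 then n else if i = 1 then d else if i = 2 then q else #f.support,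
    fun _ => 0, fun _ x => if h : x / n < #f.support ∧ 0 < n then
      (μ ⟨x / n, h.1⟩ : Fin n →₀ ℕ) ⟨x % n, Nat.mod_lt _ h.2⟩ else 0,
    fun _ j => if h : j < #f.support then f.coeff (μ ⟨j, h⟩ : Fin n →₀ ℕ) else 0⟩,
    rfl, rfl, rfl, rfl, μ, fun j => ⟨by simp, fun i => ?_⟩⟩
  have hn : 0 < n := i.pos
  have h1 : ((j : ℕ) * n + i) / n = j := by
    rw [mul_comm, Nat.mul_add_div hn, Nat.div_eq_of_lt i.2, add_zero]
  have h2 : ((j : ℕ) * n + i) % n = i := by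
    rw [mul_comm, Nat.mul_add_mod, Nat.mod_eq_of_lt i.2]
  simp only [h1, h2]
  rw [dif_pos ⟨j.2, hn⟩]

end RealRAM

/-! ### Taking roots and assembling the theorem -/

namespace SphereOpt

open MvPolynomial Finset

theorem abs_eval_le_supNorm {n : ℕ} (f : MvPolynomial (Fin n) ℝ) {x : EuclideanSpace ℝ (Fin n)}
    (hx : ‖x‖ = 1) : |eval (fun i => x i) f| ≤ supNorm f := by
  have hc : Continuous fun x : EuclideanSpace ℝ (Fin n) => |eval (fun i => x i) f| :=
    ((MvPolynomial.continuous_eval f).comp (by fun_prop)).abs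
  have hb : BddAbove (Set.range fun x : Metric.sphere (0 : EuclideanSpace ℝ (Fin n)) 1 =>
      |eval (fun i => x.1 i) f|) := by
    have h := ((isCompact_sphere (0 : EuclideanSpace ℝ (Fin n)) 1).image hc).bddAbove
    rwa [Set.image_eq_range] at h
  exact le_ciSup hb (⟨x, by simpa using hx⟩ : Metric.sphere (0 : EuclideanSpace ℝ (Fin n)) 1)

/-- The root sends the exponent `q` to `d` and, because `q = 2ρd`, the exponent `2ρ` to `1`. -/
theorem rpow_le_of_le {q d ρ : ℕ} (hq' : q = 2 * ρ * d) (hq : 0 < q) {Λ K a N : ℝ} {e : ℕ}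
    (hΛ : 0 ≤ Λ) (hK : 0 ≤ K) (ha : 0 ≤ a) (hN : 0 ≤ N)
    (h : Λ ≤ K ^ q * a ^ e * N ^ (2 * ρ)) :
    Λ ^ ((d : ℝ) / q) ≤ K ^ d * a ^ ((e : ℝ) * (d / q)) * N := by
  have hq0 : (q : ℝ) ≠ 0 := by exact_mod_cast hq.ne'
  have e2 : ((2 * ρ : ℕ) : ℝ) * ((d : ℝ) / q) = 1 := by
    rw [← mul_div_assoc, ← Nat.cast_mul, ← hq', div_self hq0]
  have e1 : (q : ℝ) * ((d : ℝ) / q) = d := mul_div_cancel₀ _ hq0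
  refine (Real.rpow_le_rpow hΛ h (by positivity)).trans (le_of_eq ?_)
  rw [Real.mul_rpow (by positivity) (by positivity), Real.mul_rpow (by positivity) (by positivity),
    ← Real.rpow_natCast K q, ← Real.rpow_natCast a e, ← Real.rpow_natCast N (2 * ρ),
    ← Real.rpow_mul hK, ← Real.rpow_mul ha, ← Real.rpow_mul hN, e1, e2, Real.rpow_one,
    Real.rpow_natCast]

/-- Non-negativity is needed for the monotonicity of the real power; it holds also when the set is
empty. -/
theorem constrainedSosValue_sq_nonneg {n D e : ℕ} (h : MvPolynomial (Fin n) ℝ) :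
    0 ≤ constrainedSosValue D e (h ^ 2) := by
  refine Real.sSup_nonneg ?_
  rintro v ⟨E, hE, -, hh, rfl⟩
  exact hE.sq_nonneg h hh

variable {n d q : ℕ} {f : MvPolynomial (Fin n) ℝ} {N : ℝ}

theorem exists_eq_of_dvd (hq : 0 < q) (hdq : 2 * d ∣ q) :
    ∃ ρ, q = 2 * ρ * d ∧ q / 2 = ρ * d ∧ q / d = 2 * ρ ∧ 2 * q / d = 2 * (2 * ρ) ∧ 0 < d ∧
      2 * d ≤ q := by
  have hd : 0 < d := by
    rcases Nat.eq_zero_or_pos d with rfl | h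
    · simp at hdq; omega
    · exact h
  obtain ⟨ρ, hρ⟩ := id hdq
  have h1 : q = 2 * ρ * d := by rw [hρ]; ring
  refine ⟨ρ, h1, ?_, ?_, ?_, hd, Nat.le_of_dvd hq hdq⟩
  · rw [h1, mul_assoc, Nat.mul_div_cancel_left _ two_pos]
  · rw [h1, Nat.mul_div_cancel _ hd]
  · rw [h1, ← mul_assoc, Nat.mul_div_cancel _ hd]

theorem sosValue_rpow_le_general (hq : 0 < q) (hqn : q ≤ n) (hdq : 2 * d ∣ q)
    (hf : f.IsHomogeneous d) (hN : 0 ≤ N) (hG : CandidateBound f d q N) (hd : 2 ≤ d) :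
    sosValue (q / 2) (f ^ (q / d)) ^ ((d : ℝ) / q) ≤
      2000000 ^ d * ((n : ℝ) / q) ^ ((d : ℝ) / 2 - 1) * N := by
  obtain ⟨ρ, hρ, e1, e2, -, -⟩ := exists_eq_of_dvd hq hdq
  obtain ⟨D, rfl⟩ : ∃ D, d = D + 2 := ⟨d - 2, by omega⟩
  rw [e1, e2]
  have h := rpow_le_of_le hρ hq (sosValue_nonneg (by omega) fun x => by
    rw [map_pow]; exact (even_two_mul ρ).pow_nonneg _) (by positivity) (by positivity) hN
    (sosValue_le_general hf hq hqn hρ hN hG)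
  convert h using 4
  -- What remains is the exponent: `ρ(d-2)·d/q = d/2 - 1`.
  have hq0 : (q : ℝ) ≠ 0 := by exact_mod_cast hq.ne'
  have hρ' : (q : ℝ) = 2 * ρ * ((D + 2 : ℕ) : ℝ) := by exact_mod_cast hρ
  rw [← mul_div_assoc, eq_div_iff hq0, hρ']
  push_cast
  ring

theorem constrainedSosValue_rpow_le (hq : 0 < q) (hqn : q ≤ n) (hdq : 2 * d ∣ q)
    (hf : f.IsHomogeneous d) (hN : 0 ≤ N) (hG : CandidateBound f d q N) (hd : 2 ≤ d)
    (hfn : ∀ μ, 0 ≤ f.coeff μ) :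
    constrainedSosValue q (2 * q / d) (f ^ (q / d)) ^ ((d : ℝ) / q) ≤
      2000000 ^ d * ((n : ℝ) / q) ^ ((d : ℝ) / 4 - 1 / 2) * N := by
  obtain ⟨ρ, hρ, -, e2, e3, -⟩ := exists_eq_of_dvd hq hdq
  obtain ⟨D, rfl⟩ : ∃ D, d = D + 2 := ⟨d - 2, by omega⟩
  rw [e2, e3]
  have h0 : 0 ≤ constrainedSosValue q (2 * (2 * ρ)) (f ^ (2 * ρ)) := by
    rw [mul_comm 2 ρ, pow_mul]; exact constrainedSosValue_sq_nonneg _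
  have h := rpow_le_of_le hρ hq h0 (by positivity) (by positivity) hN
    (constrainedSosValue_le_nonneg hf hfn hq hqn hρ hN hG)
  convert h using 3
  -- The square root halves the exponent: `(1/2)·ρ(d-2)·d/q = d/4 - 1/2`.
  rw [Real.sqrt_eq_rpow, ← Real.rpow_mul (by positivity)]
  congr 1
  have hq0 : (q : ℝ) ≠ 0 := by exact_mod_cast hq.ne'
  have hρ' : (q : ℝ) = 2 * ρ * ((D + 2 : ℕ) : ℝ) := by exact_mod_cast hρ
  rw [← mul_div_assoc, ← mul_div_assoc, eq_div_iff hq0, hρ']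
  push_cast
  ring

theorem sosValue_rpow_le_sparse (hq : 0 < q) (hqn : q ≤ n) (hdq : 2 * d ∣ q)
    (hf : f.IsHomogeneous d) (hN : 0 ≤ N) (hG : CandidateBound f d q N) :
    sosValue (q / 2) (f ^ (q / d)) ^ ((d : ℝ) / q) ≤
      2000000 ^ d * √(max 1 ((#f.support : ℝ) / q)) * N := by
  obtain ⟨ρ, hρ, e1, e2, -, -⟩ := exists_eq_of_dvd hq hdq
  rw [e1, e2]
  have h := rpow_le_of_le hρ hq (sosValue_nonneg (by omega) fun x => by
    rw [map_pow]; exact (even_two_mul ρ).pow_nonneg _) (by positivity) (by positivity) hN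
    (sosValue_le_sparse hf hq hqn hρ hN hG)
  have hq0 : (q : ℝ) ≠ 0 := by exact_mod_cast hq.ne'
  have e4 : ((2 * ρ : ℕ) : ℝ) * ((d : ℝ) / q) = 1 := by
    rw [← mul_div_assoc, ← Nat.cast_mul, ← hρ, div_self hq0]
  rw [e4, Real.rpow_one] at h
  refine h.trans ?_
  gcongr
  norm_num

end SphereOpt

theorem mainTheorem1 :
    ∃ C : ℝ, 0 < C ∧
      -- the approximation guarantees
      (∀ (n d q : ℕ) (f : MvPolynomial (Fin n) ℝ),
        0 < q → q ≤ n → 2 * d ∣ q → f.IsHomogeneous d →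
        (2 ≤ d →
          SphereOpt.sosValue (q / 2) (f ^ (q / d)) ^ ((d : ℝ) / q) ≤
            C ^ d * ((n : ℝ) / q) ^ ((d : ℝ) / 2 - 1) * SphereOpt.supNorm f) ∧
        (2 ≤ d → (∀ μ, 0 ≤ f.coeff μ) →
          SphereOpt.constrainedSosValue q (2 * q / d) (f ^ (q / d)) ^ ((d : ℝ) / q) ≤
            C ^ d * ((n : ℝ) / q) ^ ((d : ℝ) / 4 - 1 / 2) * SphereOpt.supNorm f) ∧
        SphereOpt.sosValue (q / 2) (f ^ (q / d)) ^ ((d : ℝ) / q) ≤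
          C ^ d * Real.sqrt (max 1 ((f.support.card : ℝ) / q)) * SphereOpt.supNorm f) ∧
      -- the algorithm
      ∃ (P : RealRAM.Prog) (c : ℕ),
        ∀ (n d q : ℕ) (f : MvPolynomial (Fin n) ℝ),
          0 < q → q ≤ n → 2 * d ∣ q → f.IsHomogeneous d →
          ∀ s : RealRAM.State, RealRAM.HoldsInput s n d q f →
            ∃ (t : ℕ) (s' : RealRAM.State), RealRAM.Exec P s t s' ∧ t ≤ n ^ (c * q) ∧
              ∃ x : EuclideanSpace ℝ (Fin n), x = RealRAM.output n s' ∧ ‖x‖ = 1 ∧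
                (2 ≤ d →
                  SphereOpt.sosValue (q / 2) (f ^ (q / d)) ^ ((d : ℝ) / q) /
                      (C ^ d * ((n : ℝ) / q) ^ ((d : ℝ) / 2 - 1)) ≤
                    |MvPolynomial.eval (fun i => x i) f|) ∧
                (2 ≤ d → (∀ μ, 0 ≤ f.coeff μ) →
                  SphereOpt.constrainedSosValue q (2 * q / d) (f ^ (q / d)) ^ ((d : ℝ) / q) /
                      (C ^ d * ((n : ℝ) / q) ^ ((d : ℝ) / 4 - 1 / 2)) ≤
                    |MvPolynomial.eval (fun i => x i) f|) ∧
                SphereOpt.sosValue (q / 2) (f ^ (q / d)) ^ ((d : ℝ) / q) /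
                    (C ^ d * Real.sqrt (max 1 ((f.support.card : ℝ) / q))) ≤
                  |MvPolynomial.eval (fun i => x i) f| := by
  refine ⟨2000000, by norm_num, fun n d q f hq hqn hdq hf => ?_, RealRAM.searchP,
    RealRAM.searchP.weight + 18 * RealRAM.searchP.depth, fun n d q f hq hqn hdq hf s hs => ?_⟩
  -- The inequalities are read off from a run of the program: its output is a unit vector satisfying
  -- the candidate bound with `N = |f x|`, and this is at most `supNorm f`.
  · obtain ⟨s, hs⟩ := RealRAM.exists_holdsInput n d q f
    obtain ⟨-, -, -, -, -, hd, hdq'⟩ := SphereOpt.exists_eq_of_dvd hq hdq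
    obtain ⟨t, s', -, -, h1, hG⟩ := RealRAM.exec_searchP hd hdq' hqn hf hs
    have hle := SphereOpt.abs_eval_le_supNorm f h1
    refine ⟨fun h2 => ?_, fun h2 hfn => ?_, ?_⟩
    · exact (SphereOpt.sosValue_rpow_le_general hq hqn hdq hf (abs_nonneg _) hG h2).trans
        (mul_le_mul_of_nonneg_left hle (by positivity))
    · exact (SphereOpt.constrainedSosValue_rpow_le hq hqn hdq hf (abs_nonneg _) hG h2 hfn).trans
        (mul_le_mul_of_nonneg_left hle (by positivity))
    · exact (SphereOpt.sosValue_rpow_le_sparse hq hqn hdq hf (abs_nonneg _) hG).trans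
        (mul_le_mul_of_nonneg_left hle (by positivity))
  · obtain ⟨-, -, -, -, -, hd, hdq'⟩ := SphereOpt.exists_eq_of_dvd hq hdq
    have hq0 : (0 : ℝ) < q := by exact_mod_cast hq
    have hn0 : (0 : ℝ) < n := by exact_mod_cast hq.trans_le hqn
    have hpos : ∀ e : ℝ, 0 < (2000000 : ℝ) ^ d * ((n : ℝ) / q) ^ e := fun e => by positivity
    have hpos' : 0 < (2000000 : ℝ) ^ d * √(max 1 ((f.support.card : ℝ) / q)) := by positivity
    obtain ⟨t, s', ht, htle, h1, hG⟩ := RealRAM.exec_searchP hd hdq' hqn hf hs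
    refine ⟨t, s', ht, htle, RealRAM.output n s', rfl, h1, fun h2 => ?_, fun h2 hfn => ?_, ?_⟩
    · rw [div_le_iff₀' (hpos _)]
      exact SphereOpt.sosValue_rpow_le_general hq hqn hdq hf (abs_nonneg _) hG h2
    · rw [div_le_iff₀' (hpos _)]
      exact SphereOpt.constrainedSosValue_rpow_le hq hqn hdq hf (abs_nonneg _) hG h2 hfn
    · rw [div_le_iff₀' hpos']
      exact SphereOpt.sosValue_rpow_le_sparse hq hqn hdq hf (abs_nonneg _) hG
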